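/- **Setting.** Let $\Omega\subset\mathbb R^3$ be a bounded domain with Lipschitz boundary and (a.e. defined) outer unit normal $n$, let $\Gamma_D\subset\partial\Omega$ be measurable, $\Gamma_N=\partial\Omega\setminus\Gamma_D$, and $T,\rho,\gamma>0$. Write $\mathbb D(v),\mathbb W(v)$ for the symmetric and skew-symmetric part of $\nabla v=(\partial_jv_i)_{ij}$, $\operatorname{dev}A=A-\frac13(\operatorname{tr}A)\mathbb I$, and $\mathbb S(v)=\mathbb L[\mathbb D(v)]$ with $\mathbb L:\mathbb R^{3\times3}_{\rm sym}\to\mathbb R^{3\times3}_{\rm sym}$ linear. Let $\varphi\in C^3(\mathbb R^{3\times3}_{\rm sym};[0,\infty))$ be strongly convex, with $1+\varphi(A)\ge\beta|A|^2$ for some $\beta>0$, bounded $D^3\varphi$, and $D\varphi(A)A=A\,D\varphi(A)$ for all $A$; put $\mathbb T=D\varphi(\mathbb E)+\varphi(\mathbb E)\mathbb I$. Let $\mathcal P:L^1(\Omega;\mathbb R^{3\times3}_{{\rm sym},0})\to[0,\infty]$ (symmetric trace-free matrices) be convex and lower semicontinuous with $\mathcal P(0)=0$, let $f\in L^1(0,T;L^2(\Omega;\mathbb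 R^3))$, and let $v_0\in L^1(\Omega;\mathbb R^3)$, $\mathbb E_0\in L^1(\Omega;\mathbb R^{3\times3}_{\rm sym})$ have finite energy, where $\mathcal E(v,\mathbb E)=\int_\Omega\frac\rho2|v|^2+\varphi(\mathbb E)\,dx$. **Weak solutions.** $(v,\mathbb E)$ is a weak solution if $v$ and $\mathbb E$ lie in $L^\infty(0,T;L^2)\cap L^2(0,T;H^1)$ with values in $\mathbb R^3$ and $\mathbb R^{3\times3}_{\rm sym}$, $\varphi(\mathbb E)\in L^\infty(0,T;L^1)$, $D\varphi(\mathbb E)\in L^2(0,T;H^1)$, $v=0$ on $(0,T)\times\Gamma_D$ and $v\cdot n=0$ on $(0,T)\times\Gamma_N$ in the sense of traces, and $$\begin{aligned} &\Big[\mathcal E(v,\mathbb E)-\int_\Omega\rho v\cdot\psi+\mathbb E:\Psi\,dx\Big]_s^t+\int_s^t\!\!\int_\Omega \mathbb S(v):\mathbb D(v)+\gamma|\nabla[D\varphi(\mathbb E)]|^2-f\cdot v\\ &+\int_s^t\!\!\int_\Omega\rho v\cdot\partial_t\psi+\tfrac\rho2(\operatorname{div}v)(v\cdot\psi)+\rho(v\otimes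 v):\nabla\psi-(\mathbb S(v)+D\varphi(\mathbb E)):\mathbb D(\psi)-\varphi(\mathbb E)\operatorname{div}\psi+f\cdot\psi\\ &+\int_s^t\!\!\int_\Omega\mathbb E:\partial_t\Psi+(\operatorname{div}v)\mathbb E:\Psi+(v\cdot\nabla\Psi):\mathbb E-(\mathbb E\mathbb W(v)-\mathbb W(v)\mathbb E):\Psi+\mathbb D(v):\Psi-\gamma\nabla[D\varphi(\mathbb E)]:\nabla\Psi\\ &+\int_s^t\mathcal P(\operatorname{dev}D\varphi(\mathbb E))\,d\tau\ \le\ \int_s^t\mathcal P(\operatorname{dev}\Psi)\,d\tau \end{aligned}$$ for all $\psi\in C^1_c([0,T)\times\overline\Omega;\mathbb R^3)$ with $\psi=0$ on $(0,T)\times\Gamma_D$, $\psi\cdot n=0$ on $(0,T)\times\Gamma_N$, all $\Psi\in C^1_c([0,T)\times\overline\Omega;\mathbb R^{3\times3}_{\rm sym})$ and a.a. $s<t$ in $(0,T)$, and also for $s=0$ and a.a. $t$ with $(v,\mathbb E)(s)$ replaced by $(v_0,\mathbb E_0)$. **Proposition.** Assume that for all $A\in L^1(\Omega;\mathbb R^{3\times3}_{{\rm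 sym},0})$ and $G\in C^2(\partial\Omega;\mathbb R^{3\times3}_{{\rm sym},0})$ there are $\Phi_j\in C^1(\overline\Omega;\mathbb R^{3\times3}_{{\rm sym},0})$ with $\Phi_j|_{\partial\Omega}=G$, $\Phi_j\rightharpoonup A$ weakly in $L^1$ and $\mathcal P(\Phi_j)\to\mathcal P(A)$. (Here $C^2(\partial\Omega)$ denotes the restrictions of $C^2(\overline\Omega)$ functions.) Let $(v,\mathbb E)$ be a weak solution with $v\in C^1([0,T];C^2(\overline\Omega;\mathbb R^3))$ and $\mathbb E\in C^1([0,T];C^2(\overline\Omega;\mathbb R^{3\times3}_{\rm sym}))$. Then it is a strong solution: 1. $\rho(\partial_tv+v\cdot\nabla v)=\operatorname{div}(\mathbb S(v)+\mathbb T)-\frac\rho2(\operatorname{div}v)v+f$ a.e. in $(0,T)\times\Omega$; 2. for every $t\in(0,T)$ there is $\Xi(t)\in L^\infty(\Omega;\mathbb R^{3\times3}_{{\rm sym},0})$ with $\Xi(t)\in\partial\mathcal P(\operatorname{dev}\mathbb T(t))$ (convex subdifferential, $L^1$–$L^\infty$ duality) and $\partial_t\mathbb E+v\cdot\nabla\mathbb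 E+\mathbb E\mathbb W(v)-\mathbb W(v)\mathbb E+\Xi=\mathbb D(v)+\gamma\Delta[D\varphi(\mathbb E)]$ at every point of $\Omega$; 3. for every $t\in(0,T)$: $v=0$ a.e. on $\Gamma_D$, $v\cdot n=0$ a.e. on $\Gamma_N$, and $n\cdot\nabla[D\varphi(\mathbb E)]=0$ a.e. on $\partial\Omega$; 4. for every $t\in(0,T)$, the tangential part of $(\mathbb T+\mathbb S(v))n$ vanishes at every point of $\Gamma_N$ that has a neighbourhood in which $\partial\Omega$ is a $C^2$ surface and $\Gamma_D$ is a null set (thus a.e. on $\Gamma_N$ if a.e. point of $\Gamma_N$ is of this kind); 5. $v(0)=v_0$ a.e. in $\Omega$; and $\mathbb E(0)=\mathbb E_0$ a.e. in $\Omega$, provided that either $\mathbb E_0$ is bounded and $\mathcal P(\operatorname{dev}D\varphi(\mathbb E_0))<\infty$, or $\mathcal P$ is finite on $C_c^\infty(\Omega;\mathbb R^{3\times3}_{{\rm sym},0})$. -/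

import Mathlib

open MeasureTheory Set Filter Topology
open scoped ENNReal NNReal RealInnerProductSpace ContDiff Laplacian

noncomputable section

namespace ViscoPlast

/-! ### Vectors, matrices, and the spaces of symmetric and of symmetric trace-free matrices -/

/-- Three-dimensional Euclidean space. -/
abbrev Vec := EuclideanSpace ℝ (Fin 3)

/-- Real 3×3 matrices with the Frobenius inner product; the entry in row `i` and column `j`
of `A` is `A (i, j)`. -/
abbrev Mat := EuclideanSpace ℝ (Fin 3 × Fin 3)

/-- The trace of a matrix. -/
def tr (A : Mat) : ℝ := ∑ i, A (i, i)

/-- The matrix product. -/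
def matMul (A B : Mat) : Mat := WithLp.toLp 2 fun p => ∑ k, A (p.1, k) * B (k, p.2)

/-- The matrix-vector product. -/
def matVec (A : Mat) (w : Vec) : Vec := WithLp.toLp 2 fun i => ∑ j, A (i, j) * w j

/-- The symmetric matrices. -/
def symSubmodule : Submodule ℝ Mat where
  carrier := {A | ∀ i j, A (i, j) = A (j, i)}
  add_mem' := by
    intro A B hA hB i j
    simp [hA i j, hB i j]
  zero_mem' := by intro i j; simp
  smul_mem' := by
    intro c A hA i j
    simp [hA i j]

/-- The symmetric matrices with vanishing trace. -/
def devSubmodule : Submodule ℝ Mat where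
  carrier := {A | (∀ i j, A (i, j) = A (j, i)) ∧ tr A = 0}
  add_mem' := by
    rintro A B ⟨hA, hA0⟩ ⟨hB, hB0⟩
    refine ⟨fun i j => by simp [hA i j, hB i j], ?_⟩
    simp only [tr] at hA0 hB0 ⊢
    simp [Finset.sum_add_distrib, hA0, hB0]
  zero_mem' := ⟨by intro i j; simp, by simp [tr]⟩
  smul_mem' := by
    rintro c A ⟨hA, hA0⟩
    refine ⟨fun i j => by simp [hA i j], ?_⟩
    simp only [tr] at hA0 ⊢
    simp [← Finset.mul_sum, hA0]

/-- The inner product space of symmetric 3×3 matrices. -/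
abbrev Sym := ↥symSubmodule

/-- The inner product space of symmetric trace-free 3×3 matrices. -/
abbrev Dev := ↥devSubmodule

/-- The identity matrix. -/
def idSym : Sym :=
  ⟨WithLp.toLp 2 fun p => if p.1 = p.2 then 1 else 0, by intro i j; simp [eq_comm]⟩

/-- The deviatoric part `A - (tr A / 3) I` of a symmetric matrix. -/
def dev (A : Sym) : Dev :=
  ⟨((A - (tr A / 3) • idSym : Sym) : Mat), (A - (tr A / 3) • idSym : Sym).2, by
    simp [tr, idSym, Fin.sum_univ_three]
    ring⟩

/-! ### Pointwise differential expressions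

A gradient of a vector field at a point is a linear map `G`; its matrix has the entries
`∂_j v_i` in row `i` and column `j`. -/

/-- The `k`-th standard unit vector. -/
def unitVec (k : Fin 3) : Vec := EuclideanSpace.single k 1

/-- The matrix of a velocity gradient. -/
def gradMat (G : Vec →L[ℝ] Vec) : Mat := WithLp.toLp 2 fun p => G (unitVec p.2) p.1

/-- The divergence. -/
def divg (G : Vec →L[ℝ] Vec) : ℝ := tr (gradMat G)

/-- The symmetric part `𝔻` of the velocity gradient. -/
def symGrad (G : Vec →L[ℝ] Vec) : Sym :=
  ⟨WithLp.toLp 2 fun p => (gradMat G (p.1, p.2) + gradMat G (p.2, p.1)) / 2, by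
    intro i j; simp [add_comm]⟩

/-- The skew-symmetric part `𝕎` of the velocity gradient. -/
def skewGrad (G : Vec →L[ℝ] Vec) : Mat :=
  WithLp.toLp 2 fun p => (gradMat G (p.1, p.2) - gradMat G (p.2, p.1)) / 2

/-- The corotational term `A 𝕎 - 𝕎 A`. -/
def corot (A : Sym) (G : Vec →L[ℝ] Vec) : Mat :=
  matMul A (skewGrad G) - matMul (skewGrad G) A

/-- The full contraction of two gradients of matrix fields. -/
def tripleDot (G H : Vec →L[ℝ] Sym) : ℝ := ∑ k, ⟪G (unitVec k), H (unitVec k)⟫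

/-- The row-wise divergence of a matrix field: `(div S)_i = ∑_j ∂_j S_ij`. -/
def matDiv (S : Vec → Sym) (x : Vec) : Vec :=
  WithLp.toLp 2 fun i => ∑ j, ((fderiv ℝ S x (unitVec j) : Sym) : Mat) (i, j)

/-! ### Domains and their boundaries -/

/-- Near `x₀` the set `Ω` is, in suitable Cartesian coordinates, the region strictly below the
graph of `g`. -/
def IsLocalSubgraph (Ω : Set Vec) (x₀ : Vec) (g : EuclideanSpace ℝ (Fin 2) → ℝ) : Prop :=
  ∃ A : Vec ≃ₗᵢ[ℝ] Vec, ∃ ε > 0, ∀ y ∈ Metric.ball x₀ ε,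
    (y ∈ Ω ↔ A y 2 < g !₂[A y 0, A y 1])

/-- Bounded domains with Lipschitz boundary. -/
structure IsLipschitzDomain (Ω : Set Vec) : Prop where
  isOpen : IsOpen Ω
  isConnected : IsConnected Ω
  isBounded : Bornology.IsBounded Ω
  lipschitz : ∀ x ∈ frontier Ω, ∃ K : ℝ≥0, ∃ g : EuclideanSpace ℝ (Fin 2) → ℝ,
    LipschitzWith K g ∧ IsLocalSubgraph Ω x g

/-- The surface measure, up to a constant factor (only its null sets are used): the
two-dimensional Hausdorff measure. -/
def surf : Measure Vec := Measure.hausdorffMeasure 2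

/-- `n` is the outer unit normal of `Ω` at `x`: to first order, `Ω` agrees near `x` with the half
space `{y | ⟪y - x, n⟫ < 0}`. Such an `n` is unique if it exists. If `Ω` is bounded by a Lipschitz
graph, it exists wherever the graph function is differentiable, hence at almost every boundary
point, and is the usual normal of the graph. -/
def IsOuterNormal (Ω : Set Vec) (x n : Vec) : Prop :=
  ‖n‖ = 1 ∧ ∀ ε > 0, ∀ᶠ y in 𝓝 x,
    (y ∈ Ω → ⟪y - x, n⟫ ≤ ε * ‖y - x‖) ∧ (y ∉ Ω → -(ε * ‖y - x‖) ≤ ⟪y - x, n⟫)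

/-- The boundary trace of `u` at `x` is `g`: the averages of `|u - g|` over the part in `Ω` of
small balls around `x` tend to zero. A Sobolev function on a Lipschitz domain has its
boundary trace in this sense at almost every boundary point. -/
def HasTraceAt (Ω : Set Vec) (u : Vec → Vec) (x g : Vec) : Prop :=
  Tendsto (fun r : ℝ => ⨍⁻ y in Metric.ball x r ∩ Ω, ‖u y - g‖ₑ ∂volume) (𝓝[>] 0) (𝓝 0)

/-! ### Function spaces -/

section Spaces

variable {F : Type*} [NormedAddCommGroup F] [NormedSpace ℝ F]

/-- `Du` is the weak gradient of `u` on `Ω`. -/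
def HasWeakGradient (Ω : Set Vec) (u : Vec → F) (Du : Vec → Vec →L[ℝ] F) : Prop :=
  ∀ χ : Vec → ℝ, ContDiff ℝ ∞ χ → HasCompactSupport χ → tsupport χ ⊆ Ω → ∀ e : Vec,
    ∫ x in Ω, (fderiv ℝ χ x e) • u x = -∫ x in Ω, χ x • Du x e

/-- Lebesgue measure on the space-time cylinder. -/
def cyl (Ω : Set Vec) (T : ℝ) : Measure (ℝ × Vec) :=
  (volume.restrict (Ioo 0 T)).prod (volume.restrict Ω)

/-- The space `L^∞(0,T; L^p(Ω))`. -/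
def MemLinftyLp (Ω : Set Vec) (T : ℝ) (p : ℝ≥0∞) (u : ℝ → Vec → F) : Prop :=
  AEStronglyMeasurable (Function.uncurry u) (cyl Ω T) ∧
    ∃ C : ℝ≥0, ∀ᵐ t ∂(volume.restrict (Ioo 0 T)), MemLp (u t) p (volume.restrict Ω) ∧
      eLpNorm (u t) p (volume.restrict Ω) ≤ C

/-- `u` belongs to `L²(0,T; H¹(Ω))` and has the spatial weak gradient `Du`. -/
def MemL2H1 (Ω : Set Vec) (T : ℝ) (u : ℝ → Vec → F) (Du : ℝ → Vec → Vec →L[ℝ] F) : Prop :=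
  MemLp (Function.uncurry u) 2 (cyl Ω T) ∧ MemLp (Function.uncurry Du) 2 (cyl Ω T) ∧
    ∀ᵐ t ∂(volume.restrict (Ioo 0 T)), HasWeakGradient Ω (u t) (Du t)

/-- The space `C([0,T]; C²(Ω̄))`. -/
def MemC0C2 (Ω : Set Vec) (T : ℝ) (u : ℝ → Vec → F) : Prop :=
  (∀ t ∈ Icc 0 T, ContDiffOn ℝ 2 (u t) (closure Ω)) ∧
    ∀ k ≤ 2, ContinuousOn
      (fun p : ℝ × Vec => iteratedFDerivWithin ℝ k (u p.1) (closure Ω) p.2)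
      (Icc 0 T ×ˢ closure Ω)

/-- The space `C¹([0,T]; C²(Ω̄))`. -/
def MemC1C2 (Ω : Set Vec) (T : ℝ) (u : ℝ → Vec → F) : Prop :=
  MemC0C2 Ω T u ∧ ∃ du : ℝ → Vec → F, MemC0C2 Ω T du ∧
    ∀ t ∈ Icc 0 T, ∀ x ∈ closure Ω,
      HasDerivWithinAt (fun s => u s x) (du t x) (Icc 0 T) t

/-- The space `C¹_c([0,T) × Ω̄)` of test functions, for bounded `Ω`. -/
def IsTestFunction (Ω : Set Vec) (T : ℝ) (u : ℝ → Vec → F) : Prop :=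
  ContDiffOn ℝ 1 (Function.uncurry u) (Ico 0 T ×ˢ closure Ω) ∧
    ∃ τ < T, ∀ t ∈ Ico 0 T, τ ≤ t → ∀ x ∈ closure Ω, u t x = 0

end Spaces

/-! ### Dissipation potentials on `L¹(Ω)` and stored energies -/

/-- The space `L¹(Ω; Dev)`. -/
abbrev DevL1 (Ω : Set Vec) := Lp Dev 1 (volume.restrict Ω)

open Classical in
/-- The value of the potential `P` at the class of the function `u`, and `∞` if `u` is not in
`L¹(Ω)`. -/
def potVal {Ω : Set Vec} (P : DevL1 Ω → ℝ≥0∞) (u : Vec → Dev) : ℝ≥0∞ :=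
  if h : MemLp u 1 (volume.restrict Ω) then P (h.toLp u) else ⊤

/-- Convex lower semicontinuous potentials with values in `[0,∞]` that vanish at `0`. -/
structure IsDissipationPotential {Ω : Set Vec} (P : DevL1 Ω → ℝ≥0∞) : Prop where
  convex : ∀ A B : DevL1 Ω, ∀ a b : ℝ, 0 ≤ a → 0 ≤ b → a + b = 1 →
    P (a • A + b • B) ≤ ENNReal.ofReal a * P A + ENNReal.ofReal b * P B
  lsc : LowerSemicontinuous P
  zero : P 0 = 0

/-- `Ξ`, an element of the dual space `L^∞(Ω; Dev)`, belongs to the convex subdifferential of `P`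
at (the class of) `A`. -/
def IsSubgradient {Ω : Set Vec} (P : DevL1 Ω → ℝ≥0∞) (A Ξ : Vec → Dev) : Prop :=
  MemLp Ξ ⊤ (volume.restrict Ω) ∧ potVal P A ≠ ⊤ ∧
    ∀ B : DevL1 Ω,
      (potVal P A : EReal) + ((∫ x in Ω, ⟪Ξ x, B x - A x⟫ : ℝ) : EReal) ≤ (P B : EReal)

/-- The approximation property of the potential: every `A ∈ L¹(Ω; Dev)` is, for any prescribed
boundary values of class `C²`, the weak limit in `L¹` of functions `Φ j ∈ C¹(Ω̄; Dev)` with these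
boundary values and with `P (Φ j) → P A`. Boundary values of class `C²` are those of
`C²(Ω̄)` functions. -/
def HasApproximationProperty {Ω : Set Vec} (P : DevL1 Ω → ℝ≥0∞) : Prop :=
  ∀ A : DevL1 Ω, ∀ G : Vec → Dev, ContDiffOn ℝ 2 G (closure Ω) →
    ∃ (Φ : ℕ → Vec → Dev) (Φc : ℕ → DevL1 Ω),
      (∀ j, ContDiffOn ℝ 1 (Φ j) (closure Ω)) ∧
      (∀ j, ∀ x ∈ frontier Ω, Φ j x = G x) ∧
      (∀ j, ⇑(Φc j) =ᵐ[volume.restrict Ω] Φ j) ∧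
      (∀ ℓ : DevL1 Ω →L[ℝ] ℝ, Tendsto (fun j => ℓ (Φc j)) atTop (𝓝 (ℓ A))) ∧
      Tendsto (fun j => P (Φc j)) atTop (𝓝 (P A))

/-- The assumptions on the stored elastic energy: nonnegative, of class `C³`, strongly convex, of
at least quadratic growth, with bounded third derivative, and with a derivative that commutes with
its argument. -/
structure IsStoredEnergy (φ : Sym → ℝ) : Prop where
  contDiff : ContDiff ℝ 3 φ
  nonneg : ∀ A, 0 ≤ φ A
  stronglyConvex : ∃ κ > 0, ConvexOn ℝ univ fun A => φ A - κ / 2 * ‖A‖ ^ 2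
  growth : ∃ β > 0, ∀ A, β * ‖A‖ ^ 2 ≤ 1 + φ A
  thirdDeriv : ∃ M : ℝ, ∀ A, ‖iteratedFDeriv ℝ 3 φ A‖ ≤ M
  commute : ∀ A : Sym, matMul (gradient φ A : Sym) A = matMul A (gradient φ A : Sym)

/-! ### The regularized system -/

/-- The data of the problem. -/
structure Data where
  /-- the spatial domain -/
  Ω : Set Vec
  /-- the Dirichlet part of the boundary -/
  ΓD : Set Vec
  /-- the time horizon -/
  T : ℝ
  /-- the mass density -/
  ρ : ℝ
  /-- the diffusion coefficient -/
  γ : ℝ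
  /-- the linear viscous stress as a function of the symmetric velocity gradient -/
  L : Sym →ₗ[ℝ] Sym
  /-- the stored elastic energy -/
  φ : Sym → ℝ
  /-- the (dual) dissipation potential -/
  P : DevL1 Ω → ℝ≥0∞
  /-- the external force -/
  f : ℝ → Vec → Vec
  /-- the initial velocity -/
  v₀ : Vec → Vec
  /-- the initial elastic strain -/
  E₀ : Vec → Sym

namespace Data

variable (d : Data)

/-- The slip part of the boundary. -/
def ΓN : Set Vec := frontier d.Ω \ d.ΓD

/-- The density of the total energy. -/
def energyDensity (v : Vec → Vec) (E : Vec → Sym) (x : Vec) : ℝ :=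
  d.ρ / 2 * ‖v x‖ ^ 2 + d.φ (E x)

/-- The stress `𝕋 = Dφ(𝔼) + φ(𝔼) 𝕀`. -/
def elasticStress (A : Sym) : Sym := gradient d.φ A + d.φ A • idSym

/-- The total stress `𝕊(v) + 𝕋`, for the velocity gradient `G` and the elastic strain `A`. -/
def totalStress (G : Vec →L[ℝ] Vec) (A : Sym) : Sym := d.L (symGrad G) + d.elasticStress A

/-- The standing assumptions on the data. The energy density of the initial data is nonnegative,
so that its integrability says that the initial energy is finite. -/
structure Standing : Prop where
  domain : IsLipschitzDomain d.Ω
  ΓD_subset : d.ΓD ⊆ frontier d.Ω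
  ΓD_measurable : MeasurableSet d.ΓD
  T_pos : 0 < d.T
  ρ_pos : 0 < d.ρ
  γ_pos : 0 < d.γ
  energy : IsStoredEnergy d.φ
  potential : IsDissipationPotential d.P
  f_measurable : AEStronglyMeasurable (Function.uncurry d.f) (cyl d.Ω d.T)
  f_integrable : ∫⁻ t in Ioo 0 d.T, eLpNorm (d.f t) 2 (volume.restrict d.Ω) < ⊤
  v₀_integrable : IntegrableOn d.v₀ d.Ω
  E₀_integrable : IntegrableOn d.E₀ d.Ω
  finite_energy : IntegrableOn (d.energyDensity d.v₀ d.E₀) d.Ω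

/-- The test functions for the momentum equation. -/
def IsVelocityTest (ψ : ℝ → Vec → Vec) : Prop :=
  IsTestFunction d.Ω d.T ψ ∧
    (∀ t ∈ Ioo 0 d.T, ∀ᵐ x ∂(surf.restrict d.ΓD), ψ t x = 0) ∧
    (∀ t ∈ Ioo 0 d.T, ∀ᵐ x ∂(surf.restrict d.ΓN), ∀ n, IsOuterNormal d.Ω x n → ⟪ψ t x, n⟫ = 0)

/-- The expression `𝓔(v,E) - ∫ ρ v·ψ + E:Ψ`, of which the weak formulation contains the
increment in time. -/
def energyPairing (v : Vec → Vec) (E : Vec → Sym) (ψ : Vec → Vec) (Ψ : Vec → Sym) : ℝ :=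
  (∫ x in d.Ω, d.energyDensity v E x) - ∫ x in d.Ω, (d.ρ * ⟪v x, ψ x⟫ + ⟪E x, Ψ x⟫)

/-- The integrand over space-time in the weak formulation, where `Gv` is the gradient of `v` and
`GS` is the gradient of `Dφ(E)`. -/
def weakIntegrand (v : ℝ → Vec → Vec) (Gv : ℝ → Vec → Vec →L[ℝ] Vec)
    (E : ℝ → Vec → Sym) (GS : ℝ → Vec → Vec →L[ℝ] Sym)
    (ψ : ℝ → Vec → Vec) (Ψ : ℝ → Vec → Sym) (t : ℝ) (x : Vec) : ℝ :=
  (⟪d.L (symGrad (Gv t x)), symGrad (Gv t x)⟫ + d.γ * tripleDot (GS t x) (GS t x)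
      - ⟪d.f t x, v t x⟫)
    + (d.ρ * ⟪v t x, deriv (fun s => ψ s x) t⟫ + d.ρ / 2 * divg (Gv t x) * ⟪v t x, ψ t x⟫
      + d.ρ * ⟪v t x, fderiv ℝ (ψ t) x (v t x)⟫)
    + (-⟪d.L (symGrad (Gv t x)) + gradient d.φ (E t x), symGrad (fderiv ℝ (ψ t) x)⟫
      - d.φ (E t x) * divg (fderiv ℝ (ψ t) x) + ⟪d.f t x, ψ t x⟫)
    + (⟪E t x, deriv (fun s => Ψ s x) t⟫ + divg (Gv t x) * ⟪E t x, Ψ t x⟫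
      + ⟪fderiv ℝ (Ψ t) x (v t x), E t x⟫ - ⟪corot (E t x) (Gv t x), (Ψ t x : Mat)⟫)
    + (⟪symGrad (Gv t x), Ψ t x⟫ - d.γ * tripleDot (GS t x) (fderiv ℝ (Ψ t) x))

/-- The inequality of the weak formulation on the time interval `(s,t)`, where `vs`, `Es` are the
values of the solution at time `s`. It holds trivially if `P(dev Ψ)` is not integrable. -/
def WeakInequality (v : ℝ → Vec → Vec) (Gv : ℝ → Vec → Vec →L[ℝ] Vec)
    (E : ℝ → Vec → Sym) (GS : ℝ → Vec → Vec →L[ℝ] Sym)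
    (ψ : ℝ → Vec → Vec) (Ψ : ℝ → Vec → Sym) (s t : ℝ) (vs : Vec → Vec) (Es : Vec → Sym) : Prop :=
  ((d.energyPairing (v t) (E t) (ψ t) (Ψ t) - d.energyPairing vs Es (ψ s) (Ψ s)
      + ∫ τ in s..t, ∫ x in d.Ω, d.weakIntegrand v Gv E GS ψ Ψ τ x : ℝ) : EReal)
    + ((∫⁻ τ in Ioo s t, potVal d.P fun x => dev (gradient d.φ (E τ x)) : ℝ≥0∞) : EReal)
    ≤ ((∫⁻ τ in Ioo s t, potVal d.P fun x => dev (Ψ τ x) : ℝ≥0∞) : EReal)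

/-- Weak solutions of the regularized system. -/
def IsWeakSolution (v : ℝ → Vec → Vec) (E : ℝ → Vec → Sym) : Prop :=
  ∃ (Gv : ℝ → Vec → Vec →L[ℝ] Vec) (GE GS : ℝ → Vec → Vec →L[ℝ] Sym),
    MemLinftyLp d.Ω d.T 2 v ∧ MemL2H1 d.Ω d.T v Gv ∧
    MemLinftyLp d.Ω d.T 2 E ∧ MemL2H1 d.Ω d.T E GE ∧
    MemLinftyLp d.Ω d.T 1 (fun t x => d.φ (E t x)) ∧
    MemL2H1 d.Ω d.T (fun t x => gradient d.φ (E t x)) GS ∧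
    (∀ᵐ t ∂(volume.restrict (Ioo 0 d.T)), ∀ᵐ x ∂(surf.restrict d.ΓD),
      HasTraceAt d.Ω (v t) x 0) ∧
    (∀ᵐ t ∂(volume.restrict (Ioo 0 d.T)), ∀ᵐ x ∂(surf.restrict d.ΓN),
      ∃ g, HasTraceAt d.Ω (v t) x g ∧ ∀ n, IsOuterNormal d.Ω x n → ⟪g, n⟫ = 0) ∧
    ∀ (ψ : ℝ → Vec → Vec) (Ψ : ℝ → Vec → Sym),
      d.IsVelocityTest ψ → IsTestFunction d.Ω d.T Ψ →
      (∀ᵐ q : ℝ × ℝ, 0 < q.1 → q.1 < q.2 → q.2 < d.T →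
        d.WeakInequality v Gv E GS ψ Ψ q.1 q.2 (v q.1) (E q.1)) ∧
      (∀ᵐ t : ℝ, 0 < t → t < d.T → d.WeakInequality v Gv E GS ψ Ψ 0 t d.v₀ d.E₀)

/-! ### The classical form of the system -/

/-- The momentum equation holds at a given point:
`ρ (∂ₜv + v·∇v) = div (𝕊(v) + 𝕋) - (ρ/2) (div v) v + f`. -/
def MomentumAt (v : ℝ → Vec → Vec) (E : ℝ → Vec → Sym) (t : ℝ) (x : Vec) : Prop :=
  d.ρ • (deriv (fun s => v s x) t + fderiv ℝ (v t) x (v t x))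
    = matDiv (fun y => d.totalStress (fderiv ℝ (v t) y) (E t y)) x
      - (d.ρ / 2 * divg (fderiv ℝ (v t) x)) • v t x + d.f t x

/-- The strain-rate equation `∂ₜE + v·∇E + E𝕎(v) - 𝕎(v)E + Ξ = 𝔻(v) + γ Δ[Dφ(E)]` holds at a
given point. -/
def StrainRateAt (v : ℝ → Vec → Vec) (E : ℝ → Vec → Sym) (Ξ : Vec → Dev) (t : ℝ) (x : Vec) :
    Prop :=
  ((deriv (fun s => E s x) t + fderiv ℝ (E t) x (v t x) : Sym) : Mat)
      + corot (E t x) (fderiv ℝ (v t) x) + (Ξ x : Mat)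
    = ((symGrad (fderiv ℝ (v t) x) + d.γ • Δ (fun y => gradient d.φ (E t y)) x : Sym) : Mat)

/-- The tangential part of the traction `(𝕊(v) + 𝕋) n` vanishes at the boundary point `x`. -/
def TangentialTractionFreeAt (v : ℝ → Vec → Vec) (E : ℝ → Vec → Sym) (t : ℝ) (x : Vec) : Prop :=
  ∀ n, IsOuterNormal d.Ω x n →
    let a := matVec (d.totalStress (fderivWithin ℝ (v t) (closure d.Ω) x) (E t x)) n
    a - ⟪a, n⟫ • n = 0

/-- The points `x` of the slip boundary near which the boundary is a surface of class `C²` and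
consists, up to a null set, only of slip boundary. -/
def regularSlipSet : Set Vec :=
  {x ∈ d.ΓN | (∃ g : EuclideanSpace ℝ (Fin 2) → ℝ, ContDiff ℝ 2 g ∧ IsLocalSubgraph d.Ω x g) ∧
    ∃ ε > 0, surf (Metric.ball x ε ∩ d.ΓD) = 0}

/-- The initial strain is compatible with the potential: the initial strain is bounded and its
stress has a finite potential, or the potential is finite at all smooth compactly
supported functions. -/
def InitialStrainCompatible : Prop :=
  (MemLp d.E₀ ⊤ (volume.restrict d.Ω) ∧ potVal d.P (fun x => dev (gradient d.φ (d.E₀ x))) ≠ ⊤) ∨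
    ∀ Φ : Vec → Dev, ContDiff ℝ ∞ Φ → HasCompactSupport Φ → tsupport Φ ⊆ d.Ω → potVal d.P Φ ≠ ⊤

end Data

end ViscoPlast

end

/-! Along smooth fields the energy pairing is differentiable in time, so its increment is a
space-time integral (`weak_lhs_eq`). The time derivatives of the test functions then cancel, and the
weak inequality takes the form `reduced`: the integral of a density that is affine in the test pair,
plus the integral of P(dev Dφ(E)), is at most the integral of P(dev Ψ). The equations are read off
from this inequality by choosing tests, mostly through the remark that an affine expression bounded
above on all integer multiples of a test has vanishing linear part (`eq_zero_of_forall_int_mul_le`).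

Momentum. For Ψ = 0 the right-hand side vanishes, so the part linear in ψ is zero. Partial
integration (`divg_momFlux`) and the fundamental lemma identify f almost everywhere with the
continuous field `forceField`. With this replacement the density is continuous in time, and the
inequality can be localized at every single time (`stationary_le`). Lower semicontinuity of P is
what the potential of the stress needs there, and its finiteness comes out as well.

Strain. The velocity satisfies the boundary conditions at all times, so ψ = v is admissible. The
corotational term then drops out against S = Dφ(E), since S commutes with E, and the transport terms
form the divergence of a scalar multiple of v, a tangential field. What remains is `weakStrain_le`:
W(S - Φ) + P(dev S) ≤ P(dev Φ), where W is the strain-rate equation without plastic term in weak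
form. Multiples of the identity have no deviator, so W vanishes on them and only trace-free tests
matter. The approximation property decouples such a test from its boundary values: if Φ_j has
boundary values dev S + H and weak limit A, then dev S + H - Φ_j can be integrated by parts without
boundary term, and the limit is `residual_le`, in which H and A are independent. A = dev S with
integer multiples of H gives the Neumann condition in weak form; H = 0 with arbitrary A says that
minus the residual is a subgradient.

Boundary. No surface integral occurs. The divergence theorem is needed only without boundary
contribution: for fields that vanish on the frontier, whose extension by zero is Lipschitz, and for
tangential fields, which are cut off by a ramp of width δ whose gradient 1/δ meets a normal
component of order δ. Natural boundary conditions are extracted at a point by inserting bumps of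
radius r. After multiplication by r⁻² the term with the gradient of the bump tends to a positive
multiple of the normal component (`tendsto_bump_flux`), and the other terms vanish. This yields the
Neumann condition and, with a tangential extension of the tangential traction as test, the slip
condition.

Initial data. Letting t tend to 0 in the inequality that starts at 0 leaves `initial_le`, which is
affine in the tests. Scaling gives v(0) = v₀, and also E(0) = E₀ if P is finite on smooth compactly
supported tests. If instead E₀ is bounded, tests approximating dev Dφ(E₀) turn it into nonpositivity
of the Bregman distance between E(0) and E₀, which strong convexity excludes unless they agree. -/

noncomputable section

namespace ViscoPlast

/-! ### Charts in which the domain lies below a graph -/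

/-- In the ball of radius `ε` around `x₀`, the set `Ω` is the region where `H` is positive, and
`H` decreases with unit speed in the direction `e`. -/
structure IsGraphChart (Ω : Set Vec) (x₀ : Vec) (ε : ℝ) (H : Vec → ℝ) (e : Vec) : Prop where
  pos : 0 < ε
  translate : ∀ (y : Vec) (s : ℝ), H (y + s • e) = H y - s
  norm_eq : ‖e‖ = 1
  mem_iff : ∀ y ∈ Metric.ball x₀ ε, y ∈ Ω ↔ 0 < H y

/-- The projection onto the first two coordinates of the isometry `A`. -/
def planeProj (A : Vec ≃ₗᵢ[ℝ] Vec) : Vec →L[ℝ] EuclideanSpace ℝ (Fin 2) :=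
  LinearMap.toContinuousLinearMap
    { toFun := fun y => !₂[A y 0, A y 1]
      map_add' := by intro x y; ext i; fin_cases i <;> simp
      map_smul' := by intro c x; ext i; fin_cases i <;> simp }

lemma planeProj_apply (A : Vec ≃ₗᵢ[ℝ] Vec) (y : Vec) : planeProj A y = !₂[A y 0, A y 1] := rfl

/-- The last coordinate of the isometry `A`. -/
def heightCoord (A : Vec ≃ₗᵢ[ℝ] Vec) : Vec →L[ℝ] ℝ :=
  (EuclideanSpace.proj (2 : Fin 3) : Vec →L[ℝ] ℝ).comp (A.toContinuousLinearEquiv : Vec →L[ℝ] Vec)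

lemma heightCoord_apply (A : Vec ≃ₗᵢ[ℝ] Vec) (y : Vec) : heightCoord A y = A y 2 := rfl

/-- The unit vector in the direction of the last coordinate of `A`. -/
def upVec (A : Vec ≃ₗᵢ[ℝ] Vec) : Vec := A.symm (unitVec 2)

lemma planeProj_upVec (A : Vec ≃ₗᵢ[ℝ] Vec) : planeProj A (upVec A) = 0 := by
  ext i; fin_cases i <;> simp [planeProj_apply, upVec, unitVec]

lemma heightCoord_upVec (A : Vec ≃ₗᵢ[ℝ] Vec) : heightCoord A (upVec A) = 1 := by
  simp [heightCoord_apply, upVec, unitVec]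

/-- The function whose positivity set is the region below the graph of `g`. -/
def graphFun (A : Vec ≃ₗᵢ[ℝ] Vec) (g : EuclideanSpace ℝ (Fin 2) → ℝ) (y : Vec) : ℝ :=
  g (planeProj A y) - heightCoord A y

lemma graphFun_translate (A : Vec ≃ₗᵢ[ℝ] Vec) (g : EuclideanSpace ℝ (Fin 2) → ℝ) (y : Vec)
    (s : ℝ) : graphFun A g (y + s • upVec A) = graphFun A g y - s := by
  simp only [graphFun, map_add, map_smul, planeProj_upVec, heightCoord_upVec, smul_zero, add_zero,
    smul_eq_mul, mul_one]
  ring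

lemma IsLocalSubgraph.exists_chart {Ω : Set Vec} {x₀ : Vec} {g : EuclideanSpace ℝ (Fin 2) → ℝ}
    (h : IsLocalSubgraph Ω x₀ g) :
    ∃ A : Vec ≃ₗᵢ[ℝ] Vec, ∃ ε, IsGraphChart Ω x₀ ε (graphFun A g) (upVec A) := by
  obtain ⟨A, ε, hε, h⟩ := h
  refine ⟨A, ε, hε, graphFun_translate A g, ?_, ?_⟩
  · simp [upVec, unitVec]
  · intro y hy
    rw [h y hy, graphFun, sub_pos]; rfl

lemma lipschitz_graphFun (A : Vec ≃ₗᵢ[ℝ] Vec) {g : EuclideanSpace ℝ (Fin 2) → ℝ} {K : ℝ≥0}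
    (hg : LipschitzWith K g) : ∃ K', LipschitzWith K' (graphFun A g) :=
  ⟨_, (hg.comp (planeProj A).lipschitz).sub (heightCoord A).lipschitz⟩

lemma contDiff_graphFun (A : Vec ≃ₗᵢ[ℝ] Vec) {g : EuclideanSpace ℝ (Fin 2) → ℝ} {n : WithTop ℕ∞}
    (hg : ContDiff ℝ n g) : ContDiff ℝ n (graphFun A g) :=
  (hg.comp (planeProj A).contDiff).sub (heightCoord A).contDiff

/-- Surjective linear maps pull null sets back to null sets; this serves to discard exceptional sets
on the boundary in volume integrals. -/
lemma planeProj_surjective (A : Vec ≃ₗᵢ[ℝ] Vec) : Function.Surjective (planeProj A) := by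
  intro z
  refine ⟨A.symm !₂[z 0, z 1, 0], ?_⟩
  ext i; fin_cases i <;> simp [planeProj_apply]

/-- Points whose vertical projection to a graph meets a surface null set form a null set. -/
lemma ae_vertical_notMem (A : Vec ≃ₗᵢ[ℝ] Vec) (H : Vec → ℝ) {N : Set Vec} (hN : surf N = 0) :
    ∀ᵐ y : Vec, y + H y • upVec A ∉ N := by
  -- The projection to the plane is Lipschitz, so the image of a surface null set is null for the
  -- planar Hausdorff measure, which is a Haar measure there.
  have h1 : (Measure.hausdorffMeasure (2 : ℕ) : Measure (EuclideanSpace ℝ (Fin 2)))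
      (planeProj A '' N) = 0 := by
    have := (planeProj A).lipschitz.hausdorffMeasure_image_le (d := ((2 : ℕ) : ℝ)) (by norm_num) N
    refine le_antisymm (this.trans ?_) zero_le
    simp only [surf] at hN
    norm_num [hN]
  obtain ⟨t, ht, htm, ht0⟩ := exists_measurable_superset_of_null h1
  have h2 := (ae_comp_linearMap_mem_iff (planeProj A).toLinearMap (volume : Measure Vec)
    (Measure.hausdorffMeasure (2 : ℕ) : Measure (EuclideanSpace ℝ (Fin 2)))
    (planeProj_surjective A) htm.compl).2 (measure_eq_zero_iff_ae_notMem.1 ht0)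
  filter_upwards [h2] with y hy hyN
  apply hy
  apply ht
  -- The points y and y + H(y) e have the same projection to the plane.
  refine ⟨_, hyN, ?_⟩
  simp [planeProj_upVec]

/-! ### Outer normals in charts -/

section Chart

variable {Ω : Set Vec} {x₀ : Vec} {ε : ℝ} {H : Vec → ℝ} {e : Vec}

/-- A frontier point is a limit of points of Ω, where H is positive, and of points outside, where H
is nonpositive. -/
lemma IsGraphChart.eq_zero_of_mem_frontier (hc : IsGraphChart Ω x₀ ε H e) (hH : Continuous H)
    {p : Vec} (hp : p ∈ Metric.ball x₀ ε) (hpf : p ∈ frontier Ω) : H p = 0 := by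
  have hb : Metric.ball x₀ ε ∈ 𝓝 p := Metric.isOpen_ball.mem_nhds hp
  rw [frontier_eq_closure_inter_closure] at hpf
  have key : ∀ s : Set Vec, p ∈ closure s → ∀ C : Set ℝ, IsClosed C →
      (∀ y ∈ Metric.ball x₀ ε, y ∈ s → H y ∈ C) → H p ∈ C := by
    intro s hs C hC h
    have hs' : p ∈ closure (s ∩ Metric.ball x₀ ε) := by
      rw [mem_closure_iff_nhdsWithin_neBot] at hs ⊢
      rwa [nhdsWithin_inter_of_mem' (mem_nhdsWithin_of_mem_nhds hb)]
    have := map_mem_closure hH hs' (t := C) (fun y hy => h y hy.2 hy.1)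
    rwa [hC.closure_eq] at this
  refine le_antisymm ?_ ?_
  · exact key _ hpf.2 (Iic 0) isClosed_Iic
      (fun y hy hyΩ => not_lt.1 fun h => hyΩ ((hc.mem_iff y hy).2 h))
  · exact key _ hpf.1 (Ici 0) isClosed_Ici (fun y hy hyΩ => ((hc.mem_iff y hy).1 hyΩ).le)

lemma IsGraphChart.hasFDerivAt_apply (hc : IsGraphChart Ω x₀ ε H e) {p : Vec} {D : Vec →L[ℝ] ℝ}
    (hD : HasFDerivAt H D p) : D e = -1 := by
  have h1 : HasDerivAt (fun s : ℝ => H (p + s • e)) (D e) 0 := by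
    have h2 : HasDerivAt (fun s : ℝ => p + s • e) e 0 := by
      simpa using ((hasDerivAt_id (0 : ℝ)).smul_const e).const_add p
    have h3 : HasFDerivAt H D (p + (0 : ℝ) • e) := by simpa using hD
    exact h3.comp_hasDerivAt 0 h2
  have h2 : HasDerivAt (fun s : ℝ => H (p + s • e)) (-1) 0 := by
    simp only [hc.translate]
    simpa using (hasDerivAt_id (0 : ℝ)).const_sub (H p)
  exact h1.unique h2

/-- Vertical translation changes H only by a constant. Hence differentiability at a point inside,
which is available almost everywhere by Rademacher's theorem, carries over to the boundary point
above it. -/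
lemma IsGraphChart.hasFDerivAt_translate (hc : IsGraphChart Ω x₀ ε H e) {p : Vec}
    {D : Vec →L[ℝ] ℝ} (hD : HasFDerivAt H D p) (s : ℝ) : HasFDerivAt H D (p + s • e) := by
  have h1 : H = fun y => H (y - s • e) - s := by
    ext y
    rw [← hc.translate (y - s • e) s, sub_add_cancel]
  rw [h1]
  have h3 : HasFDerivAt (fun y : Vec => y - s • e) (ContinuousLinearMap.id ℝ Vec) (p + s • e) :=
    (hasFDerivAt_id _).sub_const _
  have h4 : HasFDerivAt H D ((fun y : Vec => y - s • e) (p + s • e)) := by simpa using hD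
  simpa using (HasFDerivAt.comp (g := H) (p + s • e) h4 h3).sub_const s

/-- Where the chart function is differentiable, its negative gradient points in the direction of
the outer normal. -/
lemma IsGraphChart.exists_outerNormal (hc : IsGraphChart Ω x₀ ε H e) {p : Vec} (hp : p ∈ Metric.ball x₀ ε)
    (hp0 : H p = 0) {D : Vec →L[ℝ] ℝ} (hD : HasFDerivAt H D p) :
    ∃ n, IsOuterNormal Ω p n ∧ ∃ c > 0, ∀ w, D w = -c * ⟪w, n⟫ := by
  set G : Vec := (InnerProductSpace.toDual ℝ Vec).symm D with hG
  have hGD : ∀ w, D w = ⟪w, G⟫ := by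
    intro w; rw [real_inner_comm, hG, InnerProductSpace.toDual_symm_apply]
  have hG0 : 0 < ‖G‖ := by
    rw [norm_pos_iff]
    intro h
    have h1 := hc.hasFDerivAt_apply hD
    rw [hGD, h, inner_zero_right] at h1
    norm_num at h1
  have hn : ∀ w, D w = -‖G‖ * ⟪w, -(‖G‖⁻¹ • G)⟫ := by
    intro w
    rw [hGD, inner_neg_right, inner_smul_right]
    field_simp
  refine ⟨-(‖G‖⁻¹ • G), ⟨?_, ?_⟩, ‖G‖, hG0, hn⟩
  · rw [norm_neg, norm_smul, norm_inv, norm_norm, inv_mul_cancel₀ hG0.ne']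
  · intro η hη
    -- The tolerance carries the factor ‖G‖ because it is divided by ‖G‖ when the derivative is
    -- expressed through the unit normal.
    have h1 := hD.isLittleO.def (mul_pos hη hG0)
    filter_upwards [h1, Metric.isOpen_ball.mem_nhds hp] with y hy hyb
    rw [hp0, sub_zero, hn, Real.norm_eq_abs, abs_le] at hy
    rw [hc.mem_iff y hyb]
    constructor
    · intro hpos
      have : ‖G‖ * ⟪y - p, -(‖G‖⁻¹ • G)⟫ ≤ ‖G‖ * (η * ‖y - p‖) := by nlinarith
      exact le_of_mul_le_mul_left this hG0
    · intro hneg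
      have : ‖G‖ * (-(η * ‖y - p‖)) ≤ ‖G‖ * ⟪y - p, -(‖G‖⁻¹ • G)⟫ := by nlinarith
      exact le_of_mul_le_mul_left this hG0

/-- Directional consequence of being an outer normal. -/
lemma IsOuterNormal.eventually_mem {Ω : Set Vec} {x n : Vec} (hn : IsOuterNormal Ω x n) {w : Vec}
    (hw : ⟪w, n⟫ < 0) : ∀ᶠ s : ℝ in 𝓝[>] 0, x + s • w ∈ Ω := by
  have hw0 : 0 < ‖w‖ := by
    rw [norm_pos_iff]; rintro rfl; simp at hw
  -- The tolerance is half the slope of w along n: a point x + s w outside Ω would satisfy s⟪w, n⟫ ≥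
  -- s⟪w, n⟫ / 2, impossible for a negative slope.
  have h1 := hn.2 (-⟪w, n⟫ / (2 * ‖w‖)) (by apply div_pos <;> linarith)
  have h2 : Tendsto (fun s : ℝ => x + s • w) (𝓝[>] 0) (𝓝 x) := by
    have : Continuous fun s : ℝ => x + s • w := by fun_prop
    have h3 := this.tendsto 0
    simp only [zero_smul, add_zero] at h3
    exact h3.mono_left nhdsWithin_le_nhds
  filter_upwards [h2.eventually h1, self_mem_nhdsWithin] with s hs hs0
  have hs0 : 0 < s := hs0
  by_contra hm
  have h3 := hs.2 hm
  rw [add_sub_cancel_left, inner_smul_left, norm_smul, Real.norm_of_nonneg hs0.le] at h3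
  simp only [conj_trivial] at h3
  have h4 : -⟪w, n⟫ / (2 * ‖w‖) * (s * ‖w‖) = -⟪w, n⟫ * s / 2 := by field_simp
  rw [h4] at h3
  nlinarith

lemma IsOuterNormal.eventually_notMem {Ω : Set Vec} {x n : Vec} (hn : IsOuterNormal Ω x n) {w : Vec}
    (hw : 0 < ⟪w, n⟫) : ∀ᶠ s : ℝ in 𝓝[>] 0, x + s • w ∉ Ω := by
  have hw0 : 0 < ‖w‖ := by
    rw [norm_pos_iff]; rintro rfl; simp at hw
  have h1 := hn.2 (⟪w, n⟫ / (2 * ‖w‖)) (by apply div_pos <;> linarith)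
  have h2 : Tendsto (fun s : ℝ => x + s • w) (𝓝[>] 0) (𝓝 x) := by
    have : Continuous fun s : ℝ => x + s • w := by fun_prop
    have h3 := this.tendsto 0
    simp only [zero_smul, add_zero] at h3
    exact h3.mono_left nhdsWithin_le_nhds
  filter_upwards [h2.eventually h1, self_mem_nhdsWithin] with s hs hs0 hm
  have hs0 : 0 < s := hs0
  have h3 := hs.1 hm
  rw [add_sub_cancel_left, inner_smul_left, norm_smul, Real.norm_of_nonneg hs0.le] at h3
  simp only [conj_trivial] at h3
  have h4 : ⟪w, n⟫ / (2 * ‖w‖) * (s * ‖w‖) = ⟪w, n⟫ * s / 2 := by field_simp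
  rw [h4] at h3
  nlinarith

lemma IsGraphChart.eventually_mem (hc : IsGraphChart Ω x₀ ε H e) {p : Vec}
    (hp : p ∈ Metric.ball x₀ ε) (hp0 : H p = 0) {D : Vec →L[ℝ] ℝ} (hD : HasFDerivAt H D p) {w : Vec}
    (hw : 0 < D w) : ∃ᶠ s : ℝ in 𝓝[>] 0, p + s • w ∈ Ω := by
  obtain ⟨n, hn, c, hc0, hcn⟩ := hc.exists_outerNormal hp hp0 hD
  apply Eventually.frequently
  apply hn.eventually_mem
  rw [hcn] at hw
  nlinarith

/-- Every outer normal is orthogonal to the kernel of the derivative of the chart function. -/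
lemma IsGraphChart.inner_eq_zero (hc : IsGraphChart Ω x₀ ε H e) {p : Vec}
    (hp : p ∈ Metric.ball x₀ ε) (hp0 : H p = 0) {D : Vec →L[ℝ] ℝ} (hD : HasFDerivAt H D p)
    {n : Vec} (hn : IsOuterNormal Ω p n) {w : Vec} (hw : D w = 0) : ⟪w, n⟫ = 0 := by
  have key : ∀ w : Vec, D w = 0 → ⟪w, n⟫ ≤ 0 := by
    intro w hw
    -- Tilting w by -δe makes its derivative D equal to δ > 0, so the ray enters Ω, whereas a
    -- positive inner product with n would keep it outside. Then δ tends to 0.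
    have h1 : ∀ δ : ℝ, 0 < δ → ⟪w - δ • e, n⟫ ≤ 0 := by
      intro δ hδ
      by_contra! h
      have h2 : 0 < D (w - δ • e) := by
        rw [map_sub, hw, map_smul, hc.hasFDerivAt_apply hD]; simpa using hδ
      exact (hc.eventually_mem hp hp0 hD h2) (hn.eventually_notMem h)
    have h2 : Tendsto (fun δ : ℝ => ⟪w - δ • e, n⟫) (𝓝[>] 0) (𝓝 ⟪w, n⟫) := by
      have : Continuous fun δ : ℝ => ⟪w - δ • e, n⟫ := by fun_prop
      have h3 := this.tendsto 0
      simp only [zero_smul, sub_zero] at h3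
      exact h3.mono_left nhdsWithin_le_nhds
    exact le_of_tendsto h2 (by filter_upwards [self_mem_nhdsWithin] with δ hδ using h1 δ hδ)
  refine le_antisymm (key w hw) ?_
  have := key (-w) (by simp [hw])
  rw [inner_neg_left] at this
  linarith

/-- Vectors orthogonal to an outer normal lie in the kernel of the derivative of the chart
function. -/
lemma IsGraphChart.apply_eq_zero (hc : IsGraphChart Ω x₀ ε H e) {p : Vec}
    (hp : p ∈ Metric.ball x₀ ε) (hp0 : H p = 0) {D : Vec →L[ℝ] ℝ} (hD : HasFDerivAt H D p)
    {n : Vec} (hn : IsOuterNormal Ω p n) {a : Vec} (ha : ⟪a, n⟫ = 0) : D a = 0 := by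
  -- Since D e = -1, the vector a + (D a) e lies in the kernel of D. The case a = n shows that ⟪e,
  -- n⟫ is not zero.
  have h1 : ∀ a : Vec, ⟪a, n⟫ + D a * ⟪e, n⟫ = 0 := by
    intro a
    have := hc.inner_eq_zero hp hp0 hD hn (w := a + D a • e)
      (by rw [map_add, map_smul, hc.hasFDerivAt_apply hD]; simp)
    rwa [inner_add_left, inner_smul_left] at this
  have h2 := h1 a
  have h3 := h1 n
  rw [real_inner_self_eq_norm_sq, hn.1] at h3
  rw [ha, zero_add, mul_eq_zero] at h2
  rcases h2 with h2 | h2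
  · exact h2
  · rw [h2] at h3; norm_num at h3

end Chart

/-! ### Lipschitz domains -/

namespace IsLipschitzDomain

variable {Ω : Set Vec}

lemma exists_chart (h : IsLipschitzDomain Ω) {x : Vec} (hx : x ∈ frontier Ω) :
    ∃ (A : Vec ≃ₗᵢ[ℝ] Vec) (H : Vec → ℝ) (ε : ℝ) (K : ℝ≥0),
      LipschitzWith K H ∧ IsGraphChart Ω x ε H (upVec A) := by
  obtain ⟨K, g, hg, hl⟩ := h.lipschitz x hx
  obtain ⟨A, ε, hc⟩ := hl.exists_chart
  obtain ⟨K', hK'⟩ := lipschitz_graphFun A hg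
  exact ⟨A, _, ε, K', hK', hc⟩

lemma isCompact_closure (h : IsLipschitzDomain Ω) : IsCompact (closure Ω) :=
  h.isBounded.isCompact_closure

lemma measure_lt_top (h : IsLipschitzDomain Ω) : volume Ω < ⊤ := h.isBounded.measure_lt_top

/-- At a frontier point the region below a Lipschitz graph contains a short cone around the downward
direction. The tangent cone therefore contains a ball, and its span is the whole space. -/
lemma uniqueDiffOn (h : IsLipschitzDomain Ω) : UniqueDiffOn ℝ (closure Ω) := by
  intro x hx
  by_cases hxΩ : x ∈ Ω
  · exact uniqueDiffWithinAt_of_mem_nhds (mem_of_superset (h.isOpen.mem_nhds hxΩ) subset_closure)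
  have hxf : x ∈ frontier Ω := by rw [h.isOpen.frontier_eq]; exact ⟨hx, hxΩ⟩
  obtain ⟨A, H, ε, K, hK, hc⟩ := h.exists_chart hxf
  have hx0 : H x = 0 := hc.eq_zero_of_mem_frontier hK.continuous (Metric.mem_ball_self hc.pos) hxf
  rw [uniqueDiffWithinAt_iff]
  refine ⟨?_, subset_closure hx⟩
  -- For ‖w + e‖ < 1/(K + 1) the Lipschitz bound gives H(x + s w) ≥ s - K s ‖w + e‖ > 0; the summand
  -- 1 covers the case K = 0.
  have hδ : (0 : ℝ) < 1 / (K + 1) := by positivity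
  suffices hs : Metric.ball (-upVec A) (1 / (K + 1)) ⊆ tangentConeAt ℝ (closure Ω) x by
    have : Submodule.span ℝ (tangentConeAt ℝ (closure Ω) x) = ⊤ := by
      apply Submodule.eq_top_of_nonempty_interior'
      refine ⟨-upVec A, ?_⟩
      rw [mem_interior_iff_mem_nhds]
      exact mem_of_superset (Metric.ball_mem_nhds _ hδ) (hs.trans Submodule.subset_span)
    rw [this]; simp
  intro w hw
  have hmem : ∀ᶠ s : ℝ in 𝓝[>] 0, x + s • w ∈ closure Ω := by
    have h2 : Tendsto (fun s : ℝ => x + s • w) (𝓝[>] 0) (𝓝 x) := by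
      have : Continuous fun s : ℝ => x + s • w := by fun_prop
      have h3 := this.tendsto 0
      simp only [zero_smul, add_zero] at h3
      exact h3.mono_left nhdsWithin_le_nhds
    filter_upwards [h2.eventually (Metric.ball_mem_nhds x hc.pos), self_mem_nhdsWithin]
      with s hs hs0
    have hs0 : 0 < s := hs0
    apply subset_closure
    rw [hc.mem_iff _ hs]
    have h4 : x + s • w = (x + s • (w + upVec A)) + (-s) • upVec A := by
      rw [smul_add, neg_smul]; abel
    rw [h4, hc.translate]
    have h5 := hK.dist_le_mul (x + s • (w + upVec A)) x
    rw [dist_eq_norm, dist_eq_norm, add_sub_cancel_left, norm_smul, Real.norm_of_nonneg hs0.le,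
      hx0, sub_zero] at h5
    have h6 : ‖w + upVec A‖ < 1 / (K + 1) := by
      rw [Metric.mem_ball, dist_eq_norm, sub_neg_eq_add] at hw; exact hw
    have h7 : (K : ℝ) * (s * ‖w + upVec A‖) < s := by
      have hK1 : (0 : ℝ) < K + 1 := by positivity
      rw [lt_div_iff₀ hK1] at h6
      nlinarith [norm_nonneg (w + upVec A)]
    have h8 := (abs_le.1 h5).1
    linarith
  refine mem_tangentConeAt_of_frequently (𝓝[>] (0 : ℝ)) (fun s => s⁻¹) (fun s => s • w) ?_ ?_ ?_
  · have : Continuous fun s : ℝ => s • w := by fun_prop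
    have h3 := this.tendsto 0
    simp only [zero_smul] at h3
    exact h3.mono_left nhdsWithin_le_nhds
  · exact hmem.frequently
  · refine tendsto_const_nhds.congr' ?_
    filter_upwards [self_mem_nhdsWithin] with s hs
    have hs : 0 < s := hs
    rw [smul_smul, inv_mul_cancel₀ hs.ne', one_smul]

/-- The level sets of H are vertical translates of each other and have equal volume. Only countably
many of these disjoint sets can have positive volume, so none has. -/
lemma volume_frontier (h : IsLipschitzDomain Ω) : volume (frontier Ω) = 0 := by
  apply measure_null_of_locally_null
  intro x hx
  obtain ⟨A, H, ε, K, hK, hc⟩ := h.exists_chart hx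
  refine ⟨Metric.ball x ε ∩ frontier Ω, inter_comm (frontier Ω) _ ▸
    inter_mem_nhdsWithin _ (Metric.ball_mem_nhds x hc.pos), ?_⟩
  refine measure_mono_null (t := {y | H y = 0})
    (fun y hy => hc.eq_zero_of_mem_frontier hK.continuous hy.1 hy.2) ?_
  by_contra hne
  have hcount := Measure.countable_meas_level_set_pos (μ := (volume : Measure Vec))
    hK.continuous.measurable
  have huniv : {t : ℝ | 0 < volume {a : Vec | H a = t}} = univ := by
    ext t
    simp only [mem_ofPred_eq, mem_univ, iff_true]
    have : {a : Vec | H a = t} = (fun a => a + t • upVec A) ⁻¹' {y | H y = 0} := by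
      ext a; simp [hc.translate, sub_eq_zero]
    rw [this, measure_preimage_add_right]
    exact pos_iff_ne_zero.2 hne
  rw [huniv] at hcount
  exact not_countable_univ_iff.2 inferInstance hcount

end IsLipschitzDomain

end ViscoPlast
end

noncomputable section

namespace ViscoPlast

lemma lineDeriv_fun_const (c : ℝ) (x w : Vec) : lineDeriv ℝ (fun _ : Vec => c) x w = 0 := by
  simp [lineDeriv]

/-! ### Extension by zero -/

section ZeroExtension

variable {Ω : Set Vec} {Z : Vec → ℝ} {M : ℝ≥0}

/-- A function that is Lipschitz along the segments in `Ω` and vanishes on the frontier is bounded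
by the distance to any point outside. -/
lemma abs_le_of_zero_on_frontier (hΩ : IsOpen Ω) (hZc : ContinuousOn Z (closure Ω))
    (hZ0 : ∀ x ∈ frontier Ω, Z x = 0)
    (hZ : ∀ x y, segment ℝ x y ⊆ Ω → |Z x - Z y| ≤ M * ‖x - y‖) {x y : Vec} (hx : x ∈ Ω)
    (hy : y ∉ Ω) : |Z x| ≤ M * ‖x - y‖ := by
  set l : ℝ → Vec := fun s => x + s • (y - x) with hl
  have hlc : Continuous l := by fun_prop
  -- The first parameter at which the segment from x to y leaves Ω is a frontier point, where Z
  -- vanishes. The Lipschitz bound is available only before it, since the whole subsegment must lie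
  -- in Ω, and is extended by a limit.
  set C : Set ℝ := Icc 0 1 ∩ l ⁻¹' Ωᶜ with hC
  have hCc : IsCompact C := isCompact_Icc.inter_right (hΩ.isClosed_compl.preimage hlc)
  have hCn : C.Nonempty := ⟨1, by simp, by simpa [hl] using hy⟩
  obtain ⟨σ, ⟨hσ1, hσ2⟩, hσ⟩ := hCc.exists_isLeast hCn
  have hin : ∀ s, 0 ≤ s → s < σ → l s ∈ Ω := by
    intro s hs0 hs
    by_contra h
    exact absurd (hσ ⟨⟨hs0, hs.le.trans hσ1.2⟩, h⟩) (not_le.2 hs)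
  have hσ0 : 0 < σ := by
    rcases hσ1.1.eq_or_lt with h | h
    · exact absurd (by simpa [hl, ← h] using hx) hσ2
    · exact h
  have hcl : Tendsto l (𝓝[<] σ) (𝓝[closure Ω] (l σ)) := by
    apply tendsto_nhdsWithin_of_tendsto_nhds_of_eventually_within
    · exact (hlc.tendsto σ).mono_left nhdsWithin_le_nhds
    · filter_upwards [Ioo_mem_nhdsLT hσ0] with s hs
      exact subset_closure (hin s hs.1.le hs.2)
  have hσcl : l σ ∈ closure Ω :=
    mem_closure_of_tendsto ((hlc.tendsto σ).mono_left nhdsWithin_le_nhds) (b := 𝓝[<] σ) (by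
      filter_upwards [Ioo_mem_nhdsLT hσ0] with s hs
      exact hin s hs.1.le hs.2)
  have hσf : l σ ∈ frontier Ω := by
    rw [hΩ.frontier_eq]; exact ⟨hσcl, hσ2⟩
  have h1 : Tendsto (fun s => |Z x - Z (l s)|) (𝓝[<] σ) (𝓝 |Z x|) := by
    have := ((hZc (l σ) hσcl).tendsto.comp hcl).const_sub (Z x)
    rw [hZ0 _ hσf, sub_zero] at this
    exact this.abs
  have h2 : ∀ᶠ s in 𝓝[<] σ, |Z x - Z (l s)| ≤ M * ‖x - y‖ := by
    filter_upwards [Ioo_mem_nhdsLT hσ0] with s hs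
    refine (hZ x (l s) ?_).trans ?_
    · rintro z ⟨a, b, ha, hb, hab, rfl⟩
      have : a • x + b • l s = l (b * s) := by
        simp only [hl]
        obtain rfl : a = 1 - b := by linarith
        module
      rw [this]
      have hb1 : b ≤ 1 := by linarith
      exact hin _ (mul_nonneg hb hs.1.le) (by nlinarith [hs.1, hs.2])
    · gcongr
      have : x - l s = s • (x - y) := by simp only [hl]; module
      rw [this, norm_smul, Real.norm_of_nonneg hs.1.le]
      have : s ≤ 1 := hs.2.le.trans hσ1.2
      nlinarith [norm_nonneg (x - y)]
  exact le_of_tendsto h1 h2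

/-- A segment between two points of Ω either stays in Ω or passes through some p outside. In the
second case the bounds by the distances to p add up to the length of the segment. No convexity of Ω
is needed. -/
lemma lipschitzWith_indicator (hΩ : IsOpen Ω) (hZc : ContinuousOn Z (closure Ω))
    (hZ0 : ∀ x ∈ frontier Ω, Z x = 0)
    (hZ : ∀ x y, segment ℝ x y ⊆ Ω → |Z x - Z y| ≤ M * ‖x - y‖) :
    LipschitzWith M (Ω.indicator Z) := by
  apply LipschitzWith.of_dist_le_mul
  intro x y
  rw [dist_eq_norm, dist_eq_norm, Real.norm_eq_abs]
  have key := fun {x y} => abs_le_of_zero_on_frontier (x := x) (y := y) hΩ hZc hZ0 hZ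
  by_cases hx : x ∈ Ω <;> by_cases hy : y ∈ Ω
  · rw [indicator_of_mem hx, indicator_of_mem hy]
    by_cases hs : segment ℝ x y ⊆ Ω
    · exact hZ x y hs
    · obtain ⟨p, hp, hpΩ⟩ := not_subset.1 hs
      have h3 : ‖x - p‖ + ‖y - p‖ = ‖x - y‖ := by
        have := dist_add_dist_of_mem_segment hp
        rw [dist_eq_norm, dist_eq_norm, dist_eq_norm] at this
        rw [← this, norm_sub_rev y p]
      calc |Z x - Z y| ≤ |Z x| + |Z y| := abs_sub _ _
        _ ≤ M * ‖x - p‖ + M * ‖y - p‖ := add_le_add (key hx hpΩ) (key hy hpΩ)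
        _ = M * ‖x - y‖ := by rw [← mul_add, h3]
  · rw [indicator_of_mem hx, indicator_of_notMem hy, sub_zero]
    exact key hx hy
  · rw [indicator_of_notMem hx, indicator_of_mem hy, zero_sub, abs_neg, norm_sub_rev]
    exact key hy hx
  · rw [indicator_of_notMem hx, indicator_of_notMem hy]
    simp only [sub_self, abs_zero]
    positivity

/-- Integrate by parts over the whole space against a bump that equals one on Ω: its derivative
vanishes wherever the extension of Z does not. The frontier is null, and off the frontier the
derivative of the extension is that of Z or zero. -/
lemma integral_lineDeriv_eq_zero (hΩ : IsOpen Ω) (hb : Bornology.IsBounded Ω)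
    (hf : volume (frontier Ω) = 0) (hL : LipschitzWith M (Ω.indicator Z)) (w : Vec) :
    ∫ x in Ω, lineDeriv ℝ Z x w = 0 := by
  obtain ⟨R, hR0, hR⟩ := hb.subset_ball_lt 0 0
  let b : ContDiffBump (0 : Vec) := ⟨R, R + 1, hR0, by linarith⟩
  have hbc : ContDiff ℝ 1 b := b.contDiff
  obtain ⟨D, hD⟩ := hbc.lipschitzWith_of_hasCompactSupport b.hasCompactSupport (by norm_num)
  have key := hL.integral_lineDeriv_mul_eq (μ := volume) hD b.hasCompactSupport w
  have hb1 : ∀ x ∈ Ω, (b : Vec → ℝ) =ᶠ[𝓝 x] fun _ => 1 := by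
    intro x hx
    filter_upwards [Metric.isOpen_ball.mem_nhds (hR hx)] with y hy
    exact b.one_of_mem_closedBall (Metric.ball_subset_closedBall hy)
  have h1 : ∀ x, lineDeriv ℝ b x (-w) * Ω.indicator Z x = 0 := by
    intro x
    by_cases hx : x ∈ Ω
    · rw [(hb1 x hx).lineDeriv_eq, lineDeriv_fun_const, zero_mul]
    · rw [indicator_of_notMem hx, mul_zero]
  simp only [h1, integral_zero] at key
  rw [← integral_indicator hΩ.measurableSet, ← key]
  apply integral_congr_ae
  have hfa : ∀ᵐ x : Vec, x ∉ frontier Ω := measure_eq_zero_iff_ae_notMem.1 hf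
  filter_upwards [hfa] with x hx
  by_cases hxΩ : x ∈ Ω
  · rw [indicator_of_mem hxΩ, (hb1 x hxΩ).self_of_nhds, mul_one]
    apply (Filter.EventuallyEq.lineDeriv_eq _).symm
    filter_upwards [hΩ.mem_nhds hxΩ] with y hy using indicator_of_mem hy _
  · have hxc : x ∉ closure Ω := by
      rw [hΩ.frontier_eq] at hx
      exact fun h => hx ⟨h, hxΩ⟩
    have : Ω.indicator Z =ᶠ[𝓝 x] fun _ => 0 := by
      filter_upwards [isClosed_closure.isOpen_compl.mem_nhds hxc] with y hy
      exact indicator_of_notMem (fun h => hy (subset_closure h)) _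
    rw [indicator_of_notMem hxΩ, this.lineDeriv_eq, lineDeriv_fun_const, zero_mul]

end ZeroExtension

lemma IsLipschitzDomain.integrableOn {F : Type*} [NormedAddCommGroup F] {Ω : Set Vec} (h : IsLipschitzDomain Ω) {u : Vec → F}
    (hu : ContinuousOn u (closure Ω)) : IntegrableOn u Ω :=
  (hu.integrableOn_compact h.isCompact_closure).mono_set subset_closure

/-! ### Fields of class `C¹` up to the boundary -/

section C1

variable {F : Type*} [NormedAddCommGroup F] [NormedSpace ℝ F] {Ω : Set Vec}

lemma IsLipschitzDomain.continuousOn_fderivWithin (h : IsLipschitzDomain Ω) {u : Vec → F}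
    {n : WithTop ℕ∞} (hu : ContDiffOn ℝ n u (closure Ω)) (hn : 1 ≤ n) :
    ContinuousOn (fderivWithin ℝ u (closure Ω)) (closure Ω) :=
  hu.continuousOn_fderivWithin h.uniqueDiffOn hn

lemma IsLipschitzDomain.closure_mem_nhds (h : IsLipschitzDomain Ω) {x : Vec} (hx : x ∈ Ω) :
    closure Ω ∈ 𝓝 x := mem_of_superset (h.isOpen.mem_nhds hx) subset_closure

lemma IsLipschitzDomain.hasFDerivAt (h : IsLipschitzDomain Ω) {u : Vec → F}
    (hu : ContDiffOn ℝ 1 u (closure Ω)) {x : Vec} (hx : x ∈ Ω) :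
    HasFDerivAt u (fderivWithin ℝ u (closure Ω) x) x :=
  (((hu x (subset_closure hx)).differentiableWithinAt (by norm_num)).hasFDerivWithinAt).hasFDerivAt
    (h.closure_mem_nhds hx)

lemma IsLipschitzDomain.exists_lipschitz (h : IsLipschitzDomain Ω) {u : Vec → F}
    (hu : ContDiffOn ℝ 1 u (closure Ω)) :
    ∃ M : ℝ≥0, (∀ x ∈ closure Ω, ‖u x‖ ≤ M) ∧
      ∀ x y, segment ℝ x y ⊆ Ω → ‖u x - u y‖ ≤ M * ‖x - y‖ := by
  obtain ⟨C, hC⟩ := h.isCompact_closure.exists_bound_of_continuousOn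
    (h.continuousOn_fderivWithin hu le_rfl)
  obtain ⟨C', hC'⟩ := h.isCompact_closure.exists_bound_of_continuousOn hu.continuousOn
  refine ⟨(max C C').toNNReal, fun x hx => ?_, fun x y hxy => ?_⟩
  · exact (hC' x hx).trans ((le_max_right _ _).trans (Real.le_coe_toNNReal _))
  · refine (Convex.norm_image_sub_le_of_norm_hasFDerivWithin_le
      (f' := fderivWithin ℝ u (closure Ω)) (C := C) (fun z hz => (h.hasFDerivAt hu (hxy hz)).hasFDerivWithinAt)
      (fun z hz => hC z (subset_closure (hxy hz))) (convex_segment x y) (right_mem_segment ℝ x y)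
      (left_mem_segment ℝ x y)).trans ?_
    gcongr
    exact (le_max_left _ _).trans (Real.le_coe_toNNReal _)

end C1

/-! ### The divergence theorem without boundary terms -/

lemma vec_eq_sum (w : Vec) : w = ∑ i, w i • unitVec i := by
  ext j; fin_cases j <;> simp [unitVec, Fin.sum_univ_three]

lemma divg_eq_sum (G : Vec →L[ℝ] Vec) : divg G = ∑ i, G (unitVec i) i := by
  simp [divg, tr, gradMat]

lemma continuous_divg : Continuous divg := by
  have : divg = fun G => ∑ i, G (unitVec i) i := funext divg_eq_sum
  rw [this]; fun_prop

/-- The divergence of a smooth field is the sum of the line derivatives of the components. -/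
lemma divg_eq_sum_lineDeriv {F : Vec → Vec} {G : Vec →L[ℝ] Vec} {x : Vec} (h : HasFDerivAt F G x) :
    divg G = ∑ i, lineDeriv ℝ (fun y => F y i) x (unitVec i) := by
  rw [divg_eq_sum]
  refine Finset.sum_congr rfl fun i _ => ?_
  have h1 : HasFDerivAt (fun y => F y i) ((EuclideanSpace.proj i : Vec →L[ℝ] ℝ).comp G) x :=
    (EuclideanSpace.proj i : Vec →L[ℝ] ℝ).hasFDerivAt.comp x h
  rw [h1.differentiableAt.lineDeriv_eq_fderiv, h1.fderiv]
  rfl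

lemma contDiffOn_coord {Ω : Set Vec} {n : WithTop ℕ∞} {F : Vec → Vec}
    (hF : ContDiffOn ℝ n F Ω) (i : Fin 3) : ContDiffOn ℝ n (fun y => F y i) Ω :=
  (EuclideanSpace.proj i : Vec →L[ℝ] ℝ).contDiff.comp_contDiffOn hF

/-- The extension by zero of each component is Lipschitz, so each partial derivative has integral
zero. -/
theorem IsLipschitzDomain.integral_divg_eq_zero_of_zero {Ω : Set Vec} (h : IsLipschitzDomain Ω)
    {F : Vec → Vec} (hF : ContDiffOn ℝ 1 F (closure Ω)) (h0 : ∀ x ∈ frontier Ω, F x = 0) :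
    ∫ x in Ω, divg (fderivWithin ℝ F (closure Ω) x) = 0 := by
  have h1 : ∀ x ∈ Ω, divg (fderivWithin ℝ F (closure Ω) x) =
      ∑ i, lineDeriv ℝ (fun y => F y i) x (unitVec i) :=
    fun x hx => divg_eq_sum_lineDeriv (h.hasFDerivAt hF hx)
  have h2 : ∀ i : Fin 3, ∀ x ∈ Ω, lineDeriv ℝ (fun y => F y i) x (unitVec i) =
      fderivWithin ℝ (fun y => F y i) (closure Ω) x (unitVec i) := by
    intro i x hx
    have := h.hasFDerivAt (contDiffOn_coord hF i) hx
    rw [this.differentiableAt.lineDeriv_eq_fderiv, this.fderiv]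
  rw [setIntegral_congr_fun h.isOpen.measurableSet h1, integral_finsetSum]
  · refine Finset.sum_eq_zero fun i _ => ?_
    obtain ⟨M, -, hM⟩ := h.exists_lipschitz (contDiffOn_coord hF i)
    exact integral_lineDeriv_eq_zero h.isOpen h.isBounded h.volume_frontier
      (lipschitzWith_indicator h.isOpen (contDiffOn_coord hF i).continuousOn
        (fun x hx => by rw [h0 x hx]; rfl) hM) _
  · intro i _
    refine IntegrableOn.congr_fun (h.integrableOn ?_) (fun x hx => (h2 i x hx).symm)
      h.isOpen.measurableSet
    exact (h.continuousOn_fderivWithin (contDiffOn_coord hF i) le_rfl).clm_apply continuousOn_const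

end ViscoPlast
end

noncomputable section

namespace ViscoPlast

/-! ### The divergence theorem for tangential fields -/

/-- The cutoff function that vanishes where `H ≤ 0` and equals one where `H ≥ δ`. -/
def rampFun (H : Vec → ℝ) (δ : ℝ) (y : Vec) : ℝ := min 1 (max (H y) 0 / δ)

lemma rampFun_nonneg (H : Vec → ℝ) {δ : ℝ} (hδ : 0 < δ) (y : Vec) : 0 ≤ rampFun H δ y :=
  le_min zero_le_one (div_nonneg (le_max_right _ _) hδ.le)

lemma rampFun_le_one (H : Vec → ℝ) (δ : ℝ) (y : Vec) : rampFun H δ y ≤ 1 := min_le_left _ _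

lemma rampFun_eq_one {H : Vec → ℝ} {δ : ℝ} (hδ : 0 < δ) {y : Vec} (hy : δ ≤ H y) :
    rampFun H δ y = 1 := by
  rw [rampFun, min_eq_left]
  rw [le_div_iff₀ hδ, one_mul]
  exact hy.trans (le_max_left _ _)

lemma rampFun_eq_div {H : Vec → ℝ} {δ : ℝ} (hδ : 0 < δ) {y : Vec} (hy0 : 0 ≤ H y)
    (hy : H y ≤ δ) : rampFun H δ y = δ⁻¹ * H y := by
  rw [rampFun, max_eq_left hy0, min_eq_right, div_eq_inv_mul]
  rwa [div_le_one hδ]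

lemma rampFun_eq_zero {H : Vec → ℝ} {δ : ℝ} {y : Vec} (hy : H y = 0) :
    rampFun H δ y = 0 := by
  simp [rampFun, hy]

lemma exists_lipschitz_rampFun {H : Vec → ℝ} {K : ℝ≥0} (hK : LipschitzWith K H) (δ : ℝ) :
    ∃ K', LipschitzWith K' (rampFun H δ) := by
  have h1 : LipschitzWith K fun y => max (H y) 0 := hK.max_const 0
  have h2 : LipschitzWith (‖δ⁻¹‖₊ * K) fun y => max (H y) 0 / δ := by
    have := (lipschitzWith_smul (β := ℝ) δ⁻¹).comp h1
    simpa [Function.comp_def, div_eq_inv_mul] using this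
  exact ⟨_, h2.const_min 1⟩

/-- Fields of class `C¹` up to the boundary that are tangential at almost every boundary point. -/
def IsTangentialField (Ω : Set Vec) (F : Vec → Vec) : Prop :=
  ContDiffOn ℝ 1 F (closure Ω) ∧
    ∀ᵐ x ∂(surf.restrict (frontier Ω)), ∀ n, IsOuterNormal Ω x n → ⟪F x, n⟫ = 0

lemma IsTangentialField.smul {Ω : Set Vec} {F : Vec → Vec} (hF : IsTangentialField Ω F)
    {θ : Vec → ℝ} (hθ : ContDiffOn ℝ 1 θ (closure Ω)) :
    IsTangentialField Ω fun x => θ x • F x := by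
  refine ⟨hθ.smul hF.1, ?_⟩
  filter_upwards [hF.2] with x hx n hn
  rw [inner_smul_left, hx n hn, mul_zero]

namespace IsLipschitzDomain

variable {Ω : Set Vec}

/-- Moving up from y, the point stays in Ω until H reaches zero, after the length H(y). The field is
Lipschitz along this segment. The halved radius keeps the segment inside the chart. -/
lemma norm_sub_le_of_vertical (h : IsLipschitzDomain Ω) {F : Vec → Vec}
    (hF : ContDiffOn ℝ 1 F (closure Ω)) {M : ℝ≥0}
    (hM : ∀ x y, segment ℝ x y ⊆ Ω → ‖F x - F y‖ ≤ M * ‖x - y‖) {x₀ e : Vec} {ε : ℝ} {H : Vec → ℝ}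
    (hc : IsGraphChart Ω x₀ ε H e) {y : Vec} (hy : y ∈ Metric.ball x₀ (ε / 2)) (hy0 : 0 < H y)
    (hyε : H y < ε / 2) :
    y + H y • e ∈ Metric.ball x₀ ε ∧ y + H y • e ∈ frontier Ω ∧
      ‖F y - F (y + H y • e)‖ ≤ M * H y := by
  have hball : ∀ s, 0 ≤ s → s ≤ H y → y + s • e ∈ Metric.ball x₀ ε := by
    intro s hs0 hs
    rw [Metric.mem_ball] at hy ⊢
    have h1 : dist (y + s • e) y = s := by
      rw [dist_eq_norm, add_sub_cancel_left, norm_smul, hc.norm_eq, mul_one,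
        Real.norm_of_nonneg hs0]
    linarith [dist_triangle (y + s • e) y x₀]
  have hΩ : ∀ s, 0 ≤ s → s < H y → y + s • e ∈ Ω := by
    intro s hs0 hs
    rw [hc.mem_iff _ (hball s hs0 hs.le), hc.translate]
    linarith
  have hl : Continuous fun s : ℝ => y + s • e := by fun_prop
  have htend : Tendsto (fun s : ℝ => y + s • e) (𝓝[<] (H y)) (𝓝 (y + H y • e)) :=
    (hl.tendsto _).mono_left nhdsWithin_le_nhds
  have hev : ∀ᶠ s in 𝓝[<] (H y), y + s • e ∈ Ω := by
    filter_upwards [Ioo_mem_nhdsLT hy0] with s hs using hΩ s hs.1.le hs.2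
  have hcl : y + H y • e ∈ closure Ω := mem_closure_of_tendsto htend hev
  have hb := hball _ hy0.le le_rfl
  refine ⟨hb, ?_, ?_⟩
  · rw [h.isOpen.frontier_eq]
    refine ⟨hcl, fun hm => ?_⟩
    rw [hc.mem_iff _ hb, hc.translate] at hm
    linarith
  · have h1 : Tendsto (fun s : ℝ => ‖F y - F (y + s • e)‖) (𝓝[<] (H y))
        (𝓝 ‖F y - F (y + H y • e)‖) := by
      have h2 : Tendsto (fun s : ℝ => y + s • e) (𝓝[<] (H y)) (𝓝[closure Ω] (y + H y • e)) :=
        tendsto_nhdsWithin_of_tendsto_nhds_of_eventually_within _ htend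
          (hev.mono fun s hs => subset_closure hs)
      exact (((hF.continuousOn _ hcl).tendsto.comp h2).const_sub (F y)).norm
    refine le_of_tendsto h1 ?_
    filter_upwards [Ioo_mem_nhdsLT hy0] with s hs
    refine (hM y (y + s • e) ?_).trans ?_
    · rintro z ⟨a, b, ha, hb, hab, rfl⟩
      have : a • y + b • (y + s • e) = y + (b * s) • e := by
        obtain rfl : a = 1 - b := by linarith
        module
      rw [this]
      have hb1 : b ≤ 1 := by linarith
      exact hΩ _ (mul_nonneg hb hs.1.le) (by nlinarith [hs.1, hs.2])
    · gcongr
      rw [sub_add_cancel_left, norm_neg, norm_smul, hc.norm_eq, mul_one,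
        Real.norm_of_nonneg hs.1.le]
      exact hs.2.le

/-- Along tangential fields, the derivative of the cutoff function stays bounded. -/
lemma abs_fderiv_rampFun_le (h : IsLipschitzDomain Ω) {F : Vec → Vec}
    (hF : ContDiffOn ℝ 1 F (closure Ω)) {M : ℝ≥0}
    (hM : ∀ x y, segment ℝ x y ⊆ Ω → ‖F x - F y‖ ≤ M * ‖x - y‖) {x₀ e : Vec} {ε : ℝ} {H : Vec → ℝ}
    {K : ℝ≥0} (hK : LipschitzWith K H) (hc : IsGraphChart Ω x₀ ε H e)
    (hsupp : ∀ x ∈ closure Ω, F x ≠ 0 → x ∈ Metric.ball x₀ (ε / 2)) {δ : ℝ} (hδ : 0 < δ)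
    (hδε : δ < ε / 2) {y : Vec} (hy : y ∈ Ω) (hHd : DifferentiableAt ℝ H y)
    (hN : y + H y • e ∈ frontier Ω → ∀ n, IsOuterNormal Ω (y + H y • e) n →
      ⟪F (y + H y • e), n⟫ = 0) :
    |fderiv ℝ (rampFun H δ) y (F y)| ≤ K * M := by
  have hKM : (0 : ℝ) ≤ K * M := by positivity
  by_cases hF0 : F y = 0
  · rw [hF0, map_zero, abs_zero]; exact hKM
  have hyb := hsupp y (subset_closure hy) hF0
  have hyb' : y ∈ Metric.ball x₀ ε := Metric.ball_subset_ball (by linarith [hc.pos]) hyb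
  have hy0 : 0 < H y := (hc.mem_iff y hyb').1 hy
  rcases le_or_gt δ (H y) with hyδ | hyδ
  -- Where H ≥ δ the ramp attains its maximal value, so its derivative vanishes even at the kink.
  · have hmax : IsLocalMax (rampFun H δ) y := by
      refine Eventually.of_forall fun z => ?_
      rw [rampFun_eq_one hδ hyδ]
      exact rampFun_le_one _ _ _
    rw [hmax.fderiv_eq_zero]
    simpa using hKM
  · obtain ⟨hpb, hpf, hpn⟩ := h.norm_sub_le_of_vertical hF hM hc hyb hy0 (hyδ.trans hδε)
    set p := y + H y • e with hp
    have hp0 : H p = 0 := by rw [hp, hc.translate, sub_self]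
    have hD := hHd.hasFDerivAt
    have hDp : HasFDerivAt H (fderiv ℝ H y) p := hc.hasFDerivAt_translate hD _
    obtain ⟨n, hn, c, hc0, hcn⟩ := hc.exists_outerNormal hpb hp0 hDp
    have hFp : fderiv ℝ H y (F p) = 0 := by rw [hcn, hN hpf n hn, mul_zero]
    have hloc : rampFun H δ =ᶠ[𝓝 y] fun z => δ⁻¹ * H z := by
      have hcont := hK.continuous.continuousAt (x := y)
      filter_upwards [hcont.eventually (lt_mem_nhds hy0), hcont.eventually (gt_mem_nhds hyδ)]
        with z hz1 hz2 using rampFun_eq_div hδ hz1.le hz2.le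
    rw [hloc.fderiv_eq, fderiv_const_mul hHd]
    -- At the boundary point p above y the field is tangential, so F(y) may be replaced by F(y) -
    -- F(p), which is of size M H(y) ≤ M δ and compensates the factor δ⁻¹ of the ramp.
    have h1 : fderiv ℝ H y (F y) = fderiv ℝ H y (F y - F p) := by rw [map_sub, hFp, sub_zero]
    have h2 : |fderiv ℝ H y (F y)| ≤ K * (M * H y) := by
      rw [h1, ← Real.norm_eq_abs]
      refine (ContinuousLinearMap.le_opNorm _ _).trans ?_
      exact mul_le_mul (norm_fderiv_le_of_lipschitz ℝ hK) hpn (norm_nonneg _) K.2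
    simp only [FunLike.coe_smul, Pi.smul_apply, smul_eq_mul, abs_mul, abs_inv, abs_of_pos hδ]
    rw [inv_mul_le_iff₀ hδ]
    refine h2.trans ?_
    rw [← mul_assoc, mul_comm δ]
    exact mul_le_mul_of_nonneg_left hyδ.le hKM

/-- The product of F with the ramp vanishes on the frontier, so its divergence has integral zero. As
the ramp narrows, its gradient paired with F stays bounded by `abs_fderiv_rampFun_le` and becomes
zero at each fixed interior point; dominated convergence leaves the divergence of F. -/
lemma integral_divg_eq_zero_of_chart (h : IsLipschitzDomain Ω) {F : Vec → Vec}
    (hF : IsTangentialField Ω F) {x₀ : Vec} {ε : ℝ} {H : Vec → ℝ} {A : Vec ≃ₗᵢ[ℝ] Vec}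
    {K : ℝ≥0} (hK : LipschitzWith K H) (hc : IsGraphChart Ω x₀ ε H (upVec A))
    (hsupp : ∀ x ∈ closure Ω, F x ≠ 0 → x ∈ Metric.ball x₀ (ε / 2)) :
    ∫ x in Ω, divg (fderivWithin ℝ F (closure Ω) x) = 0 := by
  obtain ⟨M, hMb, hM⟩ := h.exists_lipschitz hF.1
  have hε := hc.pos
  have hdc : ContinuousOn (fun x => divg (fderivWithin ℝ F (closure Ω) x)) (closure Ω) :=
    continuous_divg.comp_continuousOn (h.continuousOn_fderivWithin hF.1 le_rfl)
  obtain ⟨C, hC⟩ := h.isCompact_closure.exists_bound_of_continuousOn hdc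
  -- The widths tend to zero; the shift by 3 keeps them below ε/2 already for k = 0.
  have hδ : ∀ k : ℕ, 0 < ε / (k + 3) := fun k => by positivity
  have hδε : ∀ k : ℕ, ε / (k + 3) < ε / 2 := fun k => by
    apply div_lt_div_of_pos_left hε (by norm_num)
    have : (0 : ℝ) ≤ k := k.cast_nonneg
    linarith
  have hδ0 : Tendsto (fun k : ℕ => ε / ((k : ℝ) + 3)) atTop (𝓝 0) :=
    tendsto_const_nhds.div_atTop (tendsto_atTop_add_const_right _ _ tendsto_natCast_atTop_atTop)
  set ζ : ℕ → Vec → ℝ := fun k => rampFun H (ε / (k + 3)) with hζ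
  choose K' hK' using fun k : ℕ => exists_lipschitz_rampFun hK (ε / (k + 3))
  set I : ℕ → Vec → ℝ := fun k y =>
    ∑ i, lineDeriv ℝ (fun z => ζ k z * F z i) y (unitVec i) with hI
  have hind : ∀ k, ∀ i : Fin 3, ∃ M', LipschitzWith M' (Ω.indicator fun z => ζ k z * F z i) := by
    intro k i
    have hcoord : ∀ w : Vec, |w i| ≤ ‖w‖ := fun w => by
      simpa using PiLp.norm_apply_le w i
    refine ⟨M + M * K' k, lipschitzWith_indicator h.isOpen ?_ ?_ ?_⟩
    · exact (hK' k).continuous.continuousOn.mul (contDiffOn_coord hF.1 i).continuousOn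
    · intro x hx
      by_cases hx0 : F x = 0
      · simp [hx0]
      · have hxb := hsupp x (frontier_subset_closure hx) hx0
        simp [hζ, rampFun_eq_zero (hc.eq_zero_of_mem_frontier hK.continuous
          (Metric.ball_subset_ball (by linarith) hxb) hx)]
    · intro x y hxy
      have h1 : |F x i - F y i| ≤ M * ‖x - y‖ := (hcoord (F x - F y)).trans (hM x y hxy)
      have h2 : |ζ k x - ζ k y| ≤ K' k * ‖x - y‖ := by
        simpa [dist_eq_norm] using (hK' k).dist_le_mul x y
      have h3 : |F y i| ≤ M :=
        (hcoord _).trans (hMb y (subset_closure (hxy (right_mem_segment ℝ x y))))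
      have h4 : |ζ k x| ≤ 1 := by
        rw [abs_of_nonneg (rampFun_nonneg H (hδ k) x)]; exact rampFun_le_one _ _ _
      calc |ζ k x * F x i - ζ k y * F y i|
          = |ζ k x * (F x i - F y i) + F y i * (ζ k x - ζ k y)| := by ring_nf
        _ ≤ |ζ k x| * |F x i - F y i| + |F y i| * |ζ k x - ζ k y| := by
          rw [← abs_mul, ← abs_mul]; exact abs_add_le _ _
        _ ≤ 1 * (M * ‖x - y‖) + M * (K' k * ‖x - y‖) := by gcongr
        _ = _ := by push_cast; ring
  have hline : ∀ k, ∀ i : Fin 3, IntegrableOn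
      (fun y => lineDeriv ℝ (fun z => ζ k z * F z i) y (unitVec i)) Ω := by
    intro k i
    obtain ⟨M', hM'⟩ := hind k i
    have h1 := (hM'.memLp_lineDeriv (μ := volume.restrict Ω) (unitVec i))
    have : IsFiniteMeasure (volume.restrict Ω) := ⟨by simpa using h.measure_lt_top⟩
    refine IntegrableOn.congr_fun (h1.integrable le_top) (fun y hy => ?_) h.isOpen.measurableSet
    apply Filter.EventuallyEq.lineDeriv_eq
    filter_upwards [h.isOpen.mem_nhds hy] with z hz using indicator_of_mem hz _
  have hI0 : ∀ k, ∫ y in Ω, I k y = 0 := by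
    intro k
    rw [hI, integral_finsetSum _ fun i _ => hline k i]
    refine Finset.sum_eq_zero fun i _ => ?_
    obtain ⟨M', hM'⟩ := hind k i
    exact integral_lineDeriv_eq_zero h.isOpen h.isBounded h.volume_frontier hM' _
  have hIeq : ∀ k, ∀ y ∈ Ω, DifferentiableAt ℝ (ζ k) y →
      I k y = ζ k y * divg (fderivWithin ℝ F (closure Ω) y) + fderiv ℝ (ζ k) y (F y) := by
    intro k y hy hd
    have h1 : HasFDerivAt (fun z => ζ k z • F z)
        (ζ k y • fderivWithin ℝ F (closure Ω) y + (fderiv ℝ (ζ k) y).smulRight (F y)) y :=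
      hd.hasFDerivAt.fun_smul (h.hasFDerivAt hF.1 hy)
    have h2 := divg_eq_sum_lineDeriv h1
    simp only [PiLp.smul_apply, smul_eq_mul] at h2
    rw [hI]
    simp only
    rw [← h2]
    simp only [divg_eq_sum, FunLike.coe_add, FunLike.coe_smul, Pi.add_apply, Pi.smul_apply, PiLp.add_apply,
      PiLp.smul_apply, smul_eq_mul, ContinuousLinearMap.smulRight_apply, Finset.sum_add_distrib,
      Finset.mul_sum]
    congr 1
    conv_rhs => rw [vec_eq_sum (F y)]
    simp only [map_sum, map_smul, smul_eq_mul, mul_comm]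
  -- The set where F fails to be tangential is a surface null set, so almost every y lies below a
  -- boundary point outside it.
  have hNae : ∀ᵐ y : Vec, y + H y • upVec A ∈ frontier Ω →
      ∀ n, IsOuterNormal Ω (y + H y • upVec A) n → ⟪F (y + H y • upVec A), n⟫ = 0 := by
    have hmeas : MeasurableSet (frontier Ω) := isClosed_frontier.measurableSet
    have h2 := (ae_restrict_iff' hmeas).1 hF.2
    have h3 := ae_vertical_notMem A H (ae_iff.1 h2)
    filter_upwards [h3] with y hy
    simpa using hy
  have hdiff : ∀ᵐ y : Vec, ∀ k, DifferentiableAt ℝ (ζ k) y :=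
    ae_all_iff.2 fun k => (hK' k).ae_differentiableAt
  have hlim : Tendsto (fun k => ∫ y in Ω, I k y) atTop
      (𝓝 (∫ y in Ω, divg (fderivWithin ℝ F (closure Ω) y))) := by
    have hfin : volume Ω ≠ ⊤ := h.measure_lt_top.ne
    refine tendsto_integral_of_dominated_convergence (fun _ => C + K * M) ?_ ?_ ?_ ?_
    · exact fun k => (integrable_finsetSum _ fun i _ => hline k i).aestronglyMeasurable
    · exact integrableOn_const hfin
    · intro k
      rw [ae_restrict_iff' h.isOpen.measurableSet]
      filter_upwards [hdiff, hNae, hK.ae_differentiableAt (μ := volume)] with y hy1 hy2 hy3 hyΩ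
      rw [hIeq k y hyΩ (hy1 k)]
      refine (norm_add_le _ _).trans (add_le_add ?_ ?_)
      · rw [norm_mul, Real.norm_of_nonneg (rampFun_nonneg H (hδ k) y)]
        have := hC y (subset_closure hyΩ)
        nlinarith [rampFun_nonneg H (hδ k) y, rampFun_le_one H (ε / (k + 3)) y,
          norm_nonneg (divg (fderivWithin ℝ F (closure Ω) y))]
      · exact h.abs_fderiv_rampFun_le hF.1 hM hK hc hsupp (hδ k) (hδε k) hyΩ hy3 hy2
    · rw [ae_restrict_iff' h.isOpen.measurableSet]
      filter_upwards [hdiff] with y hy1 hyΩ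
      apply tendsto_const_nhds.congr'
      by_cases hyb : y ∈ Metric.ball x₀ ε
      · have hy0 : 0 < H y := (hc.mem_iff y hyb).1 hyΩ
        filter_upwards [hδ0.eventually (gt_mem_nhds hy0)] with k hk
        rw [hIeq k y hyΩ (hy1 k)]
        have hmax : IsLocalMax (ζ k) y := by
          refine Eventually.of_forall fun z => ?_
          simp only [hζ]
          rw [rampFun_eq_one (hδ k) hk.le]
          exact rampFun_le_one _ _ _
        rw [hmax.fderiv_eq_zero]
        simp [hζ, rampFun_eq_one (hδ k) hk.le]
      -- Outside the chart ball H says nothing about Ω, but there F vanishes in a neighbourhood.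
      · have hF0 : F =ᶠ[𝓝 y] fun _ => 0 := by
          have : (Metric.closedBall x₀ (ε / 2))ᶜ ∈ 𝓝 y := by
            apply Metric.isClosed_closedBall.isOpen_compl.mem_nhds
            intro hm
            exact hyb (Metric.closedBall_subset_ball (by linarith) hm)
          filter_upwards [h.isOpen.mem_nhds hyΩ, this] with z hz1 hz2
          by_contra hne
          exact hz2 (Metric.ball_subset_closedBall (hsupp z (subset_closure hz1) hne))
        have hfd : fderivWithin ℝ F (closure Ω) y = 0 := by
          rw [fderivWithin_of_mem_nhds (h.closure_mem_nhds hyΩ), hF0.fderiv_eq]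
          simp
        refine Eventually.of_forall fun k => ?_
        simp only
        rw [hIeq k y hyΩ (hy1 k), hfd, hF0.self_of_nhds]
        simp [divg_eq_sum]
  simp only [hI0] at hlim
  exact (tendsto_nhds_unique hlim tendsto_const_nhds)

/-- Near an interior point the field vanishes on the frontier; near a boundary point a chart is
available. The factor 2 matches the ratio of outer to inner radius of the bumps in
`integral_divg_eq_zero`. -/
lemma exists_radius_integral_divg (h : IsLipschitzDomain Ω) {x : Vec} (hx : x ∈ closure Ω) :
    ∃ r > 0, ∀ F, IsTangentialField Ω F →
      (∀ y ∈ closure Ω, F y ≠ 0 → y ∈ Metric.ball x (2 * r)) →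
      ∫ y in Ω, divg (fderivWithin ℝ F (closure Ω) y) = 0 := by
  by_cases hxΩ : x ∈ Ω
  · obtain ⟨r, hr, hrΩ⟩ := Metric.isOpen_iff.1 h.isOpen x hxΩ
    refine ⟨r / 2, by positivity, fun F hF hs => h.integral_divg_eq_zero_of_zero hF.1 ?_⟩
    intro y hy
    by_contra hne
    have := hs y (frontier_subset_closure hy) hne
    rw [mul_div_cancel₀ r (by norm_num)] at this
    rw [h.isOpen.frontier_eq] at hy
    exact hy.2 (hrΩ this)
  · have hxf : x ∈ frontier Ω := by rw [h.isOpen.frontier_eq]; exact ⟨hx, hxΩ⟩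
    obtain ⟨A, H, ε, K, hK, hc⟩ := h.exists_chart hxf
    refine ⟨ε / 4, by linarith [hc.pos], fun F hF hs => ?_⟩
    refine h.integral_divg_eq_zero_of_chart hF hK hc ?_
    convert hs using 5
    ring

lemma integral_divg_add (h : IsLipschitzDomain Ω) {F G : Vec → Vec}
    (hF : ContDiffOn ℝ 1 F (closure Ω)) (hG : ContDiffOn ℝ 1 G (closure Ω)) :
    ∫ y in Ω, divg (fderivWithin ℝ (fun z => F z + G z) (closure Ω) y) =
      (∫ y in Ω, divg (fderivWithin ℝ F (closure Ω) y)) +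
        ∫ y in Ω, divg (fderivWithin ℝ G (closure Ω) y) := by
  have hi : ∀ {F : Vec → Vec}, ContDiffOn ℝ 1 F (closure Ω) →
      IntegrableOn (fun y => divg (fderivWithin ℝ F (closure Ω) y)) Ω := fun hF =>
    h.integrableOn (continuous_divg.comp_continuousOn (h.continuousOn_fderivWithin hF le_rfl))
  rw [← integral_add (hi hF) (hi hG)]
  apply setIntegral_congr_fun h.isOpen.measurableSet
  intro y hy
  have h1 := (h.hasFDerivAt hF hy).fun_add (h.hasFDerivAt hG hy)
  simp only
  rw [fderivWithin_of_mem_nhds (h.closure_mem_nhds hy), h1.fderiv]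
  simp [divg_eq_sum, Finset.sum_add_distrib]

/-- The divergence theorem for fields that are tangential at almost every boundary point. -/
theorem integral_divg_eq_zero (h : IsLipschitzDomain Ω) {F : Vec → Vec}
    (hF : IsTangentialField Ω F) :
    ∫ y in Ω, divg (fderivWithin ℝ F (closure Ω) y) = 0 := by
  choose! r hr hloc using fun x (hx : x ∈ closure Ω) => h.exists_radius_integral_divg hx
  -- Instead of a partition of unity, bumps are split off one at a time: b F has zero integral by
  -- the local result, and (1 - b) F vanishes on the inner ball. The clause that zeros of F remain
  -- zeros of G keeps the balls treated earlier.
  have hcov : ∀ t : Finset Vec, (∀ x ∈ t, x ∈ closure Ω) → ∀ F, IsTangentialField Ω F →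
      ∃ G, IsTangentialField Ω G ∧
        ∫ y in Ω, divg (fderivWithin ℝ F (closure Ω) y) =
          ∫ y in Ω, divg (fderivWithin ℝ G (closure Ω) y) ∧
        (∀ y, F y = 0 → G y = 0) ∧ ∀ x ∈ t, ∀ y ∈ Metric.ball x (r x), G y = 0 := by
    classical
    intro t
    induction t using Finset.induction_on with
    | empty => exact fun _ F hF => ⟨F, hF, rfl, fun _ => id, by simp⟩
    | insert x t hxt ih =>
      intro ht F hF
      have hx := ht x (Finset.mem_insert_self x t)
      let b : ContDiffBump x := ⟨r x, 2 * r x, hr x hx, by linarith [hr x hx]⟩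
      have hb : ContDiffOn ℝ 1 b (closure Ω) := b.contDiff.contDiffOn
      have hb' : ContDiffOn ℝ 1 (fun y => 1 - b y) (closure Ω) := contDiffOn_const.sub hb
      obtain ⟨G, hG, hGi, hG0, hGt⟩ := ih (fun z hz => ht z (Finset.mem_insert_of_mem hz)) _
        (hF.smul hb')
      refine ⟨G, hG, ?_, fun y hy => hG0 y (by simp [hy]), ?_⟩
      · rw [← hGi]
        have h1 := h.integral_divg_add (hF.smul hb).1 (hF.smul hb').1
        have h2 : (fun z => b z • F z + (1 - b z) • F z) = F := by
          ext1 z; module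
        rw [h2] at h1
        rw [h1, hloc x hx _ (hF.smul hb), zero_add]
        intro y _ hy
        have : b y ≠ 0 := fun h0 => hy (by simp [h0])
        have hsup : y ∈ Function.support b := this
        rwa [b.support_eq] at hsup
      · intro z hz y hy
        rcases Finset.mem_insert.1 hz with rfl | hz
        · apply hG0
          have : b y = 1 := b.one_of_mem_closedBall (Metric.ball_subset_closedBall hy)
          simp [this]
        · exact hGt z hz y hy
  obtain ⟨t, ht, htc⟩ := h.isCompact_closure.elim_nhds_subcover (fun x => Metric.ball x (r x))
    (fun x hx => Metric.ball_mem_nhds x (hr x hx))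
  obtain ⟨G, hG, hGi, -, hG0⟩ := hcov t ht F hF
  rw [hGi]
  apply h.integral_divg_eq_zero_of_zero hG.1
  intro y hy
  obtain ⟨x, hx, hyx⟩ := mem_iUnion₂.1 (htc (frontier_subset_closure hy))
  exact hG0 x hx y hyx

end IsLipschitzDomain

end ViscoPlast
end

noncomputable section

namespace ViscoPlast

/-! ### Concentrating test functions at a boundary point -/

/-- The derivative of `expNegInvGlue`. -/
def glueSlope (x : ℝ) : ℝ := (x⁻¹) ^ 2 * expNegInvGlue x

lemma hasDerivAt_expNegInvGlue (x : ℝ) : HasDerivAt expNegInvGlue (glueSlope x) x := by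
  simpa [glueSlope] using expNegInvGlue.hasDerivAt_polynomial_eval_inv_mul 1 x

lemma continuous_glueSlope : Continuous glueSlope := by
  have := expNegInvGlue.continuous_polynomial_eval_inv_mul (Polynomial.X ^ 2 : Polynomial ℝ)
  simp only [Polynomial.eval_pow, Polynomial.eval_X] at this
  exact this

lemma glueSlope_nonneg (x : ℝ) : 0 ≤ glueSlope x :=
  mul_nonneg (sq_nonneg _) (expNegInvGlue.nonneg x)

lemma glueSlope_pos {x : ℝ} (hx : 0 < x) : 0 < glueSlope x :=
  mul_pos (by positivity) (expNegInvGlue.pos_of_pos hx)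

lemma glueSlope_of_nonpos {x : ℝ} (hx : x ≤ 0) : glueSlope x = 0 := by
  simp [glueSlope, expNegInvGlue.zero_of_nonpos hx]

/-- A smooth radial bump supported in the unit ball. -/
def radialBump (z : Vec) : ℝ := expNegInvGlue (1 - ‖z‖ ^ 2)

/-- The bump of radius `r` centered at `x`. -/
def bumpAt (x : Vec) (r : ℝ) (y : Vec) : ℝ := radialBump (r⁻¹ • (y - x))

lemma contDiff_radialBump {n : ℕ∞} : ContDiff ℝ n radialBump :=
  expNegInvGlue.contDiff.comp (contDiff_const.sub (contDiff_id.norm_sq ℝ))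

lemma contDiff_bumpAt {n : ℕ∞} (x : Vec) (r : ℝ) : ContDiff ℝ n (bumpAt x r) :=
  contDiff_radialBump.comp ((contDiff_id.sub contDiff_const).const_smul r⁻¹)

lemma radialBump_eq_zero {z : Vec} (hz : 1 ≤ ‖z‖) : radialBump z = 0 :=
  expNegInvGlue.zero_of_nonpos (by nlinarith)

lemma bumpAt_eq_zero {x y : Vec} {r : ℝ} (hr : 0 < r) (hy : y ∉ Metric.ball x r) :
    bumpAt x r y = 0 := by
  apply radialBump_eq_zero
  rw [norm_smul, norm_inv, Real.norm_of_nonneg hr.le, inv_mul_eq_div, le_div_iff₀ hr, one_mul]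
  rwa [Metric.mem_ball, dist_eq_norm, not_lt] at hy

lemma hasFDerivAt_radialBump (z : Vec) :
    HasFDerivAt radialBump ((glueSlope (1 - ‖z‖ ^ 2) * (-2)) • innerSL ℝ z) z := by
  have h1 : HasFDerivAt (fun z : Vec => 1 - ‖z‖ ^ 2) ((-2 : ℝ) • innerSL ℝ z) z := by
    have := (hasStrictFDerivAt_norm_sq z).hasFDerivAt.const_sub 1
    refine this.congr_fderiv ?_
    ext w; simp
  have := (hasDerivAt_expNegInvGlue (1 - ‖z‖ ^ 2)).comp_hasFDerivAt z h1
  rw [smul_smul] at this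
  exact this

lemma fderiv_bumpAt (x : Vec) (r : ℝ) (y w : Vec) : fderiv ℝ (bumpAt x r) y w =
    r⁻¹ * (glueSlope (1 - ‖r⁻¹ • (y - x)‖ ^ 2) * (-2) * ⟪r⁻¹ • (y - x), w⟫) := by
  have h1 : HasFDerivAt (fun y : Vec => r⁻¹ • (y - x)) (r⁻¹ • ContinuousLinearMap.id ℝ Vec) y :=
    ((hasFDerivAt_id y).sub_const x).const_smul r⁻¹
  have h2 := (hasFDerivAt_radialBump (r⁻¹ • (y - x))).comp y h1
  have h3 : fderiv ℝ (bumpAt x r) y = _ := h2.fderiv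
  rw [h3]
  simp only [ContinuousLinearMap.comp_apply, FunLike.coe_smul, Pi.smul_apply,
    ContinuousLinearMap.id_apply, innerSL_apply_apply, smul_eq_mul, inner_smul_right]
  ring

lemma hasCompactSupport_glueSlope : HasCompactSupport fun z : Vec => glueSlope (1 - ‖z‖ ^ 2) := by
  apply HasCompactSupport.intro (isCompact_closedBall (0 : Vec) 1)
  intro z hz
  apply glueSlope_of_nonpos
  rw [mem_closedBall_zero_iff, not_le] at hz
  nlinarith

/-- The flux of the bump through a half space. -/
def halfSpaceFlux (n : Vec) : ℝ :=
  ∫ z : Vec, glueSlope (1 - ‖z‖ ^ 2) * 2 * max (-⟪z, n⟫) 0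

lemma halfSpaceFlux_pos {n : Vec} (hn : ‖n‖ = 1) : 0 < halfSpaceFlux n := by
  have hc : Continuous fun z : Vec => glueSlope (1 - ‖z‖ ^ 2) :=
    continuous_glueSlope.comp (by fun_prop)
  -- The point -n/2 lies inside the unit ball and strictly inside the half space, so the integrand
  -- is positive there.
  refine Continuous.integral_pos_of_hasCompactSupport_nonneg_nonzero (x := -((1 / 2 : ℝ) • n))
    (by fun_prop) ?_ ?_ ?_
  · exact (hasCompactSupport_glueSlope.mul_right).mul_right
  · intro z
    exact mul_nonneg (mul_nonneg (glueSlope_nonneg _) zero_le_two) (le_max_right _ _)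
  · have h1 : ‖-((1 / 2 : ℝ) • n)‖ = 1 / 2 := by rw [norm_neg, norm_smul, hn]; norm_num
    have h2 : ⟪-((1 / 2 : ℝ) • n), n⟫ = -(1 / 2) := by
      rw [inner_neg_left, inner_smul_left, real_inner_self_eq_norm_sq, hn]; norm_num
    rw [h1, h2]
    have : 0 < glueSlope (1 - (1 / 2) ^ 2) := glueSlope_pos (by norm_num)
    norm_num
    norm_num at this
    exact this.ne'

lemma integrable_glueSlope_mul {g : Vec → ℝ} (hg : Measurable g) {C : ℝ}
    (hC : ∀ z, ‖z‖ ≤ 1 → |g z| ≤ C) :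
    Integrable fun z : Vec => glueSlope (1 - ‖z‖ ^ 2) * g z := by
  have hc : Continuous fun z : Vec => glueSlope (1 - ‖z‖ ^ 2) :=
    continuous_glueSlope.comp (by fun_prop)
  refine ((hc.integrable_of_hasCompactSupport hasCompactSupport_glueSlope).mul_const C).mono'
    (hc.measurable.mul hg).aestronglyMeasurable (Eventually.of_forall fun z => ?_)
  rw [norm_mul, Real.norm_of_nonneg (glueSlope_nonneg _)]
  by_cases hz : ‖z‖ ≤ 1
  · exact mul_le_mul_of_nonneg_left (hC z hz) (glueSlope_nonneg _)
  · have : glueSlope (1 - ‖z‖ ^ 2) = 0 := glueSlope_of_nonpos (by nlinarith)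
    simp [this]

/-- The normal part of a contributes the flux. The tangential part b contributes nothing, because
reflection in the plane orthogonal to b preserves the half space and changes the sign of the
integrand. -/
lemma integral_halfSpace {n : Vec} (hn : ‖n‖ = 1) (a : Vec) :
    ∫ z : Vec, glueSlope (1 - ‖z‖ ^ 2) * (if ⟪z, n⟫ < 0 then -2 * ⟪z, a⟫ else 0) =
      halfSpaceFlux n * ⟪a, n⟫ := by
  set b := a - ⟪a, n⟫ • n with hb
  have hbn : ⟪b, n⟫ = 0 := by
    rw [hb, inner_sub_left, inner_smul_left, real_inner_self_eq_norm_sq, hn]; simp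
  have hmeas : ∀ w : Vec, Measurable fun z : Vec => if ⟪z, n⟫ < 0 then -2 * ⟪z, w⟫ else 0 := by
    intro w
    refine Measurable.ite ?_ (by fun_prop) measurable_const
    exact measurableSet_lt (by fun_prop) measurable_const
  have hbd : ∀ w z : Vec, ‖z‖ ≤ 1 → |if ⟪z, n⟫ < 0 then -2 * ⟪z, w⟫ else 0| ≤ 2 * ‖w‖ := by
    intro w z hz
    split_ifs
    · rw [abs_mul, abs_neg, abs_two]
      have := abs_real_inner_le_norm z w
      nlinarith [norm_nonneg w]
    · simp
  have hint := fun w => integrable_glueSlope_mul (hmeas w) (hbd w)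
  have hzero : ∫ z : Vec, glueSlope (1 - ‖z‖ ^ 2) *
      (if ⟪z, n⟫ < 0 then -2 * ⟪z, b⟫ else 0) = 0 := by
    set σ := (ℝ ∙ b)ᗮ.reflection with hσ
    have hσb : σ b = -b := Submodule.reflection_orthogonalComplement_singleton_eq_neg b
    have hσn : σ n = n := by
      apply Submodule.reflection_mem_subspace_eq_self
      rw [Submodule.mem_orthogonal_singleton_iff_inner_right]
      exact hbn
    have h1 := σ.measurePreserving.integral_comp σ.toHomeomorph.measurableEmbedding
      (fun z : Vec => glueSlope (1 - ‖z‖ ^ 2) * (if ⟪z, n⟫ < 0 then -2 * ⟪z, b⟫ else 0))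
    have h2 : ∀ z, ⟪σ z, n⟫ = ⟪z, n⟫ := fun z => by
      conv_lhs => rw [← hσn]
      exact σ.inner_map_map z n
    have h3 : ∀ z, ⟪σ z, b⟫ = -⟪z, b⟫ := fun z => by
      rw [← inner_neg_right, ← σ.inner_map_map z (-b), map_neg, hσb, neg_neg]
    simp only [h2, h3, LinearIsometryEquiv.norm_map] at h1
    have h4 : ∀ z : Vec, glueSlope (1 - ‖z‖ ^ 2) * (if ⟪z, n⟫ < 0 then -2 * -⟪z, b⟫ else 0) =
        -(glueSlope (1 - ‖z‖ ^ 2) * (if ⟪z, n⟫ < 0 then -2 * ⟪z, b⟫ else 0)) := by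
      intro z; split_ifs <;> ring
    simp only [h4, integral_neg] at h1
    linarith
  have hsplit : ∀ z : Vec, glueSlope (1 - ‖z‖ ^ 2) * (if ⟪z, n⟫ < 0 then -2 * ⟪z, a⟫ else 0) =
      glueSlope (1 - ‖z‖ ^ 2) * (if ⟪z, n⟫ < 0 then -2 * ⟪z, b⟫ else 0) +
      glueSlope (1 - ‖z‖ ^ 2) * 2 * max (-⟪z, n⟫) 0 * ⟪a, n⟫ := by
    intro z
    have : ⟪z, a⟫ = ⟪z, b⟫ + ⟪a, n⟫ * ⟪z, n⟫ := by
      rw [hb, inner_sub_right, inner_smul_right]; ring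
    split_ifs with h
    · rw [max_eq_left (by linarith), this]; ring
    · rw [max_eq_right (by linarith)]; ring
  have hint2 : Integrable fun z : Vec => glueSlope (1 - ‖z‖ ^ 2) * 2 * max (-⟪z, n⟫) 0 * ⟪a, n⟫ := by
    have := (hint a).sub (hint b)
    refine this.congr (Eventually.of_forall fun z => ?_)
    simp only [Pi.sub_apply]
    rw [hsplit z]; ring
  rw [integral_congr_ae (Eventually.of_forall hsplit), integral_add (hint b) hint2, hzero, zero_add,
    integral_mul_const, halfSpaceFlux]

section Concentration

variable {Ω : Set Vec} {x n : Vec}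

lemma integral_comp_scale (f : Vec → ℝ) (x : Vec) {r : ℝ} (hr : 0 < r) :
    ∫ z, f (x + r • z) = (r⁻¹) ^ 3 * ∫ y, f y := by
  have h1 := Measure.integral_comp_smul (volume : Measure Vec) (fun w => f (x + w)) r
  rw [integral_add_left_eq_self f x] at h1
  rw [h1, finrank_euclideanSpace_fin, smul_eq_mul, abs_of_pos (by positivity), inv_pow]

lemma IsLipschitzDomain.ae_inner_ne_zero (hn : n ≠ 0) : ∀ᵐ z : Vec, ⟪z, n⟫ ≠ 0 := by
  have h1 : volume ((ℝ ∙ n)ᗮ : Set Vec) = 0 := by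
    apply Measure.addHaar_submodule
    intro h
    have : n ∈ (ℝ ∙ n)ᗮ := h ▸ Submodule.mem_top
    rw [Submodule.mem_orthogonal_singleton_iff_inner_right] at this
    exact hn (inner_self_eq_zero.1 this)
  filter_upwards [measure_eq_zero_iff_ae_notMem.1 h1] with z hz h0
  apply hz
  rw [SetLike.mem_coe, Submodule.mem_orthogonal_singleton_iff_inner_right, real_inner_comm]
  exact h0

/-- The gradients of concentrating bumps, rescaled, extract the normal component of a continuous
field at a boundary point. -/
theorem IsLipschitzDomain.tendsto_bump_flux (h : IsLipschitzDomain Ω) (hx : x ∈ closure Ω)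
    (hn : IsOuterNormal Ω x n) {F : Vec → Vec} (hF : ContinuousOn F (closure Ω)) :
    Tendsto (fun r : ℝ => (r⁻¹) ^ 2 * ∫ y in Ω, fderiv ℝ (bumpAt x r) y (F y)) (𝓝[>] 0)
      (𝓝 (halfSpaceFlux n * ⟪F x, n⟫)) := by
  classical
  obtain ⟨C, hC⟩ := h.isCompact_closure.exists_bound_of_continuousOn hF
  have hC0 : 0 ≤ C := (norm_nonneg _).trans (hC x hx)
  set F' : Vec → Vec := Ω.indicator F with hF'
  have hF'm : Measurable F' := by
    have := (hF.mono subset_closure).measurable_piecewise (g := 0)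
      continuous_zero.continuousOn h.isOpen.measurableSet
    rwa [piecewise_eq_indicator] at this
  have hF'b : ∀ y, ‖F' y‖ ≤ C := by
    intro y
    by_cases hy : y ∈ Ω
    · rw [hF', indicator_of_mem hy]; exact hC y (subset_closure hy)
    · rw [hF', indicator_of_notMem hy, norm_zero]; exact hC0
  -- Substituting y = x + r z produces r³ from the volume and r⁻¹ from the gradient of the bump,
  -- which fixes the normalization r⁻².
  have hscale : ∀ r > 0, (r⁻¹) ^ 2 * ∫ y in Ω, fderiv ℝ (bumpAt x r) y (F y) =
      ∫ z, glueSlope (1 - ‖z‖ ^ 2) * (-2 * ⟪z, F' (x + r • z)⟫) := by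
    intro r hr
    have h1 : ∫ y in Ω, fderiv ℝ (bumpAt x r) y (F y) = ∫ y, fderiv ℝ (bumpAt x r) y (F' y) := by
      rw [← integral_indicator h.isOpen.measurableSet]
      congr 1; ext y
      by_cases hy : y ∈ Ω
      · simp [hF', indicator_of_mem hy]
      · simp [hF', indicator_of_notMem hy]
    have h2 := integral_comp_scale (fun y => r * fderiv ℝ (bumpAt x r) y (F' y)) x hr
    rw [integral_const_mul (μ := volume) r (fun y => fderiv ℝ (bumpAt x r) y (F' y))] at h2
    rw [h1]
    have h3 : (r⁻¹) ^ 3 * (r * ∫ y, fderiv ℝ (bumpAt x r) y (F' y)) =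
        (r⁻¹) ^ 2 * ∫ y, fderiv ℝ (bumpAt x r) y (F' y) := by
      field_simp
    rw [← h3, ← h2]
    congr 1; ext z
    rw [fderiv_bumpAt, add_sub_cancel_left, smul_smul, inv_mul_cancel₀ hr.ne', one_smul, ← mul_assoc,
      mul_inv_cancel₀ hr.ne', one_mul]
    ring
  rw [← integral_halfSpace hn.1 (F x)]
  refine Tendsto.congr' (f₁ := fun r : ℝ => ∫ z, glueSlope (1 - ‖z‖ ^ 2) *
    (-2 * ⟪z, F' (x + r • z)⟫)) ?_ ?_
  · filter_upwards [self_mem_nhdsWithin] with r hr using (hscale r hr).symm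
  have hgc : Continuous fun z : Vec => glueSlope (1 - ‖z‖ ^ 2) :=
    continuous_glueSlope.comp (by fun_prop)
  refine tendsto_integral_filter_of_dominated_convergence
    (fun z => glueSlope (1 - ‖z‖ ^ 2) * (2 * C)) ?_ ?_ ?_ ?_
  · refine Eventually.of_forall fun r => Measurable.aestronglyMeasurable ?_
    have : Measurable fun z : Vec => F' (x + r • z) := hF'm.comp (by fun_prop)
    exact hgc.measurable.mul ((measurable_id.inner this).const_mul _)
  · refine Eventually.of_forall fun r => Eventually.of_forall fun z => ?_
    rw [norm_mul, Real.norm_of_nonneg (glueSlope_nonneg _)]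
    by_cases hz : ‖z‖ ≤ 1
    · refine mul_le_mul_of_nonneg_left ?_ (glueSlope_nonneg _)
      rw [norm_mul, norm_neg, Real.norm_ofNat, Real.norm_eq_abs]
      have h1 := abs_real_inner_le_norm z (F' (x + r • z))
      have h2 := hF'b (x + r • z)
      nlinarith [norm_nonneg (F' (x + r • z)), norm_nonneg z]
    · have : glueSlope (1 - ‖z‖ ^ 2) = 0 := glueSlope_of_nonpos (by nlinarith)
      simp [this]
  · exact (hgc.integrable_of_hasCompactSupport hasCompactSupport_glueSlope).mul_const _
  · have hn0 : n ≠ 0 := by rintro rfl; simpa using hn.1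
    filter_upwards [IsLipschitzDomain.ae_inner_ne_zero hn0] with z hz
    apply Tendsto.const_mul
    have hlim : Tendsto (fun r : ℝ => x + r • z) (𝓝[>] 0) (𝓝 x) := by
      have : Continuous fun s : ℝ => x + s • z := by fun_prop
      have h3 := this.tendsto 0
      simp only [zero_smul, add_zero] at h3
      exact h3.mono_left nhdsWithin_le_nhds
    -- The rescaled domains converge to the half space: x + r z is eventually inside or eventually
    -- outside Ω, according to the sign of ⟪z, n⟫.
    rcases lt_or_gt_of_ne hz with hz | hz
    · rw [if_pos hz]
      have hev := hn.eventually_mem hz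
      have h1 : Tendsto (fun r : ℝ => F (x + r • z)) (𝓝[>] 0) (𝓝 (F x)) :=
        (hF x hx).tendsto.comp (tendsto_nhdsWithin_of_tendsto_nhds_of_eventually_within _ hlim
          (hev.mono fun r hr => subset_closure hr))
      refine ((tendsto_const_nhds.inner h1).const_mul (-2)).congr' ?_
      filter_upwards [hev] with r hr
      rw [hF', indicator_of_mem hr]
    · rw [if_neg hz.le.not_gt]
      apply tendsto_const_nhds.congr'
      filter_upwards [hn.eventually_notMem hz] with r hr
      rw [hF', indicator_of_notMem hr, inner_zero_right, mul_zero]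

/-- Terms without derivatives of the bump are negligible. -/
theorem IsLipschitzDomain.tendsto_bump_lower (h : IsLipschitzDomain Ω) (x : Vec) {g : Vec → ℝ}
    {C : ℝ} (hC : ∀ y ∈ Ω, |g y| ≤ C) :
    Tendsto (fun r : ℝ => (r⁻¹) ^ 2 * ∫ y in Ω, bumpAt x r y * g y) (𝓝[>] 0) (𝓝 0) := by
  obtain ⟨B, hB⟩ := (contDiff_radialBump (n := 0)).continuous.bounded_above_of_compact_support
    (HasCompactSupport.intro (isCompact_closedBall (0 : Vec) 1) fun z hz => radialBump_eq_zero (by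
      rw [mem_closedBall_zero_iff, not_le] at hz; exact hz.le))
  set m := (volume (Metric.ball (0 : Vec) 1)).toReal with hm
  -- The ball has volume of order r³, which leaves one power of r after multiplication by r⁻².
  have hbound : ∀ r > 0, ‖(r⁻¹) ^ 2 * ∫ y in Ω, bumpAt x r y * g y‖ ≤ r * (B * |C| * m) := by
    intro r hr
    have h1 : ∫ y in Ω, bumpAt x r y * g y = ∫ y in Ω ∩ Metric.ball x r, bumpAt x r y * g y := by
      rw [← setIntegral_eq_of_subset_of_forall_sdiff_eq_zero h.isOpen.measurableSet
        inter_subset_left]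
      intro y hy
      rw [bumpAt_eq_zero hr fun hb => hy.2 ⟨hy.1, hb⟩, zero_mul]
    have hv : volume (Metric.ball x r) = ENNReal.ofReal (r ^ 3) * volume (Metric.ball (0 : Vec) 1) := by
      rw [Measure.addHaar_ball _ _ hr.le, finrank_euclideanSpace_fin]
    have hlt : volume (Metric.ball x r) < ⊤ := measure_ball_lt_top
    have h2 : ‖∫ y in Ω ∩ Metric.ball x r, bumpAt x r y * g y‖ ≤
        B * |C| * (volume (Ω ∩ Metric.ball x r)).toReal := by
      apply norm_setIntegral_le_of_norm_le_const
      · exact (measure_mono inter_subset_right).trans_lt hlt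
      · intro y hy
        rw [norm_mul]
        exact mul_le_mul (hB _) ((hC y hy.1).trans (le_abs_self C)) (norm_nonneg _)
          ((norm_nonneg _).trans (hB 0))
    have h3 : (volume (Ω ∩ Metric.ball x r)).toReal ≤ r ^ 3 * m := by
      have := ENNReal.toReal_mono hlt.ne (measure_mono (μ := (volume : Measure Vec))
        (inter_subset_right : Ω ∩ Metric.ball x r ⊆ _))
      rwa [hv, ENNReal.toReal_mul, ENNReal.toReal_ofReal (by positivity)] at this
    have hB0 : 0 ≤ B := (norm_nonneg _).trans (hB 0)
    rw [h1, norm_mul, norm_pow, norm_inv, Real.norm_of_nonneg hr.le]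
    calc (r⁻¹) ^ 2 * ‖∫ y in Ω ∩ Metric.ball x r, bumpAt x r y * g y‖
        ≤ (r⁻¹) ^ 2 * (B * |C| * (r ^ 3 * m)) := by
          gcongr
          exact h2.trans (by gcongr)
      _ = r * (B * |C| * m) := by field_simp
  apply squeeze_zero_norm' (a := fun r : ℝ => r * (B * |C| * m))
  · filter_upwards [self_mem_nhdsWithin] with r hr using hbound r hr
  · have : Continuous fun r : ℝ => r * (B * |C| * m) := by fun_prop
    have h3 := this.tendsto 0
    rw [zero_mul] at h3
    exact h3.mono_left nhdsWithin_le_nhds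

end Concentration

end ViscoPlast
end

noncomputable section

namespace ViscoPlast

/-! ### Continuous functions on space-time cylinders -/

set_option linter.unusedSectionVars false

section SpaceTime

variable {F : Type*} [NormedAddCommGroup F] [NormedSpace ℝ F] {Ω : Set Vec} {T : ℝ}

lemma MemC0C2.continuousOn {u : ℝ → Vec → F} (hu : MemC0C2 Ω T u) :
    ContinuousOn (fun p : ℝ × Vec => u p.1 p.2) (Icc 0 T ×ˢ closure Ω) := by
  have h := hu.2 0 (by norm_num)
  have h1 : Continuous fun m : ContinuousMultilinearMap ℝ (fun _ : Fin 0 => Vec) F => m ![] :=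
    ContinuousEvalConst.continuous_eval_const _
  exact h1.comp_continuousOn h

lemma MemC0C2.continuousOn_fderivWithin (hΩ : UniqueDiffOn ℝ (closure Ω)) {u : ℝ → Vec → F}
    (hu : MemC0C2 Ω T u) :
    ContinuousOn (fun p : ℝ × Vec => fderivWithin ℝ (u p.1) (closure Ω) p.2)
      (Icc 0 T ×ˢ closure Ω) := by
  rw [continuousOn_clm_apply]
  intro w
  have h1 : Continuous fun m : ContinuousMultilinearMap ℝ (fun _ : Fin 1 => Vec) F =>
      m (fun _ => w) := ContinuousEvalConst.continuous_eval_const _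
  refine (h1.comp_continuousOn (hu.2 1 (by norm_num))).congr fun p hp => ?_
  simp [iteratedFDerivWithin_one_apply (hΩ p.2 hp.2)]

lemma MemC0C2.continuousOn_fderivWithin_two (hΩ : UniqueDiffOn ℝ (closure Ω)) {u : ℝ → Vec → F}
    (hu : MemC0C2 Ω T u) :
    ContinuousOn (fun p : ℝ × Vec =>
      fderivWithin ℝ (fderivWithin ℝ (u p.1) (closure Ω)) (closure Ω) p.2)
      (Icc 0 T ×ˢ closure Ω) := by
  rw [continuousOn_clm_apply]
  intro w
  rw [continuousOn_clm_apply]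
  intro w'
  have h1 : Continuous fun m : ContinuousMultilinearMap ℝ (fun _ : Fin 2 => Vec) F =>
      m ![w, w'] := ContinuousEvalConst.continuous_eval_const _
  refine (h1.comp_continuousOn (hu.2 2 le_rfl)).congr fun p hp => ?_
  simp [iteratedFDerivWithin_two_apply _ hΩ hp.2]

lemma continuousOn_slice_time {a b t : ℝ} {g : ℝ × Vec → F}
    (hg : ContinuousOn g (Icc a b ×ˢ closure Ω)) (ht : t ∈ Icc a b) :
    ContinuousOn (fun x => g (t, x)) (closure Ω) :=
  hg.comp (by fun_prop) fun _ hx => ⟨ht, hx⟩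

lemma continuousOn_slice_space {a b : ℝ} {x : Vec} {g : ℝ × Vec → F}
    (hg : ContinuousOn g (Icc a b ×ˢ closure Ω)) (hx : x ∈ closure Ω) :
    ContinuousOn (fun t => g (t, x)) (Icc a b) :=
  hg.comp (by fun_prop) fun _ ht => ⟨ht, hx⟩

/-- Lebesgue measure on the part of the cylinder between two times. -/
def slab (Ω : Set Vec) (a b : ℝ) : Measure (ℝ × Vec) :=
  (volume.restrict (Ioc a b)).prod (volume.restrict Ω)

lemma slab_eq (Ω : Set Vec) (a b : ℝ) : slab Ω a b = volume.restrict (Ioc a b ×ˢ Ω) := by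
  rw [slab, Measure.prod_restrict]; rfl

lemma cyl_eq (Ω : Set Vec) (T : ℝ) : cyl Ω T = volume.restrict (Ioo 0 T ×ˢ Ω) := by
  rw [cyl, Measure.prod_restrict]; rfl

lemma slab_le_cyl (Ω : Set Vec) {a b T : ℝ} (ha : 0 ≤ a) (hb : b < T) : slab Ω a b ≤ cyl Ω T := by
  rw [slab_eq, cyl_eq]
  exact Measure.restrict_mono
    (Set.prod_mono (fun _ ht => mem_Ioo.2 ⟨ha.trans_lt ht.1, ht.2.trans_lt hb⟩) subset_rfl) le_rfl

lemma IsLipschitzDomain.integrable_slab (h : IsLipschitzDomain Ω) {a b : ℝ} {g : ℝ × Vec → F}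
    (hg : ContinuousOn g (Icc a b ×ˢ closure Ω)) : Integrable g (slab Ω a b) := by
  rw [slab_eq]
  exact (hg.integrableOn_compact (isCompact_Icc.prod h.isCompact_closure)).mono_set
    (Set.prod_mono Ioc_subset_Icc_self subset_closure)

lemma intervalIntegral_eq_slab {a b : ℝ} (hab : a ≤ b) {g : ℝ × Vec → F}
    (hg : Integrable g (slab Ω a b)) :
    ∫ t in a..b, ∫ x in Ω, g (t, x) = ∫ p, g p ∂(slab Ω a b) := by
  rw [intervalIntegral.integral_of_le hab, slab, integral_prod]
  exact hg

lemma IsLipschitzDomain.continuousOn_integral (h : IsLipschitzDomain Ω) {a b : ℝ} {g : ℝ × Vec → F}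
    (hg : ContinuousOn g (Icc a b ×ˢ closure Ω)) :
    ContinuousOn (fun t => ∫ x in Ω, g (t, x)) (Icc a b) := by
  obtain ⟨C, hC⟩ := (isCompact_Icc.prod h.isCompact_closure).exists_bound_of_continuousOn hg
  refine continuousOn_of_dominated (bound := fun _ => C) ?_ ?_ ?_ ?_
  · exact fun t ht => (h.integrableOn (continuousOn_slice_time hg ht)).aestronglyMeasurable
  · intro t ht
    filter_upwards [ae_restrict_mem h.isOpen.measurableSet] with x hx
    exact hC _ ⟨ht, subset_closure hx⟩
  · exact integrableOn_const h.measure_lt_top.ne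
  · filter_upwards [ae_restrict_mem h.isOpen.measurableSet] with x hx
    exact continuousOn_slice_space hg (subset_closure hx)

/-- Fundamental theorem of calculus for integrals over the domain. -/
lemma IsLipschitzDomain.integral_sub_eq_slab [CompleteSpace F] (h : IsLipschitzDomain Ω) {a b : ℝ} (hab : a ≤ b)
    {g g' : ℝ × Vec → F} (hg : ContinuousOn g (Icc a b ×ˢ closure Ω))
    (hg' : ContinuousOn g' (Icc a b ×ˢ closure Ω))
    (hd : ∀ t ∈ Ioo a b, ∀ x ∈ Ω, HasDerivAt (fun s => g (s, x)) (g' (t, x)) t) :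
    (∫ x in Ω, g (b, x)) - ∫ x in Ω, g (a, x) = ∫ p, g' p ∂(slab Ω a b) := by
  rw [← integral_sub (h.integrableOn (continuousOn_slice_time hg (right_mem_Icc.2 hab)))
    (h.integrableOn (continuousOn_slice_time hg (left_mem_Icc.2 hab)))]
  have hint := h.integrable_slab hg'
  rw [slab] at hint
  rw [slab, integral_prod _ hint, integral_integral_swap (f := fun t x => g' (t, x)) hint]
  refine setIntegral_congr_fun h.isOpen.measurableSet fun x hx => ?_
  have hc' := continuousOn_slice_space hg' (subset_closure hx)
  rw [← intervalIntegral.integral_of_le hab]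
  refine (intervalIntegral.integral_eq_sub_of_hasDerivAt_of_le hab
    (continuousOn_slice_space hg (subset_closure hx)) (fun t ht => hd t ht x hx) ?_).symm
  exact (hc'.mono (by rw [uIcc_of_le hab])).intervalIntegrable

end SpaceTime

/-! ### Test functions -/

section Test

variable {F : Type*} [NormedAddCommGroup F] [NormedSpace ℝ F] {Ω : Set Vec} {T : ℝ}

lemma IsTestFunction.continuousOn {u : ℝ → Vec → F} (hu : IsTestFunction Ω T u) :
    ContinuousOn (fun p : ℝ × Vec => u p.1 p.2) (Ico 0 T ×ˢ closure Ω) :=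
  hu.1.continuousOn

lemma uniqueDiffOn_cylinder (hΩ : UniqueDiffOn ℝ (closure Ω)) :
    UniqueDiffOn ℝ (Ico 0 T ×ˢ closure Ω) :=
  (uniqueDiffOn_Ico 0 T).prod hΩ

lemma IsTestFunction.hasFDerivWithinAt {u : ℝ → Vec → F} (hu : IsTestFunction Ω T u) {t : ℝ}
    (ht : t ∈ Ico 0 T) {x : Vec} (hx : x ∈ closure Ω) :
    HasFDerivWithinAt (u t) ((fderivWithin ℝ (Function.uncurry u) (Ico 0 T ×ˢ closure Ω) (t, x)).comp
      (ContinuousLinearMap.inr ℝ ℝ Vec)) (closure Ω) x := by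
  have h1 := ((hu.1 (t, x) ⟨ht, hx⟩).differentiableWithinAt (by norm_num)).hasFDerivWithinAt
  have h2 : HasFDerivWithinAt (fun y : Vec => (t, y)) (ContinuousLinearMap.inr ℝ ℝ Vec)
      (closure Ω) x := (hasFDerivAt_prodMk_right t x).hasFDerivWithinAt
  exact h1.comp x h2 fun y hy => ⟨ht, hy⟩

lemma IsTestFunction.contDiffOn {u : ℝ → Vec → F} (hu : IsTestFunction Ω T u) {t : ℝ}
    (ht : t ∈ Ico 0 T) : ContDiffOn ℝ 1 (u t) (closure Ω) :=
  hu.1.comp (g := Function.uncurry u) (f := fun y : Vec => (t, y)) (by fun_prop) fun y hy => ⟨ht, hy⟩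

lemma IsTestFunction.continuousOn_fderivWithin (hΩ : UniqueDiffOn ℝ (closure Ω)) {u : ℝ → Vec → F}
    (hu : IsTestFunction Ω T u) :
    ContinuousOn (fun p : ℝ × Vec => fderivWithin ℝ (u p.1) (closure Ω) p.2)
      (Ico 0 T ×ˢ closure Ω) := by
  have h1 := hu.1.continuousOn_fderivWithin (uniqueDiffOn_cylinder hΩ) le_rfl
  refine (h1.clm_comp (continuousOn_const (c := ContinuousLinearMap.inr ℝ ℝ Vec))).congr
    fun p hp => ?_
  exact (hu.hasFDerivWithinAt hp.1 hp.2).fderivWithin (hΩ p.2 hp.2)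

/-- The time derivative of a test function. -/
def IsTestFunction.dt (Ω : Set Vec) (T : ℝ) (u : ℝ → Vec → F) (p : ℝ × Vec) : F :=
  fderivWithin ℝ (Function.uncurry u) (Ico 0 T ×ˢ closure Ω) p (1, 0)

lemma IsTestFunction.continuousOn_dt (hΩ : UniqueDiffOn ℝ (closure Ω)) {u : ℝ → Vec → F}
    (hu : IsTestFunction Ω T u) :
    ContinuousOn (IsTestFunction.dt Ω T u) (Ico 0 T ×ˢ closure Ω) :=
  (hu.1.continuousOn_fderivWithin (uniqueDiffOn_cylinder hΩ) le_rfl).clm_apply continuousOn_const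

lemma IsTestFunction.hasDerivAt {u : ℝ → Vec → F} (hu : IsTestFunction Ω T u) {t : ℝ}
    (ht : t ∈ Ioo 0 T) {x : Vec} (hx : x ∈ closure Ω) :
    HasDerivAt (fun s => u s x) (IsTestFunction.dt Ω T u (t, x)) t := by
  have h1 := ((hu.1 (t, x) ⟨⟨ht.1.le, ht.2⟩, hx⟩).differentiableWithinAt
    (by norm_num)).hasFDerivWithinAt
  have h2 : HasDerivWithinAt (fun s : ℝ => (s, x)) ((1 : ℝ), (0 : Vec)) (Ico 0 T) t :=
    ((hasDerivAt_id t).prodMk (hasDerivAt_const t x)).hasDerivWithinAt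
  have h3 : HasDerivWithinAt (Function.uncurry u ∘ fun s : ℝ => (s, x)) _ (Ico 0 T) t :=
    HasFDerivWithinAt.comp_hasDerivWithinAt t h1 h2 fun s hs => ⟨hs, hx⟩
  exact h3.hasDerivAt (Ico_mem_nhds ht.1 ht.2)

/-- A smooth function of time that equals one until `τ` and vanishes near `T`. -/
def timeCutoff (τ T : ℝ) (t : ℝ) : ℝ := Real.smoothTransition (2 - 2 * (t - τ) / (T - τ))

lemma contDiff_timeCutoff {n : ℕ∞} (τ T : ℝ) : ContDiff ℝ n (timeCutoff τ T) := by
  refine Real.smoothTransition.contDiff.comp ?_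
  fun_prop

lemma timeCutoff_eq_one {τ T t : ℝ} (h : τ < T) (ht : 2 * t ≤ τ + T) : timeCutoff τ T t = 1 := by
  apply Real.smoothTransition.one_of_one_le
  have : 2 * (t - τ) / (T - τ) ≤ 1 := by rw [div_le_one (by linarith)]; linarith
  linarith

lemma timeCutoff_eq_zero {τ T t : ℝ} (h : τ < T) (ht : T ≤ t) : timeCutoff τ T t = 0 := by
  apply Real.smoothTransition.zero_of_nonpos
  have : 2 ≤ 2 * (t - τ) / (T - τ) := by rw [le_div_iff₀ (by linarith)]; linarith
  linarith

/-- Cutting off in time turns functions of class `C¹` into test functions. -/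
lemma isTestFunction_timeCutoff {u : ℝ → Vec → F}
    (hu : ContDiffOn ℝ 1 (Function.uncurry u) (Icc 0 T ×ˢ closure Ω)) {τ : ℝ} (hτ : τ < T) :
    IsTestFunction Ω T fun t x => timeCutoff τ ((τ + T) / 2) t • u t x := by
  -- The cutoff ends at (τ + T)/2 because a test function has to vanish before T; it is still one
  -- for some time after τ.
  refine ⟨?_, (τ + T) / 2, by linarith, fun t ht htT x hx => ?_⟩
  · have h1 : ContDiff ℝ 1 fun p : ℝ × Vec => timeCutoff τ ((τ + T) / 2) p.1 :=
      (contDiff_timeCutoff (n := 1) τ _).comp contDiff_fst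
    exact h1.contDiffOn.smul (hu.mono (Set.prod_mono Ico_subset_Icc_self subset_rfl))
  · have : timeCutoff τ ((τ + T) / 2) t = 0 := timeCutoff_eq_zero (by linarith) htT
    simp only [this, zero_smul]

lemma contDiffOn_uncurry_const {Φ : Vec → F} (hΦ : ContDiffOn ℝ 1 Φ (closure Ω)) (s : Set ℝ) :
    ContDiffOn ℝ 1 (Function.uncurry fun (_ : ℝ) x => Φ x) (s ×ˢ closure Ω) :=
  hΦ.comp contDiff_snd.contDiffOn fun _ hp => hp.2

/-- Continuity of the partial derivatives implies joint differentiability on cylinders. -/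
lemma MemC1C2.contDiffOn (hΩ : UniqueDiffOn ℝ (closure Ω)) (hT : 0 < T) {u : ℝ → Vec → F}
    (hu : MemC1C2 Ω T u) :
    ContDiffOn ℝ 1 (Function.uncurry u) (Icc 0 T ×ˢ closure Ω) := by
  obtain ⟨hu0, du, hdu, hd⟩ := hu
  set D : ℝ × Vec → (ℝ × Vec →L[ℝ] F) := fun p =>
    (ContinuousLinearMap.toSpanSingleton ℝ (du p.1 p.2)).comp (ContinuousLinearMap.fst ℝ ℝ Vec) +
      (fderivWithin ℝ (u p.1) (closure Ω) p.2).comp (ContinuousLinearMap.snd ℝ ℝ Vec) with hD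
  have hDc : ContinuousOn D (Icc 0 T ×ˢ closure Ω) := by
    refine ContinuousOn.add ?_ ?_
    · refine ContinuousOn.clm_comp ?_ continuousOn_const
      rw [continuousOn_clm_apply]
      intro s
      refine (hdu.continuousOn.const_smul s).congr fun p _ => ?_
      simp
    · exact (hu0.continuousOn_fderivWithin hΩ).clm_comp continuousOn_const
  have hdiff : ∀ p ∈ Icc 0 T ×ˢ closure Ω,
      HasFDerivWithinAt (Function.uncurry u) (D p) (Icc 0 T ×ˢ closure Ω) p := by
    rintro ⟨t, x⟩ ⟨ht, hx⟩
    simp only at ht hx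
    rw [hasFDerivWithinAt_iff_isLittleO, Asymptotics.isLittleO_iff]
    intro ε hε
    have h1 : HasFDerivWithinAt (u t) (fderivWithin ℝ (u t) (closure Ω) x) (closure Ω) x :=
      ((hu0.1 t ht x hx).differentiableWithinAt (by norm_num)).hasFDerivWithinAt
    rw [hasFDerivWithinAt_iff_isLittleO, Asymptotics.isLittleO_iff] at h1
    have h1' := h1 (half_pos hε)
    have h2 := Metric.continuousOn_iff.1 hdu.continuousOn (t, x) ⟨ht, hx⟩ (ε / 2) (half_pos hε)
    obtain ⟨δ, hδ, h2⟩ := h2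
    have hsnd : Tendsto (fun p : ℝ × Vec => p.2) (𝓝[Icc 0 T ×ˢ closure Ω] (t, x))
        (𝓝[closure Ω] x) := by
      rw [nhdsWithin_prod_eq]; exact tendsto_snd
    filter_upwards [hsnd.eventually h1', self_mem_nhdsWithin,
      nhdsWithin_le_nhds (Metric.ball_mem_nhds (t, x) hδ)] with p hp1 hpm hpb
    obtain ⟨t', x'⟩ := p
    simp only [Function.uncurry_apply_pair] at hp1 hpm hpb ⊢
    have hconv : Convex ℝ (uIcc t t') := convex_uIcc t t'
    have hsub : uIcc t t' ⊆ Icc 0 T := uIcc_subset_Icc ht hpm.1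
    -- The increment is split into a time step at the fixed point x', controlled by the mean value
    -- inequality and the joint continuity of the time derivative, and a space step at the fixed
    -- time t.
    have h3 : ‖u t' x' - u t x' - (ContinuousLinearMap.toSpanSingleton ℝ (du t x)) (t' - t)‖ ≤
        ε / 2 * ‖t' - t‖ := by
      refine hconv.norm_image_sub_le_of_norm_hasFDerivWithin_le' (f := fun s => u s x')
        (f' := fun s => ContinuousLinearMap.toSpanSingleton ℝ (du s x')) (fun s hs => ?_)
        (fun s hs => ?_) left_mem_uIcc right_mem_uIcc
      · exact ((hd s (hsub hs) x' hpm.2).mono hsub).hasFDerivWithinAt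
      · have h4 : (s, x') ∈ Icc 0 T ×ˢ closure Ω := ⟨hsub hs, hpm.2⟩
        have h5 : dist ((s, x') : ℝ × Vec) (t, x) < δ := by
          rw [Metric.mem_ball, Prod.dist_eq] at hpb
          rw [Prod.dist_eq]
          refine lt_of_le_of_lt (max_le_max ?_ le_rfl) hpb
          simp only [Real.dist_eq]
          rw [abs_sub_comm s t, abs_sub_comm t' t]
          rw [abs_sub_comm t s, abs_sub_comm t t']
          exact abs_sub_left_of_mem_uIcc hs
        have h6 := h2 _ h4 h5
        rw [dist_eq_norm] at h6
        have : ContinuousLinearMap.toSpanSingleton ℝ (du s x') -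
            ContinuousLinearMap.toSpanSingleton ℝ (du t x) =
            ContinuousLinearMap.toSpanSingleton ℝ (du s x' - du t x) := by
          ext; simp
        rw [this, ContinuousLinearMap.norm_toSpanSingleton]
        exact h6.le
    have hn1 : ‖t' - t‖ ≤ ‖((t', x') : ℝ × Vec) - (t, x)‖ := norm_fst_le (((t', x') : ℝ × Vec) - (t, x))
    have hn2 : ‖x' - x‖ ≤ ‖((t', x') : ℝ × Vec) - (t, x)‖ := norm_snd_le (((t', x') : ℝ × Vec) - (t, x))
    have h7 : u t' x' - u t x - D (t, x) ((t', x') - (t, x)) =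
        (u t' x' - u t x' - (ContinuousLinearMap.toSpanSingleton ℝ (du t x)) (t' - t)) +
        (u t x' - u t x - fderivWithin ℝ (u t) (closure Ω) x (x' - x)) := by
      simp only [hD, FunLike.coe_add, Pi.add_apply, ContinuousLinearMap.comp_apply,
        ContinuousLinearMap.coe_fst', ContinuousLinearMap.coe_snd', Prod.fst_sub, Prod.snd_sub]
      abel
    rw [h7]
    refine (norm_add_le _ _).trans ?_
    calc _ ≤ ε / 2 * ‖t' - t‖ + ε / 2 * ‖x' - x‖ := add_le_add h3 hp1
      _ ≤ ε / 2 * ‖((t', x') : ℝ × Vec) - (t, x)‖ + ε / 2 * ‖((t', x') : ℝ × Vec) - (t, x)‖ := by gcongr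
      _ = _ := by ring
  have hU : UniqueDiffOn ℝ (Icc 0 T ×ˢ closure Ω) := (uniqueDiffOn_Icc hT).prod hΩ
  rw [show (1 : WithTop ℕ∞) = 0 + 1 by norm_num]
  rw [contDiffOn_succ_iff_hasFDerivWithinAt_of_uniqueDiffOn hU]
  refine ⟨by simp, D, ?_, hdiff⟩
  rwa [contDiffOn_zero]

end Test

end ViscoPlast
end

noncomputable section

namespace ViscoPlast

/-! ### Matrix algebra -/

lemma inner_mat (A B : Mat) : ⟪A, B⟫ = ∑ i, ∑ j, A (i, j) * B (i, j) := by
  rw [PiLp.inner_apply, Fintype.sum_prod_type]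
  refine Finset.sum_congr rfl fun i _ => Finset.sum_congr rfl fun j _ => ?_
  simp [mul_comm]

lemma inner_sym (A B : Sym) : ⟪A, B⟫ = ∑ i, ∑ j, (A : Mat) (i, j) * (B : Mat) (i, j) := by
  rw [Submodule.coe_inner, inner_mat]

lemma inner_dev (A B : Dev) : ⟪A, B⟫ = ∑ i, ∑ j, (A : Mat) (i, j) * (B : Mat) (i, j) := by
  rw [Submodule.coe_inner, inner_mat]

lemma inner_vec (v w : Vec) : ⟪v, w⟫ = ∑ i, v i * w i := by
  rw [PiLp.inner_apply]
  exact Finset.sum_congr rfl fun i _ => by simp [mul_comm]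

lemma sym_inner_smul_left (c : ℝ) (A B : Sym) : ⟪c • A, B⟫ = c * ⟪A, B⟫ := by
  simp [inner_smul_left]

lemma sym_inner_smul_right (c : ℝ) (A B : Sym) : ⟪A, c • B⟫ = c * ⟪A, B⟫ := by
  simp [inner_smul_right]

lemma dev_inner_smul_right (c : ℝ) (A B : Dev) : ⟪A, c • B⟫ = c * ⟪A, B⟫ := by
  simp [inner_smul_right]

/-- The symmetric gradient as a continuous linear map. -/
def symGradL : (Vec →L[ℝ] Vec) →L[ℝ] Sym :=
  LinearMap.toContinuousLinearMap
    { toFun := symGrad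
      map_add' := by
        intro G H; ext p; simp [symGrad, gradMat]; ring
      map_smul' := by
        intro c G; ext p; simp [symGrad, gradMat]; ring }

/-- The divergence as a continuous linear map. -/
def divgL : (Vec →L[ℝ] Vec) →L[ℝ] ℝ :=
  LinearMap.toContinuousLinearMap
    { toFun := divg
      map_add' := by intro G H; simp [divg_eq_sum, Finset.sum_add_distrib]
      map_smul' := by intro c G; simp [divg_eq_sum, Finset.mul_sum] }

/-- The matrix-vector product as a continuous bilinear map. -/
def matVecL : Sym →L[ℝ] Vec →L[ℝ] Vec :=
  LinearMap.toContinuousLinearMap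
    { toFun := fun A => LinearMap.toContinuousLinearMap
        { toFun := fun w => matVec A w
          map_add' := by intro v w; ext i; simp [matVec, mul_add, Finset.sum_add_distrib]
          map_smul' := by
            intro c w; ext i; simp only [matVec, PiLp.smul_apply, smul_eq_mul, Finset.mul_sum, RingHom.id_apply]
            exact Finset.sum_congr rfl fun j _ => by ring }
      map_add' := by
        intro A B; ext w i; simp [matVec, add_mul, Finset.sum_add_distrib]
      map_smul' := by
        intro c A; ext w i; simp [matVec, mul_assoc, Finset.mul_sum] }

lemma matVecL_apply (A : Sym) (w : Vec) : matVecL A w = matVec A w := rfl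

/-- The inclusion of the trace-free symmetric matrices into the symmetric matrices. -/
def devIncl : Dev →L[ℝ] Sym :=
  LinearMap.toContinuousLinearMap
    { toFun := fun A => ⟨(A : Mat), A.2.1⟩
      map_add' := by intro A B; rfl
      map_smul' := by intro c A; rfl }

lemma coe_devIncl (A : Dev) : (devIncl A : Mat) = A := rfl

/-- The deviatoric part as a continuous linear map. -/
def devL : Sym →L[ℝ] Dev :=
  LinearMap.toContinuousLinearMap
    { toFun := dev
      map_add' := by
        intro A B; ext p
        simp [dev, tr, idSym, Fin.sum_univ_three]
        split_ifs <;> ring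
      map_smul' := by
        intro c A; ext p
        simp [dev, tr, idSym, Fin.sum_univ_three]
        split_ifs <;> ring }

lemma devL_apply (A : Sym) : devL A = dev A := rfl

/-- The trace as a continuous linear map. -/
def trL : Sym →L[ℝ] ℝ :=
  LinearMap.toContinuousLinearMap
    { toFun := fun A => tr A
      map_add' := by intro A B; simp [tr, Finset.sum_add_distrib]
      map_smul' := by intro c A; simp [tr, Finset.mul_sum] }

lemma dev_devIncl (A : Dev) : dev (devIncl A) = A := by
  ext p
  have h : tr (A : Mat) = 0 := A.2.2
  simp [dev, h, coe_devIncl]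

lemma dev_idSym : dev idSym = 0 := by
  ext ⟨i, j⟩
  simp [dev, idSym, tr]

lemma sym_eq_dev_add (A : Sym) : A = devIncl (dev A) + (tr A / 3) • idSym := by
  ext p; simp [coe_devIncl, dev]

lemma inner_idSym (A : Sym) : ⟪A, idSym⟫ = tr A := by
  rw [inner_sym]; simp [idSym, tr]

lemma inner_devIncl (A : Sym) (B : Dev) : ⟪A, devIncl B⟫ = ⟪dev A, B⟫ := by
  have h : tr (devIncl B) = 0 := B.2.2
  conv_lhs => rw [sym_eq_dev_add A, inner_add_left, sym_inner_smul_left,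
    real_inner_comm (devIncl B) idSym, inner_idSym, h]
  simp only [mul_zero, add_zero]
  rw [inner_sym, inner_dev]
  simp only [coe_devIncl, mul_comm]

lemma inner_sym_symGrad (S : Sym) (G : Vec →L[ℝ] Vec) :
    ⟪S, symGrad G⟫ = ∑ i, ∑ j, (S : Mat) (i, j) * G (unitVec j) i := by
  rw [inner_sym]
  have h : ∀ i j, (S : Mat) (i, j) = (S : Mat) (j, i) := S.2
  simp only [symGrad, gradMat, Fin.sum_univ_three, h 1 0, h 2 0, h 2 1]
  ring

lemma divg_smulRight (ℓ : Vec →L[ℝ] ℝ) (w : Vec) : divg (ℓ.smulRight w) = ℓ w := by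
  conv_rhs => rw [vec_eq_sum w]
  simp [divg_eq_sum, mul_comm]

lemma inner_idSym_symGrad (G : Vec →L[ℝ] Vec) : ⟪idSym, symGrad G⟫ = divg G := by
  rw [inner_sym_symGrad, divg_eq_sum]
  simp [idSym]

lemma inner_matVec (S : Sym) (v w : Vec) : ⟪matVec S v, w⟫ = ⟪v, matVec S w⟫ := by
  have h : ∀ i j, (S : Mat) (i, j) = (S : Mat) (j, i) := S.2
  simp only [inner_vec, matVec, Fin.sum_univ_three, h 1 0, h 2 0, h 2 1]
  ring

/-- The corotational term is a symmetric matrix. -/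
def corotSym (A : Sym) (G : Vec →L[ℝ] Vec) : Sym :=
  ⟨corot A G, by
    have h : ∀ i j, (A : Mat) (i, j) = (A : Mat) (j, i) := A.2
    intro i j
    simp only [corot, matMul, skewGrad, gradMat, PiLp.sub_apply, Fin.sum_univ_three]
    rw [h j 0, h j 1, h j 2, h i 0, h i 1, h i 2]
    ring⟩

/-- For symmetric A and S one has (AW - WA) : S = W : (AS - SA), which vanishes if S and A commute.
This is where the commutation assumption on the stored energy enters. -/
lemma inner_corot_eq_zero (A S : Sym) (G : Vec →L[ℝ] Vec) (h : matMul (S : Mat) A = matMul A S) :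
    ⟪corotSym A G, S⟫ = 0 := by
  have hA : ∀ i j, (A : Mat) (i, j) = (A : Mat) (j, i) := A.2
  have hS : ∀ i j, (S : Mat) (i, j) = (S : Mat) (j, i) := S.2
  have h' : ∀ i j, (matMul (S : Mat) A) (i, j) = (matMul (A : Mat) S) (i, j) := fun i j => by rw [h]
  have h01 := h' 0 1
  have h02 := h' 0 2
  have h12 := h' 1 2
  rw [inner_sym]
  simp only [matMul, Fin.sum_univ_three, corotSym, corot, skewGrad, gradMat, PiLp.sub_apply,
    hA 1 0, hA 2 0, hA 2 1, hS 1 0, hS 2 0, hS 2 1] at h01 h02 h12 ⊢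
  -- The commutator is skew, so only three of its entries matter; the coefficients are -2 times the
  -- corresponding entries of W.
  linear_combination (-2 * ((G (unitVec 1) 0 - G (unitVec 0) 1) / 2)) * h01 +
    (-2 * ((G (unitVec 2) 0 - G (unitVec 0) 2) / 2)) * h02 +
    (-2 * ((G (unitVec 2) 1 - G (unitVec 1) 2) / 2)) * h12

/-! ### Continuity and linearity -/

@[fun_prop]
lemma continuous_symGrad : Continuous symGrad := symGradL.continuous

@[fun_prop]
lemma continuous_dev : Continuous dev := devL.continuous

/-- The corotational term as a continuous bilinear map. -/
def corotL : Sym →L[ℝ] (Vec →L[ℝ] Vec) →L[ℝ] Sym :=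
  LinearMap.toContinuousLinearMap
    { toFun := fun A => LinearMap.toContinuousLinearMap
        { toFun := fun G => corotSym A G
          map_add' := by
            intro G H; ext p
            simp only [corotSym, corot, matMul, skewGrad, gradMat, PiLp.sub_apply, PiLp.add_apply,
              FunLike.coe_add, Pi.add_apply, Fin.sum_univ_three, Submodule.coe_add]
            ring
          map_smul' := by
            intro c G; ext p
            simp only [corotSym, corot, matMul, skewGrad, gradMat, PiLp.sub_apply, PiLp.smul_apply,
              FunLike.coe_smul, Pi.smul_apply, smul_eq_mul, Fin.sum_univ_three,
              Submodule.coe_smul, RingHom.id_apply]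
            ring }
      map_add' := by
        intro A B; ext G p
        change corot (A + B : Sym) G p = corot A G p + corot B G p
        simp only [corot, matMul, skewGrad, gradMat, PiLp.sub_apply, PiLp.add_apply,
          Fin.sum_univ_three, Submodule.coe_add]
        ring
      map_smul' := by
        intro c A; ext G p
        change corot (c • A : Sym) G p = c * corot A G p
        simp only [corot, matMul, skewGrad, gradMat, PiLp.sub_apply, PiLp.smul_apply, smul_eq_mul,
          Fin.sum_univ_three, Submodule.coe_smul]
        ring }

lemma _root_.ContinuousOn.corotSym {X : Type*} [TopologicalSpace X] {s : Set X} {f : X → Sym}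
    {g : X → Vec →L[ℝ] Vec} (hf : ContinuousOn f s) (hg : ContinuousOn g s) :
    ContinuousOn (fun x => corotSym (f x) (g x)) s :=
  (corotL.continuous.comp_continuousOn hf).clm_apply hg

lemma _root_.ContinuousOn.tripleDot {X : Type*} [TopologicalSpace X] {s : Set X}
    {f g : X → Vec →L[ℝ] Sym} (hf : ContinuousOn f s) (hg : ContinuousOn g s) :
    ContinuousOn (fun x => tripleDot (f x) (g x)) s := by
  simp only [ViscoPlast.tripleDot]
  fun_prop

lemma tripleDot_smul_right (c : ℝ) (G H : Vec →L[ℝ] Sym) :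
    tripleDot G (c • H) = c * tripleDot G H := by
  simp [tripleDot, inner_smul_right, Finset.mul_sum]

lemma tripleDot_sub_right (G H H' : Vec →L[ℝ] Sym) :
    tripleDot G (H - H') = tripleDot G H - tripleDot G H' := by
  simp [tripleDot, inner_sub_right, Finset.sum_sub_distrib]

lemma tripleDot_smulRight (G : Vec →L[ℝ] Sym) (ℓ : Vec →L[ℝ] ℝ) (B : Sym) :
    tripleDot G (ℓ.smulRight B) = ∑ k, ℓ (unitVec k) * ⟪G (unitVec k), B⟫ := by
  simp [tripleDot, inner_smul_right]

lemma symGrad_smul (c : ℝ) (G : Vec →L[ℝ] Vec) : symGrad (c • G) = c • symGrad G :=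
  symGradL.map_smul c G

lemma divg_smul (c : ℝ) (G : Vec →L[ℝ] Vec) : divg (c • G) = c * divg G := divgL.map_smul c G

lemma divg_add (G H : Vec →L[ℝ] Vec) : divg (G + H) = divg G + divg H := divgL.map_add G H

lemma divg_sub (G H : Vec →L[ℝ] Vec) : divg (G - H) = divg G - divg H := divgL.map_sub G H

/-- The product rule for the divergence of a scalar multiple of a vector field. -/
lemma divg_fderiv_smul {h : Vec → ℝ} {u : Vec → Vec} {x : Vec} {h' : Vec →L[ℝ] ℝ}
    {u' : Vec →L[ℝ] Vec} (hh : HasFDerivAt h h' x) (hu : HasFDerivAt u u' x) :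
    divg (fderiv ℝ (fun y => h y • u y) x) = h x * divg u' + h' (u x) := by
  rw [(hh.fun_smul hu).fderiv, divg_add, divg_smul, divg_smulRight]

/-- The product rule for the divergence of a matrix-vector product. -/
lemma divg_fderiv_matVec {S : Vec → Sym} {u : Vec → Vec} {x : Vec}
    (hS : DifferentiableAt ℝ S x) (hu : DifferentiableAt ℝ u x) :
    divg (fderiv ℝ (fun y => matVec (S y) (u y)) x) =
      ⟪matDiv S x, u x⟫ + ⟪S x, symGrad (fderiv ℝ u x)⟫ := by
  have h := matVecL.hasFDerivAt_of_bilinear hS.hasFDerivAt hu.hasFDerivAt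
  have h2 : fderiv ℝ (fun y => matVec (S y) (u y)) x = _ := h.fderiv
  rw [h2, inner_sym_symGrad, divg_eq_sum, inner_vec]
  have hs : ∀ i j k, ((fderiv ℝ S x (unitVec k) : Sym) : Mat) (i, j) =
    ((fderiv ℝ S x (unitVec k) : Sym) : Mat) (j, i) := fun i j k => (fderiv ℝ S x (unitVec k)).2 i j
  have hs' : ∀ i j, (S x : Mat) (i, j) = (S x : Mat) (j, i) := (S x).2
  simp only [FunLike.coe_add, Pi.add_apply, ContinuousLinearMap.precompR_apply, ContinuousLinearMap.compL_apply,
    ContinuousLinearMap.comp_apply,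
    ContinuousLinearMap.precompL_apply, matVecL_apply, PiLp.add_apply, matVec, matDiv,
    Fin.sum_univ_three, hs 1 0, hs 2 0, hs 2 1, hs' 1 0, hs' 2 0, hs' 2 1]
  ring

end ViscoPlast
end

noncomputable section

namespace ViscoPlast

/-! ### Weak gradients of smooth functions -/

section WeakGradient

variable {F : Type*} [NormedAddCommGroup F] [InnerProductSpace ℝ F] [FiniteDimensional ℝ F]
  {Ω : Set Vec}

/-- For each vector b the field χ ⟪b, u⟫ e vanishes on the frontier, and the integral of its
divergence is the tested identity. -/
lemma IsLipschitzDomain.hasWeakGradient (h : IsLipschitzDomain Ω) {u : Vec → F}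
    (hu : ContDiffOn ℝ 1 u (closure Ω)) : HasWeakGradient Ω u (fderivWithin ℝ u (closure Ω)) := by
  intro χ hχ hχc hχΩ e
  have hcomp : CompleteSpace F := FiniteDimensional.complete ℝ F
  have hχ1 : ContDiff ℝ 1 χ := hχ.of_le (by norm_cast)
  have hDχ : Continuous fun x => fderiv ℝ χ x e :=
    (hχ1.continuous_fderiv (by norm_num)).clm_apply continuous_const
  have hDu := h.continuousOn_fderivWithin hu le_rfl
  have hi1 : IntegrableOn (fun x => (fderiv ℝ χ x e) • u x) Ω :=
    h.integrableOn (hDχ.continuousOn.smul hu.continuousOn)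
  have hi2 : IntegrableOn (fun x => χ x • fderivWithin ℝ u (closure Ω) x e) Ω :=
    h.integrableOn (hχ1.continuous.continuousOn.smul (hDu.clm_apply continuousOn_const))
  rw [eq_neg_iff_add_eq_zero, ← integral_add hi1 hi2]
  refine ext_inner_left ℝ fun b => ?_
  have hin := integral_inner (𝕜 := ℝ) (f := fun x => (fderiv ℝ χ x e) • u x +
    χ x • fderivWithin ℝ u (closure Ω) x e) (hi1.add hi2) b
  rw [inner_zero_right, ← hin]
  have hub : ContDiffOn ℝ 1 (fun x => ⟪b, u x⟫) (closure Ω) := contDiffOn_const.inner ℝ hu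
  have key := h.integral_divg_eq_zero_of_zero (F := fun x => (χ x * ⟪b, u x⟫) • e)
    ((hχ1.contDiffOn.mul hub).smul contDiffOn_const) (fun x hx => by
      rw [h.isOpen.frontier_eq] at hx
      have : χ x = 0 := image_eq_zero_of_notMem_tsupport fun hm => hx.2 (hχΩ hm)
      simp [this])
  rw [← key]
  refine setIntegral_congr_fun h.isOpen.measurableSet fun x hx => ?_
  have h1 : HasFDerivAt χ (fderiv ℝ χ x) x := (hχ1.differentiable (by norm_num) x).hasFDerivAt
  have h2 := h.hasFDerivAt hu hx
  have h3 : HasFDerivAt (fun x => ⟪b, u x⟫)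
      ((innerSL ℝ b).comp (fderivWithin ℝ u (closure Ω) x)) x :=
    (innerSL ℝ b).hasFDerivAt.comp x h2
  rw [fderivWithin_of_mem_nhds (f := fun y => (χ y * ⟪b, u y⟫) • e) (h.closure_mem_nhds hx),
    divg_fderiv_smul (h1.fun_mul h3) (hasFDerivAt_const e x)]
  simp only [inner_add_right, inner_smul_right, FunLike.coe_add, Pi.add_apply, FunLike.coe_smul,
    Pi.smul_apply, smul_eq_mul, ContinuousLinearMap.comp_apply, innerSL_apply_apply]
  simp [divg_eq_sum]
  ring

/-- Both gradients satisfy the same identity for all bumps, so their difference vanishes. This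
removes the unspecified weak gradients from the definition of a weak solution. -/
lemma IsLipschitzDomain.ae_eq_weakGradient (h : IsLipschitzDomain Ω) {u : Vec → F}
    {Du : Vec → Vec →L[ℝ] F} (hu : ContDiffOn ℝ 1 u (closure Ω)) (hw : HasWeakGradient Ω u Du)
    (hi : IntegrableOn Du Ω) :
    ∀ᵐ x ∂(volume.restrict Ω), Du x = fderivWithin ℝ u (closure Ω) x := by
  have hcomp : CompleteSpace F := FiniteDimensional.complete ℝ F
  have hDu := h.continuousOn_fderivWithin hu le_rfl
  have hk : ∀ k : Fin 3, ∀ᵐ x ∂(volume.restrict Ω),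
      Du x (unitVec k) - fderivWithin ℝ u (closure Ω) x (unitVec k) = 0 := by
    intro k
    have hi1 : IntegrableOn (fun x => Du x (unitVec k)) Ω :=
      (ContinuousLinearMap.apply ℝ F (unitVec k)).integrable_comp hi
    have hi2 : IntegrableOn (fun x => fderivWithin ℝ u (closure Ω) x (unitVec k)) Ω :=
      h.integrableOn (hDu.clm_apply continuousOn_const)
    rw [ae_restrict_iff' h.isOpen.measurableSet]
    refine h.isOpen.ae_eq_zero_of_integral_contDiff_smul_eq_zero
      ((hi1.sub hi2).locallyIntegrableOn) fun χ hχ hχc hχΩ => ?_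
    have hb : ∀ {g : Vec → F}, IntegrableOn g Ω → IntegrableOn (fun x => χ x • g x) Ω := by
      intro g hg
      obtain ⟨C, hC⟩ := hχ.continuous.bounded_above_of_compact_support hχc
      exact hg.bdd_smul C hχ.continuous.aestronglyMeasurable (Eventually.of_forall hC)
    have h1 := hw χ hχ hχc hχΩ (unitVec k)
    have h2 := h.hasWeakGradient hu χ hχ hχc hχΩ (unitVec k)
    rw [h2, neg_inj] at h1
    rw [← setIntegral_eq_integral_of_forall_compl_eq_zero (s := Ω)]
    · simp only [smul_sub]
      rw [integral_sub (hb hi1) (hb hi2), h1, sub_self]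
    · intro x hx
      have : χ x = 0 := image_eq_zero_of_notMem_tsupport fun hm => hx (hχΩ hm)
      simp [this]
  filter_upwards [ae_all_iff.2 hk] with x hx
  ext w
  rw [vec_eq_sum w]
  simp only [map_sum, map_smul]
  exact Finset.sum_congr rfl fun k _ => by rw [sub_eq_zero.1 (hx k)]

end WeakGradient

/-! ### The force -/

namespace Data

variable {d : Data}

/-- Hölder's inequality on the bounded domain bounds the L¹ norm in space by the L² norm times
|Ω|^(1/2). -/
lemma Standing.integrable_f (hd : d.Standing) :
    Integrable (fun p : ℝ × Vec => d.f p.1 p.2) (cyl d.Ω d.T) := by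
  have hfin : IsFiniteMeasure (volume.restrict d.Ω) := ⟨by simpa using hd.domain.measure_lt_top⟩
  refine ⟨hd.f_measurable, ?_⟩
  change ∫⁻ p, ‖Function.uncurry d.f p‖ₑ ∂(cyl d.Ω d.T) < ⊤
  rw [cyl, lintegral_prod _ hd.f_measurable.enorm]
  simp only [Function.uncurry_apply_pair]
  have hm : ∀ᵐ t ∂(volume.restrict (Ioo 0 d.T)),
      AEStronglyMeasurable (d.f t) (volume.restrict d.Ω) := hd.f_measurable.prodMk_left
  set c := (volume d.Ω) ^ (1 / (1 : ℝ≥0∞).toReal - 1 / (2 : ℝ≥0∞).toReal) with hc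
  have hcfin : c ≠ ⊤ := by
    apply ENNReal.rpow_ne_top_of_nonneg _ hd.domain.measure_lt_top.ne
    norm_num
  calc ∫⁻ t in Ioo 0 d.T, ∫⁻ x in d.Ω, ‖d.f t x‖ₑ
      ≤ ∫⁻ t in Ioo 0 d.T, eLpNorm (d.f t) 2 (volume.restrict d.Ω) * c := by
        apply lintegral_mono_ae
        filter_upwards [hm] with t ht
        have := eLpNorm_le_eLpNorm_mul_rpow_measure_univ (p := 1) (q := 2) (by norm_num) ht
        rwa [eLpNorm_one_eq_lintegral_enorm, Measure.restrict_apply_univ] at this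
    _ = (∫⁻ t in Ioo 0 d.T, eLpNorm (d.f t) 2 (volume.restrict d.Ω)) * c :=
        lintegral_mul_const' _ _ hcfin
    _ < ⊤ := ENNReal.mul_lt_top hd.f_integrable hcfin.lt_top

/-! ### Stresses along smooth fields -/

/-- The stress `Dφ(E)` along a strain field. -/
def stress (d : Data) (E : ℝ → Vec → Sym) (t : ℝ) (x : Vec) : Sym := gradient d.φ (E t x)

/-- The total stress as a field in space. -/
def stressField (d : Data) (v : ℝ → Vec → Vec) (E : ℝ → Vec → Sym) (t : ℝ) (x : Vec) : Sym :=
  d.totalStress (fderivWithin ℝ (v t) (closure d.Ω) x) (E t x)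

lemma contDiff_gradient {φ : Sym → ℝ} (hφ : ContDiff ℝ 3 φ) : ContDiff ℝ 2 (gradient φ) := by
  have h1 : ContDiff ℝ 2 (fderiv ℝ φ) := hφ.fderiv_right (by norm_num)
  let b := stdOrthonormalBasis ℝ Sym
  have h2 : gradient φ = fun A => ∑ i, (fderiv ℝ φ A (b i)) • b i := by
    ext1 A
    conv_lhs => rw [← b.sum_repr' (gradient φ A)]
    refine Finset.sum_congr rfl fun i _ => ?_
    rw [real_inner_comm, gradient, InnerProductSpace.toDual_symm_apply]
  rw [h2]
  exact ContDiff.sum fun i _ => (h1.clm_apply contDiff_const).smul contDiff_const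

lemma inner_gradient {φ : Sym → ℝ} (A B : Sym) : ⟪gradient φ A, B⟫ = fderiv ℝ φ A B := by
  rw [gradient, InnerProductSpace.toDual_symm_apply]

lemma contDiff_elasticStress (hφ : ContDiff ℝ 3 d.φ) : ContDiff ℝ 2 d.elasticStress :=
  (contDiff_gradient hφ).add ((hφ.of_le (by norm_num)).smul contDiff_const)

/-- Smooth velocity and strain fields with their time derivatives. -/
structure IsRegular (d : Data) (v dv : ℝ → Vec → Vec) (E dE : ℝ → Vec → Sym) : Prop where
  standing : d.Standing
  v_mem : MemC0C2 d.Ω d.T v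
  dv_mem : MemC0C2 d.Ω d.T dv
  E_mem : MemC0C2 d.Ω d.T E
  dE_mem : MemC0C2 d.Ω d.T dE
  v_deriv : ∀ t ∈ Icc 0 d.T, ∀ x ∈ closure d.Ω,
    HasDerivWithinAt (fun s => v s x) (dv t x) (Icc 0 d.T) t
  E_deriv : ∀ t ∈ Icc 0 d.T, ∀ x ∈ closure d.Ω,
    HasDerivWithinAt (fun s => E s x) (dE t x) (Icc 0 d.T) t

namespace IsRegular

variable {v dv : ℝ → Vec → Vec} {E dE : ℝ → Vec → Sym} (h : d.IsRegular v dv E dE)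
include h

lemma uniqueDiffOn : UniqueDiffOn ℝ (closure d.Ω) := h.standing.domain.uniqueDiffOn

lemma contDiff_φ : ContDiff ℝ 3 d.φ := h.standing.energy.contDiff

lemma contDiffOn_v {t : ℝ} (ht : t ∈ Icc 0 d.T) : ContDiffOn ℝ 1 (v t) (closure d.Ω) :=
  (h.v_mem.1 t ht).of_le (by norm_num)

lemma contDiffOn_E {t : ℝ} (ht : t ∈ Icc 0 d.T) : ContDiffOn ℝ 2 (E t) (closure d.Ω) :=
  h.E_mem.1 t ht

lemma contDiffOn_stress {t : ℝ} (ht : t ∈ Icc 0 d.T) :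
    ContDiffOn ℝ 2 (d.stress E t) (closure d.Ω) :=
  (contDiff_gradient h.contDiff_φ).comp_contDiffOn (h.contDiffOn_E ht)

lemma contDiffOn_stressField {t : ℝ} (ht : t ∈ Icc 0 d.T) :
    ContDiffOn ℝ 1 (d.stressField v E t) (closure d.Ω) := by
  have h1 : ContDiffOn ℝ 1 (fderivWithin ℝ (v t) (closure d.Ω)) (closure d.Ω) :=
    (h.v_mem.1 t ht).fderivWithin h.uniqueDiffOn (by norm_num)
  have h2 : ContDiffOn ℝ 1 (fun x => d.elasticStress (E t x)) (closure d.Ω) :=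
    ((contDiff_elasticStress h.contDiff_φ).of_le (by norm_num)).comp_contDiffOn
      ((h.contDiffOn_E ht).of_le (by norm_num))
  exact (((LinearMap.toContinuousLinearMap d.L).comp symGradL).contDiff.comp_contDiffOn h1).add h2

lemma continuousOn_stress :
    ContinuousOn (fun p : ℝ × Vec => d.stress E p.1 p.2) (Icc 0 d.T ×ˢ closure d.Ω) :=
  (contDiff_gradient h.contDiff_φ).continuous.comp_continuousOn h.E_mem.continuousOn

lemma hasFDerivWithinAt_E {t : ℝ} (ht : t ∈ Icc 0 d.T) {x : Vec} (hx : x ∈ closure d.Ω) :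
    HasFDerivWithinAt (E t) (fderivWithin ℝ (E t) (closure d.Ω) x) (closure d.Ω) x :=
  (((h.contDiffOn_E ht) x hx).differentiableWithinAt (by norm_num)).hasFDerivWithinAt

lemma fderivWithin_comp_E {G : Type*} [NormedAddCommGroup G] [NormedSpace ℝ G] {g : Sym → G}
    (hg : ContDiff ℝ 1 g) {t : ℝ} (ht : t ∈ Icc 0 d.T) {x : Vec} (hx : x ∈ closure d.Ω) :
    fderivWithin ℝ (fun y => g (E t y)) (closure d.Ω) x =
      (fderiv ℝ g (E t x)).comp (fderivWithin ℝ (E t) (closure d.Ω) x) := by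
  have h1 : HasFDerivAt g (fderiv ℝ g (E t x)) (E t x) :=
    (hg.differentiable (by norm_num) _).hasFDerivAt
  exact (h1.comp_hasFDerivWithinAt x (h.hasFDerivWithinAt_E ht hx)).fderivWithin
    (h.uniqueDiffOn x hx)

lemma continuousOn_fderivWithin_comp_E {G : Type*} [NormedAddCommGroup G] [NormedSpace ℝ G]
    {g : Sym → G} (hg : ContDiff ℝ 1 g) :
    ContinuousOn (fun p : ℝ × Vec => fderivWithin ℝ (fun y => g (E p.1 y)) (closure d.Ω) p.2)
      (Icc 0 d.T ×ˢ closure d.Ω) := by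
  have h1 := (hg.continuous_fderiv (by norm_num)).comp_continuousOn h.E_mem.continuousOn
  exact (h1.clm_comp (h.E_mem.continuousOn_fderivWithin h.uniqueDiffOn)).congr fun p hp =>
    h.fderivWithin_comp_E hg hp.1 hp.2

lemma continuousOn_fderivWithin_stress :
    ContinuousOn (fun p : ℝ × Vec => fderivWithin ℝ (d.stress E p.1) (closure d.Ω) p.2)
      (Icc 0 d.T ×ˢ closure d.Ω) :=
  h.continuousOn_fderivWithin_comp_E ((contDiff_gradient h.contDiff_φ).of_le (by norm_num))

/-- The stress contains the velocity gradient, so this uses the joint continuity of the second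
derivatives of v. -/
lemma continuousOn_fderivWithin_stressField :
    ContinuousOn (fun p : ℝ × Vec => fderivWithin ℝ (d.stressField v E p.1) (closure d.Ω) p.2)
      (Icc 0 d.T ×ˢ closure d.Ω) := by
  set M := (LinearMap.toContinuousLinearMap d.L).comp symGradL with hM
  have hg : ContDiff ℝ 1 d.elasticStress :=
    (contDiff_elasticStress h.contDiff_φ).of_le (by norm_num)
  have h1 := (continuousOn_const (c := M)).clm_comp
    (h.v_mem.continuousOn_fderivWithin_two h.uniqueDiffOn)
  refine (h1.add (h.continuousOn_fderivWithin_comp_E hg)).congr fun p hp => ?_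
  have h2 : HasFDerivWithinAt (fderivWithin ℝ (v p.1) (closure d.Ω))
      (fderivWithin ℝ (fderivWithin ℝ (v p.1) (closure d.Ω)) (closure d.Ω) p.2) (closure d.Ω) p.2 :=
    ((((h.v_mem.1 p.1 hp.1).fderivWithin h.uniqueDiffOn (m := 1) (by norm_num)) p.2
      hp.2).differentiableWithinAt (by norm_num)).hasFDerivWithinAt
  have h3 : HasFDerivWithinAt (fun y => d.elasticStress (E p.1 y)) _ (closure d.Ω) p.2 :=
    (hg.differentiable (by norm_num) _).hasFDerivAt.comp_hasFDerivWithinAt p.2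
      (h.hasFDerivWithinAt_E hp.1 hp.2)
  have h4 : HasFDerivWithinAt (d.stressField v E p.1) _ (closure d.Ω) p.2 :=
    (M.hasFDerivAt.comp_hasFDerivWithinAt p.2 h2).add h3
  rw [h4.fderivWithin (h.uniqueDiffOn p.2 hp.2), ← h3.fderivWithin (h.uniqueDiffOn p.2 hp.2)]
  rfl

end IsRegular

end Data

end ViscoPlast
end

noncomputable section

namespace ViscoPlast

lemma MemL2H1.ae_integrableOn {F : Type*} [NormedAddCommGroup F] [NormedSpace ℝ F] {Ω : Set Vec}
    {T : ℝ} {u : ℝ → Vec → F} {Du : ℝ → Vec → Vec →L[ℝ] F} (h : MemL2H1 Ω T u Du)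
    (hΩ : IsLipschitzDomain Ω) : ∀ᵐ t ∂(volume.restrict (Ioo 0 T)), IntegrableOn (Du t) Ω := by
  have hfin : IsFiniteMeasure (volume.restrict Ω) := ⟨by simpa using hΩ.measure_lt_top⟩
  have hcyl : IsFiniteMeasure (cyl Ω T) := by rw [cyl]; infer_instance
  exact (h.2.1.integrable (by norm_num)).prod_right_ae

namespace Data

variable (d : Data)

/-! ### The weak formulation in densities -/

/-- The part of the energy balance that does not depend on the test functions. -/
def baseDensity (v dv : Vec) (G : Vec →L[ℝ] Vec) (A dA : Sym) (GS : Vec →L[ℝ] Sym) : ℝ :=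
  d.ρ * ⟪v, dv⟫ + ⟪gradient d.φ A, dA⟫ + ⟪d.L (symGrad G), symGrad G⟫ + d.γ * tripleDot GS GS

/-- The momentum equation without force, tested with a velocity test function. -/
def momDensity (v dv : Vec) (G : Vec →L[ℝ] Vec) (A : Sym) (ψ : Vec) (Dψ : Vec →L[ℝ] Vec) : ℝ :=
  -(d.ρ * ⟪dv, ψ⟫) + d.ρ / 2 * divg G * ⟪v, ψ⟫ + d.ρ * ⟪v, Dψ v⟫
    - ⟪d.L (symGrad G) + gradient d.φ A, symGrad Dψ⟫ - d.φ A * divg Dψ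

/-- The strain-rate equation tested with a strain test function. -/
def strainDensity (v : Vec) (G : Vec →L[ℝ] Vec) (A dA : Sym) (GS : Vec →L[ℝ] Sym) (Ψ : Sym)
    (DΨ : Vec →L[ℝ] Sym) : ℝ :=
  -⟪dA, Ψ⟫ + divg G * ⟪A, Ψ⟫ + ⟪DΨ v, A⟫ - ⟪corotSym A G, Ψ⟫ + ⟪symGrad G, Ψ⟫
    - d.γ * tripleDot GS DΨ

/-- The time derivative of the integrand of the energy pairing. -/
def pairingRate (v dv : Vec) (A dA : Sym) (ψ dψ : Vec) (Ψ dΨ : Sym) : ℝ :=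
  d.ρ * ⟪v, dv⟫ + ⟪gradient d.φ A, dA⟫
    - (d.ρ * ⟪dv, ψ⟫ + d.ρ * ⟪v, dψ⟫ + (⟪dA, Ψ⟫ + ⟪A, dΨ⟫))

/-- Here `dv` and `dA` are arbitrary; they are added and subtracted. Split in this way, the time
derivatives of the tests occur only in `pairingRate`, which cancels against the increment of the
energy pairing, so that time derivatives of the fields take their place. -/
lemma weakIntegrand_eq (v : ℝ → Vec → Vec) (Gv : ℝ → Vec → Vec →L[ℝ] Vec)
    (E : ℝ → Vec → Sym) (GS : ℝ → Vec → Vec →L[ℝ] Sym) (ψ : ℝ → Vec → Vec) (Ψ : ℝ → Vec → Sym)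
    (t : ℝ) (x : Vec) (dv : Vec) (dA : Sym) :
    d.weakIntegrand v Gv E GS ψ Ψ t x =
      d.baseDensity (v t x) dv (Gv t x) (E t x) dA (GS t x)
      + d.momDensity (v t x) dv (Gv t x) (E t x) (ψ t x) (fderiv ℝ (ψ t) x)
      + d.strainDensity (v t x) (Gv t x) (E t x) dA (GS t x) (Ψ t x) (fderiv ℝ (Ψ t) x)
      + ⟪d.f t x, ψ t x - v t x⟫
      - d.pairingRate (v t x) dv (E t x) dA (ψ t x) (deriv (fun s => ψ s x) t) (Ψ t x)
        (deriv (fun s => Ψ s x) t) := by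
  have h : ⟪corot (E t x) (Gv t x), (Ψ t x : Mat)⟫ = ⟪corotSym (E t x) (Gv t x), Ψ t x⟫ := rfl
  rw [weakIntegrand, h, inner_sub_right, baseDensity, momDensity, strainDensity, pairingRate]
  ring

section Fields

variable (v dv : ℝ → Vec → Vec) (E dE : ℝ → Vec → Sym) (ψ : ℝ → Vec → Vec) (Ψ : ℝ → Vec → Sym)

/-- The test-independent density along smooth fields. -/
def baseField (p : ℝ × Vec) : ℝ :=
  d.baseDensity (v p.1 p.2) (dv p.1 p.2) (fderivWithin ℝ (v p.1) (closure d.Ω) p.2) (E p.1 p.2)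
    (dE p.1 p.2) (fderivWithin ℝ (d.stress E p.1) (closure d.Ω) p.2)

/-- The momentum density along smooth fields. -/
def momField (p : ℝ × Vec) : ℝ :=
  d.momDensity (v p.1 p.2) (dv p.1 p.2) (fderivWithin ℝ (v p.1) (closure d.Ω) p.2) (E p.1 p.2)
    (ψ p.1 p.2) (fderivWithin ℝ (ψ p.1) (closure d.Ω) p.2)

/-- The strain density along smooth fields. -/
def strainField (p : ℝ × Vec) : ℝ :=
  d.strainDensity (v p.1 p.2) (fderivWithin ℝ (v p.1) (closure d.Ω) p.2) (E p.1 p.2)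
    (dE p.1 p.2) (fderivWithin ℝ (d.stress E p.1) (closure d.Ω) p.2) (Ψ p.1 p.2)
    (fderivWithin ℝ (Ψ p.1) (closure d.Ω) p.2)

/-- The potential of the deviatoric stress. -/
def stressPot (t : ℝ) : ℝ≥0∞ := potVal d.P fun x => dev (d.stress E t x)

end Fields

lemma IsWeakSolution.gradients_eq {d : Data} {v dv : ℝ → Vec → Vec} {E dE : ℝ → Vec → Sym}
    (h : d.IsRegular v dv E dE) {Gv : ℝ → Vec → Vec →L[ℝ] Vec} {GS : ℝ → Vec → Vec →L[ℝ] Sym}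
    (hv : MemL2H1 d.Ω d.T v Gv) (hS : MemL2H1 d.Ω d.T (fun t x => gradient d.φ (E t x)) GS) :
    ∀ᵐ t ∂(volume.restrict (Ioo 0 d.T)), ∀ᵐ x ∂(volume.restrict d.Ω),
      Gv t x = fderivWithin ℝ (v t) (closure d.Ω) x ∧
      GS t x = fderivWithin ℝ (d.stress E t) (closure d.Ω) x := by
  filter_upwards [hv.ae_integrableOn h.standing.domain, hS.ae_integrableOn h.standing.domain,
    hv.2.2, hS.2.2, ae_restrict_mem measurableSet_Ioo] with t h3 h4 h5 h6 ht
  have ht' := Ioo_subset_Icc_self ht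
  filter_upwards [h.standing.domain.ae_eq_weakGradient (h.contDiffOn_v ht') h5 h3,
    h.standing.domain.ae_eq_weakGradient ((h.contDiffOn_stress ht').of_le (by norm_num)) h6 h4]
    with x hx1 hx2 using ⟨hx1, hx2⟩

namespace IsRegular

variable {d}
variable {v dv : ℝ → Vec → Vec} {E dE : ℝ → Vec → Sym} (h : d.IsRegular v dv E dE)
include h

lemma continuousOn_baseField :
    ContinuousOn (d.baseField v dv E dE) (Icc 0 d.T ×ˢ closure d.Ω) := by
  have h1 := h.v_mem.continuousOn
  have h2 := h.dv_mem.continuousOn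
  have h3 := h.dE_mem.continuousOn
  have h4 := h.continuousOn_stress
  have h5 := h.v_mem.continuousOn_fderivWithin h.uniqueDiffOn
  have h6 := h.continuousOn_fderivWithin_stress
  have h7 := continuous_symGrad.comp_continuousOn h5
  have h8 := (LinearMap.toContinuousLinearMap d.L).continuous.comp_continuousOn h7
  exact ((((h1.inner h2).const_mul d.ρ).add (h4.inner h3)).add (h8.inner h7)).add
    ((h6.tripleDot h6).const_mul d.γ)

lemma continuousOn_momField {ψ : ℝ → Vec → Vec} {s : Set ℝ} (hs : s ⊆ Icc 0 d.T)
    (hψ : ContinuousOn (fun p : ℝ × Vec => ψ p.1 p.2) (s ×ˢ closure d.Ω))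
    (hDψ : ContinuousOn (fun p : ℝ × Vec => fderivWithin ℝ (ψ p.1) (closure d.Ω) p.2)
      (s ×ˢ closure d.Ω)) :
    ContinuousOn (d.momField v dv E ψ) (s ×ˢ closure d.Ω) := by
  have hsub : s ×ˢ closure d.Ω ⊆ Icc 0 d.T ×ˢ closure d.Ω := Set.prod_mono hs subset_rfl
  have h1 := h.v_mem.continuousOn.mono hsub
  have h2 := h.dv_mem.continuousOn.mono hsub
  have h4 := h.continuousOn_stress.mono hsub
  have h5 := (h.v_mem.continuousOn_fderivWithin h.uniqueDiffOn).mono hsub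
  have h7 := (LinearMap.toContinuousLinearMap d.L).continuous.comp_continuousOn
    (continuous_symGrad.comp_continuousOn h5)
  have h8 := h.contDiff_φ.continuous.comp_continuousOn (h.E_mem.continuousOn.mono hsub)
  exact ((((((h2.inner hψ).const_mul d.ρ).neg).add
    (((continuous_divg.comp_continuousOn h5).const_mul (d.ρ / 2)).mul (h1.inner hψ))).add
    ((h1.inner (hDψ.clm_apply h1)).const_mul d.ρ)).sub
    ((h7.add h4).inner (continuous_symGrad.comp_continuousOn hDψ))).sub
    (h8.mul (continuous_divg.comp_continuousOn hDψ))

lemma continuousOn_strainField {Ψ : ℝ → Vec → Sym} {s : Set ℝ} (hs : s ⊆ Icc 0 d.T)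
    (hΨ : ContinuousOn (fun p : ℝ × Vec => Ψ p.1 p.2) (s ×ˢ closure d.Ω))
    (hDΨ : ContinuousOn (fun p : ℝ × Vec => fderivWithin ℝ (Ψ p.1) (closure d.Ω) p.2)
      (s ×ˢ closure d.Ω)) :
    ContinuousOn (d.strainField v E dE Ψ) (s ×ˢ closure d.Ω) := by
  have hsub : s ×ˢ closure d.Ω ⊆ Icc 0 d.T ×ˢ closure d.Ω := Set.prod_mono hs subset_rfl
  have h1 := h.v_mem.continuousOn.mono hsub
  have h2 := h.dE_mem.continuousOn.mono hsub
  have h3 := h.E_mem.continuousOn.mono hsub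
  have h5 := (h.v_mem.continuousOn_fderivWithin h.uniqueDiffOn).mono hsub
  have h6 := h.continuousOn_fderivWithin_stress.mono hsub
  exact (((((h2.inner hΨ).neg.add
    ((continuous_divg.comp_continuousOn h5).mul (h3.inner hΨ))).add
    ((hDΨ.clm_apply h1).inner h3)).sub ((h3.corotSym h5).inner hΨ)).add
    ((continuous_symGrad.comp_continuousOn h5).inner hΨ)).sub
    ((h6.tripleDot hDΨ).const_mul d.γ)

lemma integrable_force {a b : ℝ} (ha : 0 ≤ a) (hb : b < d.T) {g : ℝ × Vec → Vec}
    (hg : ContinuousOn g (Icc a b ×ˢ closure d.Ω)) :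
    Integrable (fun p => ⟪d.f p.1 p.2, g p⟫) (slab d.Ω a b) := by
  have h1 := h.standing.integrable_f.mono_measure (slab_le_cyl d.Ω ha hb)
  have h2 := (h.standing.domain.integrable_slab hg).aestronglyMeasurable
  obtain ⟨C, hC⟩ := (isCompact_Icc.prod
    h.standing.domain.isCompact_closure).exists_bound_of_continuousOn hg
  refine (h1.norm.mul_const C).mono' (h1.aestronglyMeasurable.inner h2) ?_
  rw [slab_eq]
  filter_upwards [ae_restrict_mem (measurableSet_Ioc.prod h.standing.domain.isOpen.measurableSet)]
    with p hp
  refine (norm_inner_le_norm _ _).trans ?_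
  gcongr
  exact hC p ⟨Ioc_subset_Icc_self hp.1, subset_closure hp.2⟩

lemma hasDerivAt_v {t : ℝ} (ht : t ∈ Ioo 0 d.T) {x : Vec} (hx : x ∈ closure d.Ω) :
    HasDerivAt (fun s => v s x) (dv t x) t :=
  (h.v_deriv t (Ioo_subset_Icc_self ht) x hx).hasDerivAt (Icc_mem_nhds ht.1 ht.2)

lemma hasDerivAt_E {t : ℝ} (ht : t ∈ Ioo 0 d.T) {x : Vec} (hx : x ∈ closure d.Ω) :
    HasDerivAt (fun s => E s x) (dE t x) t :=
  (h.E_deriv t (Ioo_subset_Icc_self ht) x hx).hasDerivAt (Icc_mem_nhds ht.1 ht.2)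

/-- The energy pairing is absolutely continuous in time, and the weak integrand can be rewritten in
densities. -/
lemma weak_lhs_eq {Gv : ℝ → Vec → Vec →L[ℝ] Vec} {GS : ℝ → Vec → Vec →L[ℝ] Sym}
    (hG : ∀ᵐ t ∂(volume.restrict (Ioo 0 d.T)), ∀ᵐ x ∂(volume.restrict d.Ω),
      Gv t x = fderivWithin ℝ (v t) (closure d.Ω) x ∧
      GS t x = fderivWithin ℝ (d.stress E t) (closure d.Ω) x)
    {ψ : ℝ → Vec → Vec} {Ψ : ℝ → Vec → Sym} (hψ : IsTestFunction d.Ω d.T ψ)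
    (hΨ : IsTestFunction d.Ω d.T Ψ) {s t : ℝ} (hs : 0 ≤ s) (hst : s ≤ t) (ht : t < d.T) :
    d.energyPairing (v t) (E t) (ψ t) (Ψ t) - d.energyPairing (v s) (E s) (ψ s) (Ψ s)
      + ∫ τ in s..t, ∫ x in d.Ω, d.weakIntegrand v Gv E GS ψ Ψ τ x =
    ∫ p, (d.baseField v dv E dE p + d.momField v dv E ψ p + d.strainField v E dE Ψ p
      + ⟪d.f p.1 p.2, ψ p.1 p.2 - v p.1 p.2⟫) ∂(slab d.Ω s t) := by
  have hΩ := h.standing.domain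
  have hU := h.uniqueDiffOn
  have hsub : Icc s t ⊆ Icc 0 d.T := Icc_subset_Icc hs ht.le
  have hsub' : Icc s t ⊆ Ico 0 d.T := fun τ hτ => ⟨hs.trans hτ.1, hτ.2.trans_lt ht⟩
  have hpsub : Icc s t ×ˢ closure d.Ω ⊆ Icc 0 d.T ×ˢ closure d.Ω := Set.prod_mono hsub subset_rfl
  have hpsub' : Icc s t ×ˢ closure d.Ω ⊆ Ico 0 d.T ×ˢ closure d.Ω := Set.prod_mono hsub' subset_rfl
  have hcv := h.v_mem.continuousOn.mono hpsub
  have hcdv := h.dv_mem.continuousOn.mono hpsub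
  have hcE := h.E_mem.continuousOn.mono hpsub
  have hcdE := h.dE_mem.continuousOn.mono hpsub
  have hcS := h.continuousOn_stress.mono hpsub
  have hcψ := hψ.continuousOn.mono hpsub'
  have hcΨ := hΨ.continuousOn.mono hpsub'
  have hcdψ := (hψ.continuousOn_dt hU).mono hpsub'
  have hcdΨ := (hΨ.continuousOn_dt hU).mono hpsub'
  have hcDψ := (hψ.continuousOn_fderivWithin hU).mono hpsub'
  have hcDΨ := (hΨ.continuousOn_fderivWithin hU).mono hpsub'
  set g : ℝ × Vec → ℝ := fun p => d.energyDensity (v p.1) (E p.1) p.2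
    - (d.ρ * ⟪v p.1 p.2, ψ p.1 p.2⟫ + ⟪E p.1 p.2, Ψ p.1 p.2⟫) with hg
  set g' : ℝ × Vec → ℝ := fun p => d.pairingRate (v p.1 p.2) (dv p.1 p.2) (E p.1 p.2)
    (dE p.1 p.2) (ψ p.1 p.2) (IsTestFunction.dt d.Ω d.T ψ p) (Ψ p.1 p.2)
    (IsTestFunction.dt d.Ω d.T Ψ p) with hg'
  have hce : ContinuousOn (fun p : ℝ × Vec => d.energyDensity (v p.1) (E p.1) p.2)
      (Icc s t ×ˢ closure d.Ω) :=
    ((hcv.norm.pow 2).const_mul (d.ρ / 2)).add (h.contDiff_φ.continuous.comp_continuousOn hcE)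
  have hcp : ContinuousOn (fun p : ℝ × Vec => d.ρ * ⟪v p.1 p.2, ψ p.1 p.2⟫
      + ⟪E p.1 p.2, Ψ p.1 p.2⟫) (Icc s t ×ˢ closure d.Ω) :=
    ((hcv.inner hcψ).const_mul d.ρ).add (hcE.inner hcΨ)
  have hcg : ContinuousOn g (Icc s t ×ˢ closure d.Ω) := hce.sub hcp
  have hcg' : ContinuousOn g' (Icc s t ×ˢ closure d.Ω) :=
    (((hcv.inner hcdv).const_mul d.ρ).add (hcS.inner hcdE)).sub
      ((((hcdv.inner hcψ).const_mul d.ρ).add ((hcv.inner hcdψ).const_mul d.ρ)).add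
        ((hcdE.inner hcΨ).add (hcE.inner hcdΨ)))
  have hpair : ∀ τ ∈ Icc s t, d.energyPairing (v τ) (E τ) (ψ τ) (Ψ τ) = ∫ x in d.Ω, g (τ, x) :=
    fun τ hτ => (integral_sub (hΩ.integrableOn (continuousOn_slice_time hce hτ))
      (hΩ.integrableOn (continuousOn_slice_time hcp hτ))).symm
  have hder : ∀ τ ∈ Ioo s t, ∀ x ∈ d.Ω, HasDerivAt (fun s => g (s, x)) (g' (τ, x)) τ := by
    intro τ hτ x hx
    have hτ' : τ ∈ Ioo 0 d.T := ⟨hs.trans_lt hτ.1, hτ.2.trans ht⟩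
    have hx' := subset_closure hx
    have h1 := h.hasDerivAt_v hτ' hx'
    have h2 := h.hasDerivAt_E hτ' hx'
    have h3 := hψ.hasDerivAt hτ' hx'
    have h4 := hΨ.hasDerivAt hτ' hx'
    have h5 : HasDerivAt (fun s => d.φ (E s x)) ⟪gradient d.φ (E τ x), dE τ x⟫ τ := by
      rw [inner_gradient]
      exact ((h.contDiff_φ.differentiable (by norm_num)) _).hasFDerivAt.comp_hasDerivAt τ h2
    have h6 := (((h1.norm_sq).const_mul (d.ρ / 2)).add h5).sub
      (((h1.inner ℝ h3).const_mul d.ρ).add (h2.inner ℝ h4))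
    refine h6.congr_deriv ?_
    simp only [hg', pairingRate]
    ring
  -- The increment of the pairing is the integral of `g'` over the slab; the same term occurs below
  -- with a minus sign in the weak integrand.
  have hX := hΩ.integral_sub_eq_slab hst hcg hcg' hder
  rw [hpair t (right_mem_Icc.2 hst), hpair s (left_mem_Icc.2 hst), hX]
  have hcore : ContinuousOn (fun p => d.baseField v dv E dE p + d.momField v dv E ψ p
      + d.strainField v E dE Ψ p) (Icc s t ×ˢ closure d.Ω) := (((h.continuousOn_baseField.mono hpsub).add
    (h.continuousOn_momField hsub hcψ hcDψ)).add (h.continuousOn_strainField hsub hcΨ hcDΨ))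
  have hicore := hΩ.integrable_slab hcore
  have hif := h.integrable_force hs ht (g := fun p => ψ p.1 p.2 - v p.1 p.2) (hcψ.sub hcv)
  have hig' := hΩ.integrable_slab hcg'
  have hW : ∫ τ in s..t, ∫ x in d.Ω, d.weakIntegrand v Gv E GS ψ Ψ τ x =
      ∫ τ in s..t, ∫ x in d.Ω, (fun p : ℝ × Vec => d.baseField v dv E dE p + d.momField v dv E ψ p
        + d.strainField v E dE Ψ p + ⟪d.f p.1 p.2, ψ p.1 p.2 - v p.1 p.2⟫ - g' p) (τ, x) := by
    apply intervalIntegral.integral_congr_ae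
    have hG' := (ae_restrict_iff' measurableSet_Ioo).1 hG
    filter_upwards [hG'] with τ hτ hτst
    rw [uIoc_of_le hst] at hτst
    have hτ' : τ ∈ Ioo 0 d.T := ⟨hs.trans_lt hτst.1, hτst.2.trans_lt ht⟩
    apply integral_congr_ae
    filter_upwards [hτ hτ', ae_restrict_mem hΩ.isOpen.measurableSet] with x hx hxΩ
    have hx' := subset_closure hxΩ
    rw [d.weakIntegrand_eq v Gv E GS ψ Ψ τ x (dv τ x) (dE τ x), hx.1, hx.2,
      (hψ.hasDerivAt hτ' hx').deriv, (hΨ.hasDerivAt hτ' hx').deriv,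
      ← fderivWithin_of_mem_nhds (hΩ.closure_mem_nhds hxΩ) (f := ψ τ),
      ← fderivWithin_of_mem_nhds (hΩ.closure_mem_nhds hxΩ) (f := Ψ τ)]
    rfl
  have hsum : Integrable (fun p => d.baseField v dv E dE p + d.momField v dv E ψ p
      + d.strainField v E dE Ψ p + ⟪d.f p.1 p.2, ψ p.1 p.2 - v p.1 p.2⟫) (slab d.Ω s t) :=
    hicore.add hif
  have hsub : Integrable (fun p => d.baseField v dv E dE p + d.momField v dv E ψ p
      + d.strainField v E dE Ψ p + ⟪d.f p.1 p.2, ψ p.1 p.2 - v p.1 p.2⟫ - g' p)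
      (slab d.Ω s t) := hsum.sub hig'
  rw [hW, intervalIntegral_eq_slab hst hsub, integral_sub hsum hig']
  ring

end IsRegular

end Data

end ViscoPlast
end

/-! ### The weak inequality along smooth fields, and the momentum flux -/

noncomputable section

namespace ViscoPlast

/-- The row-wise divergence as a function of the gradient. -/
def matDivOf (G : Vec →L[ℝ] Sym) : Vec :=
  WithLp.toLp 2 fun i => ∑ j, ((G (unitVec j) : Sym) : Mat) (i, j)

lemma matDiv_eq (S : Vec → Sym) (x : Vec) : matDiv S x = matDivOf (fderiv ℝ S x) := rfl

lemma _root_.ContinuousOn.matDivOf {X : Type*} [TopologicalSpace X] {s : Set X}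
    {f : X → Vec →L[ℝ] Sym} (hf : ContinuousOn f s) :
    ContinuousOn (fun x => matDivOf (f x)) s := by
  have h : ∀ i j : Fin 3, ContinuousOn (fun x => ((f x (unitVec j) : Sym) : Mat) (i, j)) s :=
    fun i j => (EuclideanSpace.proj (𝕜 := ℝ) (i, j)).continuous.comp_continuousOn
      (continuous_subtype_val.comp_continuousOn (hf.clm_apply continuousOn_const))
  exact (PiLp.continuous_toLp 2 _).comp_continuousOn
    (continuousOn_pi.2 fun i => continuousOn_finsetSum _ fun j _ => h i j)

/-- Integer factors suffice, and they matter: each inequality holds only for almost all times, and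
only countably many exceptional sets can be discarded together. -/
lemma eq_zero_of_forall_int_mul_le {X Y Z : ℝ} (h : ∀ n : ℤ, X + n * Y ≤ Z) : Y = 0 := by
  by_contra hY
  have hpos : 0 < Y ^ 2 := by positivity
  obtain ⟨m, hm⟩ := exists_nat_gt ((Z - X) / |Y|)
  rw [div_lt_iff₀ (abs_pos.2 hY)] at hm
  rcases lt_or_gt_of_ne hY with h1 | h1
  · have := h (-m)
    rw [abs_of_neg h1] at hm
    push_cast at this
    linarith
  · have := h m
    rw [abs_of_pos h1] at hm
    push_cast at this
    linarith

namespace Data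

variable (d : Data)

section Fields

variable (v dv : ℝ → Vec → Vec) (E dE : ℝ → Vec → Sym) (f : ℝ → Vec → Vec)
  (ψ : ℝ → Vec → Vec) (Ψ : ℝ → Vec → Sym)

/-- The complete density of the weak inequality along smooth fields, for the force `f`. -/
def coreField (p : ℝ × Vec) : ℝ :=
  d.baseField v dv E dE p + d.momField v dv E ψ p + d.strainField v E dE Ψ p
    + ⟪f p.1 p.2, ψ p.1 p.2 - v p.1 p.2⟫

/-- The momentum flux in the direction of a vector field `w`. -/
def momFlux (t : ℝ) (w : Vec → Vec) (x : Vec) : Vec :=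
  (d.ρ * ⟪v t x, w x⟫) • v t x - matVec (d.stressField v E t x) (w x)

/-- The force that the momentum equation assigns to smooth fields. -/
def forceField (t : ℝ) (x : Vec) : Vec :=
  d.ρ • (dv t x + fderivWithin ℝ (v t) (closure d.Ω) x (v t x))
    - matDivOf (fderivWithin ℝ (d.stressField v E t) (closure d.Ω) x)
    + (d.ρ / 2 * divg (fderivWithin ℝ (v t) (closure d.Ω) x)) • v t x

end Fields

lemma strainField_zero (v : ℝ → Vec → Vec) (E dE : ℝ → Vec → Sym) (p : ℝ × Vec) : d.strainField v E dE (fun _ _ => 0) p = 0 := by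
  have h1 : fderivWithin ℝ (fun _ : Vec => (0 : Sym)) (closure d.Ω) p.2 = 0 := by simp
  simp only [strainField, strainDensity, h1]
  simp [tripleDot]

namespace IsRegular

variable {d}
variable {v dv : ℝ → Vec → Vec} {E dE : ℝ → Vec → Sym} (h : d.IsRegular v dv E dE)
include h

/-- The pairing increments disappear into the density by `weak_lhs_eq`. For intervals that start at
0 the jump from the given initial data to the values of the fields at time 0 remains, and it will
yield the initial conditions. -/
lemma reduced (hw : d.IsWeakSolution v E) {ψ : ℝ → Vec → Vec} {Ψ : ℝ → Vec → Sym}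
    (hψ : d.IsVelocityTest ψ) (hΨ : IsTestFunction d.Ω d.T Ψ) :
    (∀ᵐ q : ℝ × ℝ, 0 < q.1 → q.1 < q.2 → q.2 < d.T →
      ((∫ p, d.coreField v dv E dE d.f ψ Ψ p ∂(slab d.Ω q.1 q.2) : ℝ) : EReal)
        + ((∫⁻ τ in Ioo q.1 q.2, d.stressPot E τ : ℝ≥0∞) : EReal)
        ≤ ((∫⁻ τ in Ioo q.1 q.2, potVal d.P fun x => dev (Ψ τ x) : ℝ≥0∞) : EReal)) ∧
    ∀ᵐ t : ℝ, 0 < t → t < d.T →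
      ((d.energyPairing (v 0) (E 0) (ψ 0) (Ψ 0) - d.energyPairing d.v₀ d.E₀ (ψ 0) (Ψ 0)
          + ∫ p, d.coreField v dv E dE d.f ψ Ψ p ∂(slab d.Ω 0 t) : ℝ) : EReal)
        + ((∫⁻ τ in Ioo 0 t, d.stressPot E τ : ℝ≥0∞) : EReal)
        ≤ ((∫⁻ τ in Ioo 0 t, potVal d.P fun x => dev (Ψ τ x) : ℝ≥0∞) : EReal) := by
  obtain ⟨Gv, GE, GS, -, hv, -, -, -, hS, -, -, hineq⟩ := hw
  have hG := IsWeakSolution.gradients_eq h hv hS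
  obtain ⟨h1, h2⟩ := hineq ψ Ψ hψ hΨ
  constructor
  · filter_upwards [h1] with q hq hq0 hq1 hqT
    have := hq hq0 hq1 hqT
    rw [WeakInequality, h.weak_lhs_eq hG hψ.1 hΨ hq0.le hq1.le hqT] at this
    exact this
  · filter_upwards [h2] with t ht ht0 htT
    have h3 := ht ht0 htT
    have h4 := h.weak_lhs_eq hG hψ.1 hΨ le_rfl ht0.le htT
    rw [WeakInequality] at h3
    have h5 : d.energyPairing (v 0) (E 0) (ψ 0) (Ψ 0) - d.energyPairing d.v₀ d.E₀ (ψ 0) (Ψ 0)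
          + ∫ p, d.coreField v dv E dE d.f ψ Ψ p ∂(slab d.Ω 0 t) =
        d.energyPairing (v t) (E t) (ψ t) (Ψ t) - d.energyPairing d.v₀ d.E₀ (ψ 0) (Ψ 0)
          + ∫ τ in 0..t, ∫ x in d.Ω, d.weakIntegrand v Gv E GS ψ Ψ τ x := by
      have h6 : ∫ p, d.coreField v dv E dE d.f ψ Ψ p ∂(slab d.Ω 0 t) = _ := h4.symm
      rw [h6]; ring
    rw [h5]
    exact h3

lemma momField_smul {ψ : ℝ → Vec → Vec} {p : ℝ × Vec} (hp : p.2 ∈ closure d.Ω)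
    (hψ : DifferentiableWithinAt ℝ (ψ p.1) (closure d.Ω) p.2) (c : ℝ) :
    d.momField v dv E (fun t x => c • ψ t x) p = c * d.momField v dv E ψ p := by
  simp only [momField, momDensity]
  rw [fderivWithin_fun_const_smul (h.uniqueDiffOn p.2 hp) hψ]
  simp only [real_inner_smul_right, FunLike.coe_smul, Pi.smul_apply, symGrad_smul, divg_smul,
    sym_inner_smul_right]
  ring

lemma continuousOn_forceField :
    ContinuousOn (fun p : ℝ × Vec => d.forceField v dv E p.1 p.2) (Icc 0 d.T ×ˢ closure d.Ω) := by
  have h1 := h.v_mem.continuousOn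
  have h2 := h.dv_mem.continuousOn
  have h3 := h.v_mem.continuousOn_fderivWithin h.uniqueDiffOn
  have h4 := h.continuousOn_fderivWithin_stressField
  exact (((h2.add (h3.clm_apply h1)).const_smul d.ρ).sub h4.matDivOf).add
    (((continuous_divg.comp_continuousOn h3).const_mul (d.ρ / 2)).smul h1)

lemma contDiffOn_momFlux {t : ℝ} (ht : t ∈ Icc 0 d.T) {w : Vec → Vec}
    (hw : ContDiffOn ℝ 1 w (closure d.Ω)) :
    ContDiffOn ℝ 1 (d.momFlux v E t w) (closure d.Ω) :=
  ((contDiffOn_const.mul ((h.contDiffOn_v ht).inner ℝ hw)).smul (h.contDiffOn_v ht)).sub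
    ((matVecL.contDiff.comp_contDiffOn (h.contDiffOn_stressField ht)).clm_apply hw)

/-- The momentum density is, up to the force term, a divergence. -/
lemma divg_momFlux {t : ℝ} (ht : t ∈ Icc 0 d.T) {ψ : ℝ → Vec → Vec}
    (hw : ContDiffOn ℝ 1 (ψ t) (closure d.Ω)) {x : Vec} (hx : x ∈ d.Ω) :
    divg (fderivWithin ℝ (d.momFlux v E t (ψ t)) (closure d.Ω) x) =
      d.momField v dv E ψ (t, x) + ⟪d.forceField v dv E t x, ψ t x⟫ := by
  have hΩ := h.standing.domain
  have hn := hΩ.closure_mem_nhds hx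
  have h1 := hΩ.hasFDerivAt (h.contDiffOn_v ht) hx
  have h2 := hΩ.hasFDerivAt hw hx
  have h3 := hΩ.hasFDerivAt (h.contDiffOn_stressField ht) hx
  have h4 : HasFDerivAt (fun y => d.ρ * ⟪v t y, ψ t y⟫) _ x := (h1.inner ℝ h2).const_mul d.ρ
  have h5 := divg_fderiv_smul h4 h1
  have h6 := divg_fderiv_matVec h3.differentiableAt h2.differentiableAt
  have h7 : DifferentiableAt ℝ (fun y => (d.ρ * ⟪v t y, ψ t y⟫) • v t y) x :=
    (h4.fun_smul h1).differentiableAt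
  have h8 : DifferentiableAt ℝ (fun y => matVec (d.stressField v E t y) (ψ t y)) x :=
    (matVecL.hasFDerivAt_of_bilinear h3 h2).differentiableAt
  have h9 : fderiv ℝ (d.momFlux v E t (ψ t)) x =
      fderiv ℝ (fun y => (d.ρ * ⟪v t y, ψ t y⟫) • v t y) x
      - fderiv ℝ (fun y => matVec (d.stressField v E t y) (ψ t y)) x := fderiv_sub h7 h8
  rw [fderivWithin_of_mem_nhds (f := d.momFlux v E t (ψ t)) hn, h9, divg_sub, h5, h6, matDiv_eq,
    h3.fderiv, h2.fderiv]
  -- The spherical part φ(E) 𝕀 of the stress pairs with the symmetric gradient to φ(E) times the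
  -- divergence.
  have h10 : ⟪d.stressField v E t x, symGrad (fderivWithin ℝ (ψ t) (closure d.Ω) x)⟫ =
      ⟪d.L (symGrad (fderivWithin ℝ (v t) (closure d.Ω) x)) + gradient d.φ (E t x),
        symGrad (fderivWithin ℝ (ψ t) (closure d.Ω) x)⟫
      + d.φ (E t x) * divg (fderivWithin ℝ (ψ t) (closure d.Ω) x) := by
    rw [stressField, totalStress, elasticStress, ← add_assoc, inner_add_left,
      sym_inner_smul_left, inner_idSym_symGrad]
  rw [h10]
  have h11 : ⟪d.forceField v dv E t x, ψ t x⟫ =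
      d.ρ * (⟪dv t x, ψ t x⟫ + ⟪fderivWithin ℝ (v t) (closure d.Ω) x (v t x), ψ t x⟫)
      - ⟪matDivOf (fderivWithin ℝ (d.stressField v E t) (closure d.Ω) x), ψ t x⟫
      + d.ρ / 2 * divg (fderivWithin ℝ (v t) (closure d.Ω) x) * ⟪v t x, ψ t x⟫ := by
    rw [forceField, inner_add_left, inner_sub_left, real_inner_smul_left, real_inner_smul_left,
      inner_add_left]
  rw [h11]
  simp only [momField, momDensity, FunLike.coe_smul, Pi.smul_apply, smul_eq_mul,
    ContinuousLinearMap.comp_apply, ContinuousLinearMap.prod_apply, fderivInnerCLM_apply]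
  ring

end IsRegular

end Data

end ViscoPlast
end

/-! ### The momentum equation -/

noncomputable section

namespace ViscoPlast

lemma exists_mem_Ioo_of_ae_prod {p : ℝ × ℝ → Prop} (hp : ∀ᵐ q, p q) {a b a' b' : ℝ} (h : a < b)
    (h' : a' < b') : ∃ q, p q ∧ q.1 ∈ Ioo a b ∧ q.2 ∈ Ioo a' b' := by
  obtain ⟨q, hq, hq'⟩ := (Measure.dense_of_ae hp).exists_mem_open (isOpen_Ioo.prod isOpen_Ioo)
    ((nonempty_Ioo.2 h).prod (nonempty_Ioo.2 h'))
  exact ⟨q, hq, hq'.1, hq'.2⟩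

lemma potVal_zero {Ω : Set Vec} (P : DevL1 Ω → ℝ≥0∞) : potVal P (fun _ => 0) = P 0 := by
  have h : MemLp (fun _ : Vec => (0 : Dev)) 1 (volume.restrict Ω) := MemLp.zero'
  rw [potVal, dif_pos h]
  congr 1

lemma EReal_coe_le_of_add_le {x y : ℝ} {a : ℝ≥0∞}
    (h : (x : EReal) + (a : EReal) ≤ (y : EReal)) : x ≤ y := by
  have h1 : (x : EReal) ≤ (x : EReal) + (a : EReal) :=
    le_add_of_nonneg_right (EReal.coe_ennreal_nonneg a)
  exact_mod_cast h1.trans h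

lemma IsTestFunction.const_smul {F : Type*} [NormedAddCommGroup F] [NormedSpace ℝ F] {Ω : Set Vec}
    {T : ℝ} {u : ℝ → Vec → F} (hu : IsTestFunction Ω T u) (c : ℝ) :
    IsTestFunction Ω T fun t x => c • u t x := by
  obtain ⟨h1, τ, hτ, h2⟩ := hu
  exact ⟨contDiffOn_const.smul h1, τ, hτ, fun t ht htτ x hx => by simp [h2 t ht htτ x hx]⟩

lemma isTestFunction_zero {F : Type*} [NormedAddCommGroup F] [NormedSpace ℝ F] (Ω : Set Vec)
    {T : ℝ} (hT : 0 < T) : IsTestFunction Ω T fun _ _ => (0 : F) :=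
  ⟨contDiffOn_const, 0, hT, fun _ _ _ _ _ => rfl⟩

lemma exists_tsupport_subset_Icc_prod {T : ℝ} (hT : 0 < T) {Ω : Set Vec} {χ : ℝ × Vec → ℝ}
    (hc : HasCompactSupport χ) (hs : tsupport χ ⊆ Ioo 0 T ×ˢ Ω) :
    ∃ a b, 0 < a ∧ a < b ∧ b < T ∧ ∀ p, χ p ≠ 0 → p.1 ∈ Icc a b := by
  rcases (tsupport χ).eq_empty_or_nonempty with h0 | h0
  · refine ⟨T / 3, T / 2, by linarith, by linarith, by linarith, fun p hp => ?_⟩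
    have := subset_tsupport χ hp
    simp [h0] at this
  · have hK : IsCompact (Prod.fst '' tsupport χ) := hc.isCompact.image continuous_fst
    obtain ⟨m, ⟨p, hp, rfl⟩, hm⟩ := hK.exists_isLeast (h0.image _)
    obtain ⟨M, ⟨q, hq, rfl⟩, hM⟩ := hK.exists_isGreatest (h0.image _)
    have h1 := (hs hp).1
    have h2 := (hs hq).1
    have h3 := hm (mem_image_of_mem Prod.fst hq)
    refine ⟨p.1 / 2, (q.1 + T) / 2, by linarith [h1.1], by linarith [h1.1, h2.2],
      by linarith [h2.2], fun r hr => ?_⟩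
    have hr' := mem_image_of_mem Prod.fst (subset_tsupport χ hr)
    exact ⟨by linarith [hm hr', h1.1], by linarith [hM hr', h2.2]⟩

namespace Data

variable {d : Data}

lemma Standing.measurableSet_ΓN (hd : d.Standing) : MeasurableSet d.ΓN :=
  isClosed_frontier.measurableSet.diff hd.ΓD_measurable

lemma IsVelocityTest.const_smul {ψ : ℝ → Vec → Vec} (hψ : d.IsVelocityTest ψ) (c : ℝ) :
    d.IsVelocityTest fun t x => c • ψ t x := by
  refine ⟨hψ.1.const_smul c, fun t ht => ?_, fun t ht => ?_⟩
  · filter_upwards [hψ.2.1 t ht] with x hx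
    rw [hx, smul_zero]
  · filter_upwards [hψ.2.2 t ht] with x hx n hn
    rw [real_inner_smul_left, hx n hn, mul_zero]

lemma Standing.isVelocityTest_of_zero_frontier (hd : d.Standing) {ψ : ℝ → Vec → Vec}
    (hψ : IsTestFunction d.Ω d.T ψ) (h0 : ∀ t ∈ Ioo 0 d.T, ∀ x ∈ frontier d.Ω, ψ t x = 0) :
    d.IsVelocityTest ψ := by
  refine ⟨hψ, fun t ht => ?_, fun t ht => ?_⟩
  · filter_upwards [ae_restrict_mem hd.ΓD_measurable] with x hx
    exact h0 t ht x (hd.ΓD_subset hx)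
  · filter_upwards [ae_restrict_mem hd.measurableSet_ΓN] with x hx n hn
    rw [h0 t ht x hx.1, inner_zero_left]

namespace IsRegular

variable {v dv : ℝ → Vec → Vec} {E dE : ℝ → Vec → Sym} (h : d.IsRegular v dv E dE)
include h

/-- With zero strain test the right-hand side is P(0) = 0, and the nonnegative potential of the
stress may be dropped. The rest is affine in the factor n in front of ψ. -/
lemma integral_momField_add_force (hw : d.IsWeakSolution v E) {ψ : ℝ → Vec → Vec}
    (hψ : d.IsVelocityTest ψ) :
    ∀ᵐ q : ℝ × ℝ, 0 < q.1 → q.1 < q.2 → q.2 < d.T →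
      ∫ p, (d.momField v dv E ψ p + ⟪d.f p.1 p.2, ψ p.1 p.2⟫) ∂(slab d.Ω q.1 q.2) = 0 := by
  have hΩ := h.standing.domain
  have hall := ae_all_iff.2 fun n : ℤ => (h.reduced hw (hψ.const_smul (n : ℝ))
    (isTestFunction_zero (F := Sym) d.Ω h.standing.T_pos)).1
  filter_upwards [hall] with q hq hq0 hq1 hqT
  have hsub : Icc q.1 q.2 ⊆ Ico 0 d.T := fun τ hτ => ⟨hq0.le.trans hτ.1, hτ.2.trans_lt hqT⟩
  have hsub' := hsub.trans Ico_subset_Icc_self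
  have hp : Icc q.1 q.2 ×ˢ closure d.Ω ⊆ Ico 0 d.T ×ˢ closure d.Ω := Set.prod_mono hsub subset_rfl
  have hp' : Icc q.1 q.2 ×ˢ closure d.Ω ⊆ Icc 0 d.T ×ˢ closure d.Ω :=
    Set.prod_mono hsub' subset_rfl
  have i1 := hΩ.integrable_slab (h.continuousOn_baseField.mono hp')
  have i2 := hΩ.integrable_slab (h.continuousOn_momField hsub' (hψ.1.continuousOn.mono hp)
    ((hψ.1.continuousOn_fderivWithin h.uniqueDiffOn).mono hp))
  have i3 := h.integrable_force hq0.le hqT (hψ.1.continuousOn.mono hp)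
  have i4 := h.integrable_force hq0.le hqT (h.v_mem.continuousOn.mono hp')
  have i23 : Integrable (fun p : ℝ × Vec => d.momField v dv E ψ p + ⟪d.f p.1 p.2, ψ p.1 p.2⟫)
    (slab d.Ω q.1 q.2) := i2.add i3
  have i14 : Integrable (fun p : ℝ × Vec => d.baseField v dv E dE p - ⟪d.f p.1 p.2, v p.1 p.2⟫)
    (slab d.Ω q.1 q.2) := i1.sub i4
  refine eq_zero_of_forall_int_mul_le (Z := 0)
    (X := ∫ p, (d.baseField v dv E dE p - ⟪d.f p.1 p.2, v p.1 p.2⟫) ∂(slab d.Ω q.1 q.2))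
    fun n => ?_
  have h1 := hq n hq0 hq1 hqT
  have hz : potVal d.P (fun _ : Vec => dev 0) = 0 := by
    rw [show dev 0 = 0 from devL.map_zero, potVal_zero, h.standing.potential.zero]
  have h2 : ((∫⁻ _ in Ioo q.1 q.2, potVal d.P (fun _ : Vec => dev 0) : ℝ≥0∞) : EReal)
      = ((0 : ℝ) : EReal) := by
    rw [hz, lintegral_zero]; rfl
  have h3 := EReal_coe_le_of_add_le (h1.trans_eq h2)
  refine le_trans (le_of_eq ?_) h3
  rw [← integral_const_mul, ← integral_add i14 (i23.const_mul _)]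
  apply integral_congr_ae
  rw [slab_eq]
  filter_upwards [ae_restrict_mem (measurableSet_Ioc.prod hΩ.isOpen.measurableSet)] with p hpm
  have hpc := subset_closure hpm.2
  have hdiff := ((hψ.1.contDiffOn (hsub (Ioc_subset_Icc_self hpm.1))) p.2
    hpc).differentiableWithinAt (by norm_num)
  rw [coreField, h.momField_smul hpc hdiff, d.strainField_zero, inner_sub_right,
    real_inner_smul_right]
  ring

/-- The momentum equation. -/
lemma force_eq_ae (hw : d.IsWeakSolution v E) :
    ∀ᵐ p ∂(cyl d.Ω d.T), d.f p.1 p.2 = d.forceField v dv E p.1 p.2 := by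
  have hΩ := h.standing.domain
  have hfi := h.standing.integrable_f
  have hci : Integrable (fun p : ℝ × Vec => d.forceField v dv E p.1 p.2) (cyl d.Ω d.T) := by
    rw [cyl_eq]
    exact (h.continuousOn_forceField.integrableOn_compact
      (isCompact_Icc.prod hΩ.isCompact_closure)).mono_set
      (Set.prod_mono Ioo_subset_Icc_self subset_closure)
  have hi := hfi.sub hci
  rw [cyl_eq] at hi ⊢
  have hU : IsOpen (Ioo 0 d.T ×ˢ d.Ω) := isOpen_Ioo.prod hΩ.isOpen
  rw [ae_restrict_iff' hU.measurableSet]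
  suffices hs : ∀ᵐ p : ℝ × Vec, p ∈ Ioo 0 d.T ×ˢ d.Ω →
      d.f p.1 p.2 - d.forceField v dv E p.1 p.2 = 0 by
    filter_upwards [hs] with p hp hpU using sub_eq_zero.1 (hp hpU)
  refine hU.ae_eq_zero_of_integral_contDiff_smul_eq_zero (IntegrableOn.locallyIntegrableOn hi)
    fun χ hχ hχc hχs => ?_
  obtain ⟨a, b, ha, hab, hb, hχab⟩ := exists_tsupport_subset_Icc_prod h.standing.T_pos hχc hχs
  have hχ0 : ∀ p : ℝ × Vec, p ∉ Ioo 0 d.T ×ˢ d.Ω → χ p = 0 := fun p hp =>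
    image_eq_zero_of_notMem_tsupport fun hm => hp (hχs hm)
  have hχi : IntegrableOn (fun p : ℝ × Vec => χ p • (d.f p.1 p.2 - d.forceField v dv E p.1 p.2))
      (Ioo 0 d.T ×ˢ d.Ω) := by
    obtain ⟨C, hC⟩ := hχ.continuous.bounded_above_of_compact_support hχc
    exact hi.bdd_smul C hχ.continuous.aestronglyMeasurable (Eventually.of_forall hC)
  rw [← setIntegral_eq_integral_of_forall_compl_eq_zero (s := Ioo 0 d.T ×ˢ d.Ω)
    (fun p hp => by rw [hχ0 p hp, zero_smul])]
  refine ext_inner_left ℝ fun w => ?_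
  rw [inner_zero_right, ← integral_inner hχi]
  have hχ1 : ContDiff ℝ 1 χ := hχ.of_le (by norm_cast)
  set ψ : ℝ → Vec → Vec := fun t x => χ (t, x) • w with hψdef
  have hψ0 : ∀ t, ∀ x ∈ frontier d.Ω, ψ t x = 0 := by
    intro t x hx
    rw [hΩ.isOpen.frontier_eq] at hx
    simp only [hψdef]
    rw [hχ0 (t, x) fun hm => hx.2 hm.2, zero_smul]
  have hψt : IsTestFunction d.Ω d.T ψ := by
    refine ⟨(hχ1.smul contDiff_const).contDiffOn, (b + d.T) / 2, by linarith,
      fun t ht htb x hx => ?_⟩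
    have : χ (t, x) = 0 := by
      by_contra hne
      have := (hχab _ hne).2
      simp only at this
      linarith
    simp [hψdef, this]
  have hψv := h.standing.isVelocityTest_of_zero_frontier hψt fun t _ => hψ0 t
  -- The time interval between the components of q is admissible and contains the time support of χ,
  -- so restricting to it loses nothing.
  obtain ⟨q, hq, hqa, hqb⟩ := exists_mem_Ioo_of_ae_prod (h.integral_momField_add_force hw hψv) ha hb
  have hq' := hq hqa.1 (by linarith [hqa.2, hqb.1]) hqb.2
  have hqq : q.1 ≤ q.2 := by linarith [hqa.2, hqb.1]
  have hsub : Icc q.1 q.2 ⊆ Ico 0 d.T := fun τ hτ =>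
    ⟨hqa.1.le.trans hτ.1, hτ.2.trans_lt hqb.2⟩
  have hsub' := hsub.trans Ico_subset_Icc_self
  have hp : Icc q.1 q.2 ×ˢ closure d.Ω ⊆ Ico 0 d.T ×ˢ closure d.Ω := Set.prod_mono hsub subset_rfl
  have hp' : Icc q.1 q.2 ×ˢ closure d.Ω ⊆ Icc 0 d.T ×ˢ closure d.Ω :=
    Set.prod_mono hsub' subset_rfl
  have c2 := h.continuousOn_momField hsub' (hψt.continuousOn.mono hp)
    ((hψt.continuousOn_fderivWithin h.uniqueDiffOn).mono hp)
  have c5 := (h.continuousOn_forceField.mono hp').inner (𝕜 := ℝ) (hψt.continuousOn.mono hp)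
  have i2 := hΩ.integrable_slab c2
  have i3 := h.integrable_force hqa.1.le hqb.2 (hψt.continuousOn.mono hp)
  have i5 := hΩ.integrable_slab c5
  have i25 := hΩ.integrable_slab (c2.add c5)
  -- At each time the integrand is the divergence of the momentum flux, which vanishes on the
  -- frontier together with ψ. Subtracting this identity from the weak one leaves f - `forceField`
  -- tested with χ w.
  have hdiv : ∫ p, (d.momField v dv E ψ p + ⟪d.forceField v dv E p.1 p.2, ψ p.1 p.2⟫)
      ∂(slab d.Ω q.1 q.2) = 0 := by
    have h0 : ∫ t in q.1..q.2, ∫ x in d.Ω, (d.momField v dv E ψ (t, x)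
        + ⟪d.forceField v dv E t x, ψ t x⟫) = 0 := by
      apply intervalIntegral.integral_zero_ae
      refine Eventually.of_forall fun t ht => ?_
      rw [uIoc_of_le hqq] at ht
      have ht1 := hsub (Ioc_subset_Icc_self ht)
      have ht' := hsub' (Ioc_subset_Icc_self ht)
      have hcd : ContDiffOn ℝ 1 (ψ t) (closure d.Ω) := hψt.contDiffOn ht1
      rw [← hΩ.integral_divg_eq_zero_of_zero (h.contDiffOn_momFlux ht' hcd) fun x hx => by
        rw [momFlux, hψ0 t x hx, inner_zero_right, mul_zero, zero_smul, zero_sub, neg_eq_zero]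
        exact (matVecL (d.stressField v E t x)).map_zero]
      exact setIntegral_congr_fun hΩ.isOpen.measurableSet fun x hx =>
        (h.divg_momFlux ht' hcd hx).symm
    rw [← h0]
    exact (intervalIntegral_eq_slab hqq i25).symm
  have hdiff : ∫ p, ⟪d.f p.1 p.2 - d.forceField v dv E p.1 p.2, ψ p.1 p.2⟫
      ∂(slab d.Ω q.1 q.2) = 0 := by
    have e1 := integral_add i2 i3
    have e2 := integral_add i2 i5
    have e3 : ∫ p, ⟪d.f p.1 p.2 - d.forceField v dv E p.1 p.2, ψ p.1 p.2⟫
        ∂(slab d.Ω q.1 q.2) = (∫ p, ⟪d.f p.1 p.2, ψ p.1 p.2⟫ ∂(slab d.Ω q.1 q.2))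
          - ∫ p, ⟪d.forceField v dv E p.1 p.2, ψ p.1 p.2⟫ ∂(slab d.Ω q.1 q.2) := by
      simp only [inner_sub_left]
      exact integral_sub i3 i5
    rw [e3]
    linarith
  rw [slab_eq] at hdiff
  refine Eq.trans ?_ hdiff
  have hss : Ioc q.1 q.2 ×ˢ d.Ω ⊆ Ioo 0 d.T ×ˢ d.Ω :=
    Set.prod_mono (fun t ht => ⟨hqa.1.trans ht.1, ht.2.trans_lt hqb.2⟩) subset_rfl
  rw [← setIntegral_eq_of_subset_of_forall_sdiff_eq_zero (f := fun p : ℝ × Vec =>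
    ⟪d.f p.1 p.2 - d.forceField v dv E p.1 p.2, ψ p.1 p.2⟫) hU.measurableSet hss]
  · apply setIntegral_congr_fun hU.measurableSet
    intro p _
    simp only [hψdef]
    rw [real_inner_smul_right, real_inner_smul_right, real_inner_comm]
  · intro p hpd
    have : χ p = 0 := by
      by_contra hne
      have h1 := hχab _ hne
      exact hpd.2 ⟨⟨hqa.2.trans_le h1.1, h1.2.trans hqb.1.le⟩, hpd.1.2⟩
    have hp0 : ψ p.1 p.2 = 0 := by simp [hψdef, this]
    simp [hp0]

lemma momentumAt (hw : d.IsWeakSolution v E) :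
    ∀ᵐ p ∂(cyl d.Ω d.T), d.MomentumAt v E p.1 p.2 := by
  have hΩ := h.standing.domain
  have hm := h.force_eq_ae hw
  rw [cyl_eq] at hm ⊢
  filter_upwards [hm, ae_restrict_mem (measurableSet_Ioo.prod hΩ.isOpen.measurableSet)]
    with p hp hpm
  obtain ⟨t, x⟩ := p
  obtain ⟨ht, hx⟩ := hpm
  simp only at ht hx hp ⊢
  have ht' := Ioo_subset_Icc_self ht
  have hn := hΩ.closure_mem_nhds hx
  have h1 : fderiv ℝ (fun y => d.totalStress (fderiv ℝ (v t) y) (E t y)) x =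
      fderivWithin ℝ (d.stressField v E t) (closure d.Ω) x := by
    rw [fderivWithin_of_mem_nhds hn]
    apply Filter.EventuallyEq.fderiv_eq
    filter_upwards [hΩ.isOpen.mem_nhds hx] with y hy
    rw [stressField, fderivWithin_of_mem_nhds (hΩ.closure_mem_nhds hy)]
  rw [MomentumAt, matDiv_eq, h1, hp, (h.hasDerivAt_v ht (subset_closure hx)).deriv,
    ← fderivWithin_of_mem_nhds (f := v t) hn, forceField]
  abel

end IsRegular

end Data

end ViscoPlast
end

noncomputable section

namespace ViscoPlast

/-! ### Localization in time -/

/-- Average over a short interval just after t₀: there k is close to k(t₀) and σ is at least c. Only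
a lower bound for σ near t₀ is required, which is what lower semicontinuity provides. -/
lemma add_le_of_ae_integral_le {k : ℝ → ℝ} {σ : ℝ → ℝ≥0∞} {t₀ t₁ : ℝ} {c p : ℝ≥0} (h01 : t₀ < t₁)
    (hk : ContinuousOn k (Icc t₀ t₁))
    (hq : ∀ᵐ q : ℝ × ℝ, t₀ < q.1 → q.1 < q.2 → q.2 < t₁ →
      ((∫ t in q.1..q.2, k t : ℝ) : EReal) + ((∫⁻ t in Ioo q.1 q.2, σ t : ℝ≥0∞) : EReal)
        ≤ ((∫⁻ _ in Ioo q.1 q.2, (p : ℝ≥0∞) : ℝ≥0∞) : EReal))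
    (hc : ∀ᶠ t in 𝓝[>] t₀, (c : ℝ≥0∞) ≤ σ t) : k t₀ + c ≤ p := by
  refine le_of_forall_pos_le_add fun ε hε => ?_
  have h1 : ∀ᶠ t in 𝓝[>] t₀, k t₀ - ε < k t := by
    have h2 : Tendsto k (𝓝[>] t₀) (𝓝 (k t₀)) :=
      (hk t₀ (left_mem_Icc.2 h01.le)).mono_left (by
        rw [nhdsWithin_Icc_eq_nhdsGE h01]
        exact nhdsWithin_mono _ Ioi_subset_Ici_self)
    exact h2.eventually (lt_mem_nhds (by linarith))
  obtain ⟨u, hu, hsub⟩ := (mem_nhdsGT_iff_exists_Ioo_subset' h01).1 (h1.and hc)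
  obtain ⟨w, hw0, hwu⟩ := exists_between (lt_min h01 hu : t₀ < min t₁ u)
  -- The point m separates the two endpoints, so that an admissible pair taken from the product of
  -- the two intervals is ordered.
  obtain ⟨m, hm0, hmw⟩ := exists_between hw0
  obtain ⟨q, hq', hq1, hq2⟩ := exists_mem_Ioo_of_ae_prod hq hm0 hmw
  have hlt : q.1 < q.2 := hq1.2.trans hq2.1
  have hw1 : w < t₁ := hwu.trans_le (min_le_left _ _)
  have hw2 : w < u := hwu.trans_le (min_le_right _ _)
  have hmem : ∀ t ∈ Icc q.1 q.2, t ∈ Ioo t₀ u := fun t ht =>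
    ⟨hq1.1.trans_le ht.1, ht.2.trans_lt (hq2.2.trans hw2)⟩
  have key := hq' hq1.1 hlt (hq2.2.trans hw1)
  have h3 : (q.2 - q.1) * (k t₀ - ε) ≤ ∫ t in q.1..q.2, k t := by
    have hki : IntervalIntegrable k volume q.1 q.2 := (hk.mono fun t ht => by
      rw [uIcc_of_le hlt.le] at ht
      exact ⟨(hq1.1.trans_le ht.1).le, (ht.2.trans_lt (hq2.2.trans hw1)).le⟩).intervalIntegrable
    have := intervalIntegral.integral_mono_on hlt.le intervalIntegrable_const hki
      (f := fun _ => k t₀ - ε) fun t ht => (hsub (hmem t ht)).1.le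
    rwa [intervalIntegral.integral_const, smul_eq_mul] at this
  have h4 : ((c * (q.2 - q.1).toNNReal : ℝ≥0) : ℝ≥0∞) ≤ ∫⁻ t in Ioo q.1 q.2, σ t := by
    have h5 : ∫⁻ _ in Ioo q.1 q.2, (c : ℝ≥0∞) ≤ ∫⁻ t in Ioo q.1 q.2, σ t :=
      setLIntegral_mono' measurableSet_Ioo fun t ht => (hsub (hmem t (Ioo_subset_Icc_self ht))).2
    rwa [setLIntegral_const, Real.volume_Ioo, ENNReal.ofReal, ← ENNReal.coe_mul] at h5
  rw [setLIntegral_const, Real.volume_Ioo, ENNReal.ofReal, ← ENNReal.coe_mul] at key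
  have h6 : (((q.2 - q.1) * (k t₀ - ε) : ℝ) : EReal)
      + (((c * (q.2 - q.1).toNNReal : ℝ≥0) : ℝ≥0∞) : EReal)
      ≤ (((p * (q.2 - q.1).toNNReal : ℝ≥0) : ℝ≥0∞) : EReal) :=
    (add_le_add (EReal.coe_le_coe_iff.2 h3) (EReal.coe_ennreal_le_coe_ennreal_iff.2 h4)).trans key
  rw [EReal.coe_nnreal_eq_coe_real, EReal.coe_nnreal_eq_coe_real] at h6
  have h7 : (q.2 - q.1) * (k t₀ - ε) + c * (q.2 - q.1) ≤ p * (q.2 - q.1) := by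
    have h8 := EReal.coe_le_coe_iff.1 (by exact_mod_cast h6 : ((_ + _ : ℝ) : EReal) ≤ _)
    simpa [Real.coe_toNNReal _ (sub_nonneg.2 hlt.le)] using h8
  have hpos : 0 < q.2 - q.1 := sub_pos.2 hlt
  have h9 : (q.2 - q.1) * (k t₀ + c) ≤ (q.2 - q.1) * (p + ε) := by linarith
  exact le_of_mul_le_mul_left h9 hpos

/-! ### The potential along continuous fields -/

section Potential

variable {Ω : Set Vec} (h : IsLipschitzDomain Ω) {P : DevL1 Ω → ℝ≥0∞}
include h

lemma IsLipschitzDomain.memLp_one {F : Type*} [NormedAddCommGroup F] {u : Vec → F}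
    (hu : ContinuousOn u (closure Ω)) : MemLp u 1 (volume.restrict Ω) :=
  memLp_one_iff_integrable.2 (h.integrableOn hu)

lemma IsLipschitzDomain.potVal_eq {u : Vec → Dev} (hu : ContinuousOn u (closure Ω)) :
    potVal P u = P ((h.memLp_one hu).toLp u) := dif_pos (h.memLp_one hu)

/-- A field that is continuous on the closed cylinder is continuous in time with values in L¹, so
the lower semicontinuity of P applies along it. -/
lemma IsLipschitzDomain.eventually_lt_potVal (hP : LowerSemicontinuous P) {a b t₀ : ℝ}
    {u : ℝ × Vec → Dev} (hu : ContinuousOn u (Icc a b ×ˢ closure Ω)) (ht₀ : t₀ ∈ Icc a b) {c : ℝ≥0∞}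
    (hc : c < potVal P fun x => u (t₀, x)) :
    ∀ᶠ t in 𝓝[Icc a b] t₀, c < potVal P fun x => u (t, x) := by
  have h0 := continuousOn_slice_time hu ht₀
  rw [h.potVal_eq h0] at hc
  obtain ⟨r, hr, hball⟩ := Metric.eventually_nhds_iff.1 (hP _ c hc)
  have hg : ContinuousOn (fun p : ℝ × Vec => ‖u p - u (t₀, p.2)‖) (Icc a b ×ˢ closure Ω) :=
    (hu.sub (h0.comp continuousOn_snd fun p hp => hp.2)).norm
  have hcont := (h.continuousOn_integral hg) t₀ ht₀
  have hlt : ∀ᶠ t in 𝓝[Icc a b] t₀, ∫ x in Ω, ‖u (t, x) - u (t₀, x)‖ < r := by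
    refine hcont.eventually (gt_mem_nhds ?_)
    simpa using hr
  filter_upwards [hlt, self_mem_nhdsWithin] with t ht htm
  have h1 := continuousOn_slice_time hu htm
  rw [h.potVal_eq h1]
  apply hball
  rw [dist_eq_norm, ← MemLp.toLp_sub, Lp.norm_toLp, eLpNorm_one_eq_lintegral_enorm,
    ← integral_norm_eq_lintegral_enorm ((h.memLp_one h1).sub (h.memLp_one h0)).1]
  exact ht

end Potential

/-! ### The inequality at a fixed time and at the initial time -/

namespace Data

variable {d : Data}

lemma strainField_congr (v : ℝ → Vec → Vec) (E dE : ℝ → Vec → Sym) {Ψ Ψ' : ℝ → Vec → Sym}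
    {p : ℝ × Vec} (hp : Ψ p.1 = Ψ' p.1) : d.strainField v E dE Ψ p = d.strainField v E dE Ψ' p := by
  simp only [strainField, hp]

namespace IsRegular

variable {v dv : ℝ → Vec → Vec} {E dE : ℝ → Vec → Sym} (h : d.IsRegular v dv E dE)
include h

/-- The stationary density at time `t`. -/
lemma continuousOn_coreField {ψ : ℝ → Vec → Vec} (hψ : IsTestFunction d.Ω d.T ψ) {Φ : Vec → Sym}
    (hΦ : ContDiffOn ℝ 1 Φ (closure d.Ω)) {a b : ℝ} (ha : 0 ≤ a) (hb : b < d.T) :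
    ContinuousOn (d.coreField v dv E dE (d.forceField v dv E) ψ fun _ => Φ)
      (Icc a b ×ˢ closure d.Ω) := by
  have hs : Icc a b ⊆ Ico 0 d.T := fun t ht => ⟨ha.trans ht.1, ht.2.trans_lt hb⟩
  have hs' := hs.trans Ico_subset_Icc_self
  have hp : Icc a b ×ˢ closure d.Ω ⊆ Ico 0 d.T ×ˢ closure d.Ω := Set.prod_mono hs subset_rfl
  have hp' : Icc a b ×ˢ closure d.Ω ⊆ Icc 0 d.T ×ˢ closure d.Ω := Set.prod_mono hs' subset_rfl
  have hψc := hψ.continuousOn.mono hp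
  have hmaps : MapsTo Prod.snd (Icc a b ×ˢ closure d.Ω) (closure d.Ω) := fun p hp => hp.2
  have h1 : ContinuousOn (fun p : ℝ × Vec => Φ p.2) (Icc a b ×ˢ closure d.Ω) :=
    hΦ.continuousOn.comp continuousOn_snd hmaps
  have h2 : ContinuousOn (fun p : ℝ × Vec => fderivWithin ℝ Φ (closure d.Ω) p.2)
      (Icc a b ×ˢ closure d.Ω) :=
    (h.standing.domain.continuousOn_fderivWithin hΦ le_rfl).comp continuousOn_snd hmaps
  exact (((h.continuousOn_baseField.mono hp').add (h.continuousOn_momField hs' hψc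
    ((hψ.continuousOn_fderivWithin h.uniqueDiffOn).mono hp))).add
    (h.continuousOn_strainField hs' h1 h2)).add ((h.continuousOn_forceField.mono hp').inner (𝕜 := ℝ)
      (hψc.sub (h.v_mem.continuousOn.mono hp')))

/-- While the cutoff equals one, the strain test is constant in time; by the momentum equation f may
be replaced by `forceField`. The resulting integrand is continuous in time although f is merely
integrable, which makes localization at every time possible. -/
lemma integral_coreField_cutoff (hw : d.IsWeakSolution v E) {ψ : ℝ → Vec → Vec}
    (hψ : IsTestFunction d.Ω d.T ψ) {Φ : Vec → Sym} (hΦ : ContDiffOn ℝ 1 Φ (closure d.Ω))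
    {t₀ a b : ℝ} (h0 : t₀ < d.T) (ha : 0 ≤ a) (hab : a ≤ b)
    (hb : 2 * b ≤ t₀ + (t₀ + d.T) / 2) :
    ∫ p, d.coreField v dv E dE d.f ψ (fun t x => timeCutoff t₀ ((t₀ + d.T) / 2) t • Φ x) p
      ∂(slab d.Ω a b) =
    ∫ t in a..b, ∫ x in d.Ω,
      d.coreField v dv E dE (d.forceField v dv E) ψ (fun _ => Φ) (t, x) := by
  have hΩ := h.standing.domain
  have hbT : b < d.T := by linarith
  rw [intervalIntegral_eq_slab hab
    (hΩ.integrable_slab (h.continuousOn_coreField hψ hΦ ha hbT))]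
  apply integral_congr_ae
  have hf : ∀ᵐ p ∂(slab d.Ω a b), d.f p.1 p.2 = d.forceField v dv E p.1 p.2 :=
    ae_mono (slab_le_cyl d.Ω ha hbT) (h.force_eq_ae hw)
  have hmem : ∀ᵐ p ∂(slab d.Ω a b), p ∈ Ioc a b ×ˢ d.Ω := by
    rw [slab_eq]
    exact ae_restrict_mem (measurableSet_Ioc.prod hΩ.isOpen.measurableSet)
  filter_upwards [hf, hmem] with p hp hpm
  have hone : timeCutoff t₀ ((t₀ + d.T) / 2) p.1 = 1 :=
    timeCutoff_eq_one (by linarith) (by linarith [hpm.1.2])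
  have hΨ : (fun x => timeCutoff t₀ ((t₀ + d.T) / 2) p.1 • Φ x) = Φ := by
    simp only [hone, one_smul]
  rw [coreField, coreField, hp, strainField_congr v E dE (p := p) (Ψ' := fun _ => Φ) hΨ]

/-- The weak inequality at a fixed time. -/
lemma stationary_le (hw : d.IsWeakSolution v E) {ψ : ℝ → Vec → Vec} (hψ : d.IsVelocityTest ψ)
    {Φ : Vec → Sym} (hΦ : ContDiffOn ℝ 1 Φ (closure d.Ω)) {t₀ : ℝ} (ht₀ : t₀ ∈ Ico 0 d.T)
    (hfin : potVal d.P (fun x => dev (Φ x)) ≠ ⊤) :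
    d.stressPot E t₀ ≠ ⊤ ∧
    (∫ x in d.Ω, d.coreField v dv E dE (d.forceField v dv E) ψ (fun _ => Φ) (t₀, x))
      + (d.stressPot E t₀).toReal ≤ (potVal d.P fun x => dev (Φ x)).toReal := by
  have hΩ := h.standing.domain
  -- The cutoff runs from t₀ to (t₀ + T)/2 and is guaranteed to equal one up to the midpoint, which
  -- is t₁.
  set t₁ := t₀ + (d.T - t₀) / 4 with ht₁
  have h01 : t₀ < t₁ := by linarith [ht₀.2]
  have h1T : t₁ < d.T := by linarith [ht₀.2]
  obtain ⟨p, hp⟩ : ∃ p : ℝ≥0, potVal d.P (fun x => dev (Φ x)) = p :=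
    ⟨_, (ENNReal.coe_toNNReal hfin).symm⟩
  set k : ℝ → ℝ := fun t => ∫ x in d.Ω,
    d.coreField v dv E dE (d.forceField v dv E) ψ (fun _ => Φ) (t, x) with hk
  have hkc : ContinuousOn k (Icc t₀ t₁) :=
    hΩ.continuousOn_integral (h.continuousOn_coreField hψ.1 hΦ ht₀.1 h1T)
  have hone : ∀ t, t ≤ t₁ → timeCutoff t₀ ((t₀ + d.T) / 2) t = 1 := fun t ht =>
    timeCutoff_eq_one (by linarith [ht₀.2]) (by linarith)
  have hq : ∀ᵐ q : ℝ × ℝ, t₀ < q.1 → q.1 < q.2 → q.2 < t₁ →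
      ((∫ t in q.1..q.2, k t : ℝ) : EReal)
        + ((∫⁻ t in Ioo q.1 q.2, d.stressPot E t : ℝ≥0∞) : EReal)
        ≤ ((∫⁻ _ in Ioo q.1 q.2, (p : ℝ≥0∞) : ℝ≥0∞) : EReal) := by
    filter_upwards [(h.reduced hw hψ (isTestFunction_timeCutoff
      (contDiffOn_uncurry_const hΦ (Icc 0 d.T)) ht₀.2)).1] with q hq hq0 hq1 hq2
    have key := hq (ht₀.1.trans_lt hq0) hq1 (hq2.trans h1T)
    rw [h.integral_coreField_cutoff hw hψ.1 hΦ ht₀.2 (ht₀.1.trans hq0.le) hq1.le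
      (by linarith)] at key
    refine key.trans (le_of_eq ?_)
    congr 1
    refine setLIntegral_congr_fun measurableSet_Ioo fun t ht => ?_
    simp only [hone t (ht.2.le.trans hq2.le), one_smul, hp]
  have hmain : ∀ c : ℝ≥0, (∀ᶠ t in 𝓝[>] t₀, (c : ℝ≥0∞) ≤ d.stressPot E t) → k t₀ + c ≤ p :=
    fun c hc => add_le_of_ae_integral_le h01 hkc hq hc
  have hk0 : k t₀ ≤ p := by simpa using hmain 0 (by simp)
  -- Every c below the potential at t₀ is also below it shortly afterwards, hence c ≤ p - k(t₀). The
  -- supremum over c gives finiteness and the inequality at once.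
  have hle : d.stressPot E t₀ ≤ ENNReal.ofReal (p - k t₀) := by
    refine ENNReal.le_of_forall_nnreal_lt fun c hc => ?_
    have hev := hΩ.eventually_lt_potVal h.standing.potential.lsc
      (continuous_dev.comp_continuousOn h.continuousOn_stress) (Ico_subset_Icc_self ht₀) hc
    have hfil : 𝓝[>] t₀ ≤ 𝓝[Icc 0 d.T] t₀ := nhdsWithin_le_of_mem
      (mem_of_superset (Ioc_mem_nhdsGT ht₀.2) fun t ht => ⟨ht₀.1.trans ht.1.le, ht.2⟩)
    have := hmain c (((hev.filter_mono hfil)).mono fun t ht => ht.le)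
    rw [ENNReal.le_ofReal_iff_toReal_le ENNReal.coe_ne_top (by linarith)]
    simp only [ENNReal.coe_toReal]
    linarith
  have hne : d.stressPot E t₀ ≠ ⊤ := ne_top_of_le_ne_top ENNReal.ofReal_ne_top hle
  refine ⟨hne, ?_⟩
  rw [ENNReal.le_ofReal_iff_toReal_le hne (by linarith)] at hle
  rw [hp, ENNReal.coe_toReal]
  linarith

/-- The weak inequality at the initial time. -/
lemma energyPairing_initial_le (hw : d.IsWeakSolution v E) {ψ : ℝ → Vec → Vec}
    (hψ : d.IsVelocityTest ψ) {Φ : Vec → Sym} (hΦ : ContDiffOn ℝ 1 Φ (closure d.Ω))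
    (hfin : potVal d.P (fun x => dev (Φ x)) ≠ ⊤) :
    d.energyPairing (v 0) (E 0) (ψ 0) Φ ≤ d.energyPairing d.v₀ d.E₀ (ψ 0) Φ := by
  have hΩ := h.standing.domain
  have hT := h.standing.T_pos
  set t₁ := d.T / 4 with ht₁
  have h1T : t₁ < d.T := by linarith
  obtain ⟨p, hp⟩ : ∃ p : ℝ≥0, potVal d.P (fun x => dev (Φ x)) = p :=
    ⟨_, (ENNReal.coe_toNNReal hfin).symm⟩
  set k : ℝ → ℝ := fun t => ∫ x in d.Ω,
    d.coreField v dv E dE (d.forceField v dv E) ψ (fun _ => Φ) (t, x) with hk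
  have hkc : ContinuousOn k (Icc 0 t₁) :=
    hΩ.continuousOn_integral (h.continuousOn_coreField hψ.1 hΦ le_rfl h1T)
  obtain ⟨C, hC⟩ := isCompact_Icc.exists_bound_of_continuousOn hkc
  have hC0 : 0 ≤ C := (norm_nonneg _).trans (hC 0 ⟨le_rfl, by positivity⟩)
  have hone : ∀ t, t ≤ t₁ → timeCutoff 0 ((0 + d.T) / 2) t = 1 := fun t ht =>
    timeCutoff_eq_one (by linarith) (by linarith)
  rw [← sub_nonpos]
  set J := d.energyPairing (v 0) (E 0) (ψ 0) Φ - d.energyPairing d.v₀ d.E₀ (ψ 0) Φ with hJ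
  -- The integrals over (0, t) are of order t, so the jump J is at most (C + p) t for almost every
  -- small t, and therefore nonpositive.
  have hq : ∀ᵐ t : ℝ, 0 < t → t < t₁ → J ≤ (C + p) * t := by
    filter_upwards [(h.reduced hw hψ (isTestFunction_timeCutoff
      (contDiffOn_uncurry_const hΦ (Icc 0 d.T)) hT)).2] with t ht ht0 htt
    have key := ht ht0 (htt.trans h1T)
    rw [h.integral_coreField_cutoff hw hψ.1 hΦ hT le_rfl ht0.le (by linarith)] at key
    have e1 : (fun x => timeCutoff 0 ((0 + d.T) / 2) 0 • Φ x) = Φ := by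
      simp only [hone 0 (by positivity), one_smul]
    have e2 : ∫⁻ τ in Ioo 0 t, potVal d.P (fun x => dev (timeCutoff 0 ((0 + d.T) / 2) τ • Φ x))
        = ((p * t.toNNReal : ℝ≥0) : ℝ≥0∞) := by
      have e3 : ∫⁻ τ in Ioo 0 t, potVal d.P (fun x => dev (timeCutoff 0 ((0 + d.T) / 2) τ • Φ x))
          = ∫⁻ _ in Ioo 0 t, (p : ℝ≥0∞) :=
        setLIntegral_congr_fun measurableSet_Ioo fun τ hτ => by
          simp only [hone τ (hτ.2.le.trans htt.le), one_smul, hp]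
      rw [e3, setLIntegral_const, Real.volume_Ioo, ENNReal.ofReal, ← ENNReal.coe_mul, sub_zero]
    rw [e1, e2, EReal.coe_nnreal_eq_coe_real] at key
    have h1 := EReal_coe_le_of_add_le key
    rw [NNReal.coe_mul, Real.coe_toNNReal t ht0.le] at h1
    have h2 : ‖∫ τ in 0..t, k τ‖ ≤ C * |t - 0| :=
      intervalIntegral.norm_integral_le_of_norm_le_const fun τ hτ => by
        rw [uIoc_of_le ht0.le] at hτ
        exact hC τ ⟨hτ.1.le, hτ.2.trans htt.le⟩
    rw [sub_zero, abs_of_pos ht0, Real.norm_eq_abs] at h2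
    have h3 := neg_le_of_abs_le h2
    linarith
  refine le_of_forall_pos_le_add fun ε hε => ?_
  have hm : 0 < min t₁ (ε / (C + p + 1)) := by
    have : (0 : ℝ) ≤ p := p.2
    positivity
  obtain ⟨t, ht, ht'⟩ := (Measure.dense_of_ae hq).exists_mem_open isOpen_Ioo (nonempty_Ioo.2 hm)
  have hp0 : (0 : ℝ) ≤ p := p.2
  have h1 := ht ht'.1 (ht'.2.trans_le (min_le_left _ _))
  have h2 := ht'.2.trans_le (min_le_right _ _)
  rw [lt_div_iff₀ (by positivity)] at h2
  nlinarith [ht'.1]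

end IsRegular

end Data

end ViscoPlast
end

noncomputable section

namespace ViscoPlast

/-! ### Traces of continuous functions -/

/-- If u(x) ≠ g, then |u - g| stays above |u(x) - g|/2 near x by continuity. The balls meet Ω in
sets of positive finite measure, so the averages could not tend to zero. -/
lemma HasTraceAt.eq_of_continuousOn {Ω : Set Vec} (hΩ : IsOpen Ω) {u : Vec → Vec}
    (hu : ContinuousOn u (closure Ω)) {x g : Vec} (hx : x ∈ closure Ω) (h : HasTraceAt Ω u x g) :
    u x = g := by
  by_contra hne
  have hpos : 0 < ‖u x - g‖ := norm_pos_iff.2 (sub_ne_zero.2 hne)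
  have hc : ContinuousWithinAt (fun y => ‖u y - g‖) (closure Ω) x :=
    ((hu x hx).sub continuousWithinAt_const).norm
  have h1 : ∀ᶠ y in 𝓝[closure Ω] x, ‖u x - g‖ / 2 < ‖u y - g‖ :=
    hc.eventually (lt_mem_nhds (half_lt_self hpos))
  obtain ⟨R, hR, hball⟩ := Metric.mem_nhdsWithin_iff.1 h1
  have h2 : ∀ᶠ r in 𝓝[>] (0 : ℝ), ENNReal.ofReal (‖u x - g‖ / 2) ≤
      ⨍⁻ y in Metric.ball x r ∩ Ω, ‖u y - g‖ₑ ∂volume := by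
    filter_upwards [Ioo_mem_nhdsGT hR] with r hr
    have hm : MeasurableSet (Metric.ball x r ∩ Ω) :=
      Metric.isOpen_ball.measurableSet.inter hΩ.measurableSet
    have hvol : volume (Metric.ball x r ∩ Ω) ≠ 0 := by
      obtain ⟨y, hy, hy'⟩ := mem_closure_iff.1 hx _ Metric.isOpen_ball (Metric.mem_ball_self hr.1)
      exact ((Metric.isOpen_ball.inter hΩ).measure_pos volume ⟨y, hy, hy'⟩).ne'
    have hfin : volume (Metric.ball x r ∩ Ω) ≠ ⊤ :=
      measure_ne_top_of_subset inter_subset_left measure_ball_lt_top.ne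
    rw [setLAverage_eq, ENNReal.le_div_iff_mul_le (Or.inl hvol) (Or.inl hfin),
      ← setLIntegral_const]
    refine setLIntegral_mono' hm fun y hy => ?_
    rw [← ofReal_norm]
    exact ENNReal.ofReal_le_ofReal
      (hball ⟨Metric.ball_subset_ball hr.2.le hy.1, subset_closure hy.2⟩).le
  have h3 := ge_of_tendsto h h2
  rw [nonpos_iff_eq_zero, ENNReal.ofReal_eq_zero] at h3
  linarith

/-- Boundary conditions given at almost every time pass to every time along such a sequence, by
continuity of v. -/
lemma exists_seq_tendsto_of_ae {T t : ℝ} {p : ℝ → Prop} (hT : 0 < T)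
    (hp : ∀ᵐ t ∂(volume.restrict (Ioo 0 T)), p t) (ht : t ∈ Icc 0 T) :
    ∃ u : ℕ → ℝ, (∀ n, u n ∈ Ioo 0 T ∧ p (u n)) ∧ Tendsto u atTop (𝓝 t) := by
  rw [ae_restrict_iff' measurableSet_Ioo] at hp
  have h1 := (Measure.dense_of_ae hp).open_subset_closure_inter (isOpen_Ioo (a := 0) (b := T))
  have h2 : t ∈ closure (Ioo 0 T ∩ {t | t ∈ Ioo 0 T → p t}) := by
    rw [← closure_Ioo hT.ne] at ht
    exact closure_minimal h1 isClosed_closure ht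
  obtain ⟨u, hu, hlim⟩ := mem_closure_iff_seq_limit.1 h2
  exact ⟨u, fun n => ⟨(hu n).1, (hu n).2 (hu n).1⟩, hlim⟩

/-! ### Localization at the boundary -/

/-- After multiplication by r⁻² the gradient term tends to a nonzero multiple of the normal
component of F and the other term to zero. So a weak identity for all small bumps at x has a
pointwise boundary condition as its consequence. -/
lemma IsLipschitzDomain.inner_eq_zero_of_flux {Ω : Set Vec} (h : IsLipschitzDomain Ω) {x n : Vec}
    (hx : x ∈ closure Ω) (hn : IsOuterNormal Ω x n) {F : Vec → Vec} {g : Vec → ℝ}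
    (hF : ContinuousOn F (closure Ω)) (hg : ContinuousOn g (closure Ω))
    (hz : ∀ᶠ r in 𝓝[>] (0 : ℝ),
      ∫ y in Ω, (fderiv ℝ (bumpAt x r) y (F y) + bumpAt x r y * g y) = 0) :
    ⟪F x, n⟫ = 0 := by
  obtain ⟨C, hC⟩ := h.isCompact_closure.exists_bound_of_continuousOn hg
  have h1 := h.tendsto_bump_flux hx hn hF
  have h2 := tendsto_bump_lower h x (g := g) (C := C) fun y hy => hC y (subset_closure hy)
  have h3 := h1.add h2
  have h4 : (fun r : ℝ => (r⁻¹) ^ 2 * (∫ y in Ω, fderiv ℝ (bumpAt x r) y (F y))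
      + (r⁻¹) ^ 2 * ∫ y in Ω, bumpAt x r y * g y) =ᶠ[𝓝[>] 0] fun _ => 0 := by
    filter_upwards [hz] with r hr
    have hb : ContDiff ℝ 1 (bumpAt x r) := contDiff_bumpAt (n := 1) x r
    have i1 : IntegrableOn (fun y => fderiv ℝ (bumpAt x r) y (F y)) Ω :=
      h.integrableOn ((hb.continuous_fderiv (by norm_num)).continuousOn.clm_apply hF)
    have i2 : IntegrableOn (fun y => bumpAt x r y * g y) Ω :=
      h.integrableOn (hb.continuous.continuousOn.mul hg)
    rw [← mul_add, ← integral_add i1 i2, hr, mul_zero]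
  have h5 := tendsto_nhds_unique (h3.congr' h4) tendsto_const_nhds
  rw [add_zero] at h5
  exact (mul_eq_zero.1 h5).resolve_left (halfSpaceFlux_pos hn.1).ne'

/-- The definition speaks of almost every boundary point. The divergence theorem, applied to bumps
times F, upgrades this to every point that has an outer normal. -/
lemma IsTangentialField.inner_eq_zero {Ω : Set Vec} {F : Vec → Vec} (hF : IsTangentialField Ω F)
    (h : IsLipschitzDomain Ω) {x n : Vec} (hx : x ∈ closure Ω) (hn : IsOuterNormal Ω x n) :
    ⟪F x, n⟫ = 0 := by
  refine h.inner_eq_zero_of_flux hx hn hF.1.continuousOn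
    (continuous_divg.comp_continuousOn (h.continuousOn_fderivWithin hF.1 le_rfl))
    (Eventually.of_forall fun r => ?_)
  have hb : ContDiff ℝ 1 (bumpAt x r) := contDiff_bumpAt (n := 1) x r
  rw [← h.integral_divg_eq_zero (hF.smul hb.contDiffOn)]
  refine setIntegral_congr_fun h.isOpen.measurableSet fun y hy => ?_
  have h1 := (hb.differentiable (by norm_num) y).hasFDerivAt
  have h2 := h.hasFDerivAt hF.1 hy
  have h3 := divg_fderiv_smul h1 h2
  change _ = divg (fderivWithin ℝ (fun y => bumpAt x r y • F y) (closure Ω) y)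
  rw [fderivWithin_of_mem_nhds (f := fun y => bumpAt x r y • F y) (h.closure_mem_nhds hy), h3]
  simp only [Function.comp_apply]
  ring

/-! ### The boundary conditions of the velocity at every time -/

namespace Data

namespace IsRegular

variable {d : Data} {v dv : ℝ → Vec → Vec} {E dE : ℝ → Vec → Sym} (h : d.IsRegular v dv E dE)
include h

lemma tendsto_v {t : ℝ} (ht : t ∈ Icc 0 d.T) {x : Vec} (hx : x ∈ closure d.Ω) {u : ℕ → ℝ}
    (hu : ∀ n, u n ∈ Icc 0 d.T) (hlim : Tendsto u atTop (𝓝 t)) :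
    Tendsto (fun n => v (u n) x) atTop (𝓝 (v t x)) :=
  ((continuousOn_slice_space h.v_mem.continuousOn hx) t ht).tendsto.comp
    (tendsto_nhdsWithin_iff.2 ⟨hlim, Eventually.of_forall hu⟩)

/-- The exceptional null set depends on the time. Hence the sequence of times is fixed first and its
countably many null sets are discarded together. -/
lemma noslip (hw : d.IsWeakSolution v E) {t : ℝ} (ht : t ∈ Icc 0 d.T) :
    ∀ᵐ x ∂(surf.restrict d.ΓD), v t x = 0 := by
  obtain ⟨-, -, -, -, -, -, -, -, -, hD, -, -⟩ := hw
  obtain ⟨u, hu, hlim⟩ := exists_seq_tendsto_of_ae h.standing.T_pos hD ht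
  filter_upwards [ae_all_iff.2 fun n => (hu n).2, ae_restrict_mem h.standing.ΓD_measurable]
    with x hx hxD
  have hxc := frontier_subset_closure (h.standing.ΓD_subset hxD)
  have hu' : ∀ n, u n ∈ Icc 0 d.T := fun n => Ioo_subset_Icc_self (hu n).1
  refine tendsto_nhds_unique (h.tendsto_v ht hxc hu' hlim) ?_
  refine tendsto_const_nhds.congr fun n => ?_
  exact ((hx n).eq_of_continuousOn h.standing.domain.isOpen
    (h.contDiffOn_v (hu' n)).continuousOn hxc).symm

lemma slip (hw : d.IsWeakSolution v E) {t : ℝ} (ht : t ∈ Icc 0 d.T) :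
    ∀ᵐ x ∂(surf.restrict d.ΓN), ∀ n, IsOuterNormal d.Ω x n → ⟪v t x, n⟫ = 0 := by
  obtain ⟨-, -, -, -, -, -, -, -, -, -, hN, -⟩ := hw
  obtain ⟨u, hu, hlim⟩ := exists_seq_tendsto_of_ae h.standing.T_pos hN ht
  filter_upwards [ae_all_iff.2 fun n => (hu n).2, ae_restrict_mem h.standing.measurableSet_ΓN]
    with x hx hxN n hn
  have hxc := frontier_subset_closure hxN.1
  have hu' : ∀ n, u n ∈ Icc 0 d.T := fun n => Ioo_subset_Icc_self (hu n).1
  refine tendsto_nhds_unique ((h.tendsto_v ht hxc hu' hlim).inner tendsto_const_nhds) ?_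
  refine tendsto_const_nhds.congr fun k => ?_
  obtain ⟨g, hg, hgn⟩ := hx k
  rw [hg.eq_of_continuousOn h.standing.domain.isOpen
    (h.contDiffOn_v (hu' k)).continuousOn hxc, hgn n hn]

lemma isTangentialField (hw : d.IsWeakSolution v E) {t : ℝ} (ht : t ∈ Icc 0 d.T) :
    IsTangentialField d.Ω (v t) := by
  refine ⟨h.contDiffOn_v ht, ?_⟩
  have hsplit : frontier d.Ω = d.ΓD ∪ d.ΓN := (union_sdiff_cancel h.standing.ΓD_subset).symm
  rw [hsplit, ae_restrict_union_iff]
  refine ⟨?_, h.slip hw ht⟩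
  filter_upwards [h.noslip hw ht] with x hx n _
  rw [hx, inner_zero_left]

end IsRegular

end Data

end ViscoPlast
end

/-! ### The velocity as test function -/

noncomputable section

namespace ViscoPlast

namespace Data

variable {d : Data}

lemma momField_congr (v dv : ℝ → Vec → Vec) (E : ℝ → Vec → Sym) {ψ ψ' : ℝ → Vec → Vec}
    {p : ℝ × Vec} (hp : ψ p.1 = ψ' p.1) : d.momField v dv E ψ p = d.momField v dv E ψ' p := by
  simp only [momField, hp]

/-- The strain-rate equation without plastic and diffusive terms. -/
def strainDefect (d : Data) (v : ℝ → Vec → Vec) (E dE : ℝ → Vec → Sym) (t : ℝ) (x : Vec) : Sym :=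
  dE t x + fderivWithin ℝ (E t) (closure d.Ω) x (v t x)
    + corotSym (E t x) (fderivWithin ℝ (v t) (closure d.Ω) x)
    - symGrad (fderivWithin ℝ (v t) (closure d.Ω) x)

namespace IsRegular

variable {v dv : ℝ → Vec → Vec} {E dE : ℝ → Vec → Sym} (h : d.IsRegular v dv E dE)
include h

lemma memC1C2_v : MemC1C2 d.Ω d.T v := ⟨h.v_mem, dv, h.dv_mem, h.v_deriv⟩

lemma isVelocityTest_cutoff (hw : d.IsWeakSolution v E) {τ : ℝ} (hτ : τ < d.T) :
    d.IsVelocityTest fun t x => timeCutoff τ ((τ + d.T) / 2) t • v t x := by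
  refine ⟨isTestFunction_timeCutoff (h.memC1C2_v.contDiffOn h.uniqueDiffOn h.standing.T_pos) hτ,
    fun t ht => ?_, fun t ht => ?_⟩
  · filter_upwards [h.noslip hw (Ioo_subset_Icc_self ht)] with x hx
    rw [hx, smul_zero]
  · filter_upwards [h.slip hw (Ioo_subset_Icc_self ht)] with x hx n hn
    rw [real_inner_smul_left, hx n hn, mul_zero]

lemma continuousOn_strainDefect {t : ℝ} (ht : t ∈ Icc 0 d.T) :
    ContinuousOn (d.strainDefect v E dE t) (closure d.Ω) := by
  have hΩ := h.standing.domain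
  have h1 := continuousOn_slice_time h.dE_mem.continuousOn ht
  have h2 := continuousOn_slice_time h.v_mem.continuousOn ht
  have h3 := hΩ.continuousOn_fderivWithin ((h.contDiffOn_E ht).of_le (by norm_num)) le_rfl
  have h4 := hΩ.continuousOn_fderivWithin (h.contDiffOn_v ht) le_rfl
  exact ((h1.add (h3.clm_apply h2)).add ((h.contDiffOn_E ht).continuousOn.corotSym h4)).sub
    (continuous_symGrad.comp_continuousOn h4)

/-- With the velocity as a test function, the density of the weak inequality is the one of the
strain-rate equation up to a divergence. -/
lemma coreField_self {t : ℝ} (ht : t ∈ Icc 0 d.T) {Φ : Vec → Sym}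
    (hΦ : ContDiffOn ℝ 1 Φ (closure d.Ω)) {x : Vec} (hx : x ∈ d.Ω) :
    d.coreField v dv E dE (d.forceField v dv E) v (fun _ => Φ) (t, x) =
      (⟪d.strainDefect v E dE t x, d.stress E t x - Φ x⟫
        + d.γ * tripleDot (fderivWithin ℝ (d.stress E t) (closure d.Ω) x)
          (fderivWithin ℝ (d.stress E t) (closure d.Ω) x - fderivWithin ℝ Φ (closure d.Ω) x))
      + divg (fderivWithin ℝ (fun y => (d.ρ / 2 * ‖v t y‖ ^ 2 - d.φ (E t y) + ⟪E t y, Φ y⟫) • v t y)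
          (closure d.Ω) x) := by
  have hΩ := h.standing.domain
  have h1 := hΩ.hasFDerivAt (h.contDiffOn_v ht) hx
  have h2 := hΩ.hasFDerivAt ((h.contDiffOn_E ht).of_le (by norm_num)) hx
  have h3 := hΩ.hasFDerivAt hΦ hx
  have h4 : HasFDerivAt (fun y => d.φ (E t y))
      ((fderiv ℝ d.φ (E t x)).comp (fderivWithin ℝ (E t) (closure d.Ω) x)) x :=
    ((h.contDiff_φ.differentiable (by norm_num)) _).hasFDerivAt.comp x h2
  have h5 : HasFDerivAt (fun y => d.ρ / 2 * ‖v t y‖ ^ 2 - d.φ (E t y) + ⟪E t y, Φ y⟫) _ x :=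
    ((h1.norm_sq.const_mul (d.ρ / 2)).fun_sub h4).fun_add (h2.inner ℝ h3)
  -- The stress commutes with the strain, so the corotational term disappears when the strain defect
  -- is paired with the stress.
  have h7 := inner_corot_eq_zero (E t x) (d.stress E t x)
    (fderivWithin ℝ (v t) (closure d.Ω) x) (h.standing.energy.commute (E t x))
  -- In the weight, ρ/2 |v|² collects the convective terms, -φ(E) the terms with φ(E) div v and the
  -- transport of the energy, and E : Φ the transport terms of the strain test.
  have h8 : divg (fderivWithin ℝ (fun y => (d.ρ / 2 * ‖v t y‖ ^ 2 - d.φ (E t y) + ⟪E t y, Φ y⟫)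
      • v t y) (closure d.Ω) x) =
      (d.ρ / 2 * ‖v t x‖ ^ 2 - d.φ (E t x) + ⟪E t x, Φ x⟫)
        * divg (fderivWithin ℝ (v t) (closure d.Ω) x)
      + (d.ρ * ⟪v t x, fderivWithin ℝ (v t) (closure d.Ω) x (v t x)⟫
        - fderiv ℝ d.φ (E t x) (fderivWithin ℝ (E t) (closure d.Ω) x (v t x))
        + (⟪E t x, fderivWithin ℝ Φ (closure d.Ω) x (v t x)⟫
          + ⟪fderivWithin ℝ (E t) (closure d.Ω) x (v t x), Φ x⟫)) := by
    rw [fderivWithin_of_mem_nhds (f := fun y => (d.ρ / 2 * ‖v t y‖ ^ 2 - d.φ (E t y)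
      + ⟪E t y, Φ y⟫) • v t y) (hΩ.closure_mem_nhds hx), divg_fderiv_smul h5 h1]
    simp only [two_nsmul, FunLike.coe_add, FunLike.coe_sub, Pi.add_apply, Pi.sub_apply, FunLike.coe_smul,
      Pi.smul_apply, ContinuousLinearMap.comp_apply, ContinuousLinearMap.prod_apply,
      fderivInnerCLM_apply, innerSL_apply_apply, smul_eq_mul]
    ring
  rw [h8]
  have h9 : ⟪d.strainDefect v E dE t x, d.stress E t x - Φ x⟫ =
      ⟪d.stress E t x, dE t x⟫
      + fderiv ℝ d.φ (E t x) (fderivWithin ℝ (E t) (closure d.Ω) x (v t x))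
      - ⟪d.stress E t x, symGrad (fderivWithin ℝ (v t) (closure d.Ω) x)⟫
      - (⟪dE t x, Φ x⟫ + ⟪fderivWithin ℝ (E t) (closure d.Ω) x (v t x), Φ x⟫
        + ⟪corotSym (E t x) (fderivWithin ℝ (v t) (closure d.Ω) x), Φ x⟫
        - ⟪symGrad (fderivWithin ℝ (v t) (closure d.Ω) x), Φ x⟫) := by
    rw [← inner_gradient, inner_sub_right, strainDefect, inner_sub_left, inner_add_left,
      inner_add_left, h7, inner_sub_left, inner_add_left, inner_add_left,
      real_inner_comm (d.stress E t x), real_inner_comm (d.stress E t x),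
      real_inner_comm (d.stress E t x)]
    simp only [stress]
    ring
  rw [h9]
  simp only [coreField, baseField, momField, strainField, baseDensity, momDensity, strainDensity,
    sub_self, inner_zero_right, inner_add_left, tripleDot_sub_right, real_inner_self_eq_norm_sq]
  rw [real_inner_comm (v t x) (dv t x),
    real_inner_comm (E t x) (fderivWithin ℝ Φ (closure d.Ω) x (v t x))]
  simp only [stress]
  ring

/-- The strain-rate inequality at a fixed time. -/
lemma strain_le (hw : d.IsWeakSolution v E) {Φ : Vec → Sym}
    (hΦ : ContDiffOn ℝ 1 Φ (closure d.Ω)) {t : ℝ} (ht : t ∈ Ico 0 d.T)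
    (hfin : potVal d.P (fun x => dev (Φ x)) ≠ ⊤) :
    d.stressPot E t ≠ ⊤ ∧
    (∫ x in d.Ω, (⟪d.strainDefect v E dE t x, d.stress E t x - Φ x⟫
        + d.γ * tripleDot (fderivWithin ℝ (d.stress E t) (closure d.Ω) x)
          (fderivWithin ℝ (d.stress E t) (closure d.Ω) x - fderivWithin ℝ Φ (closure d.Ω) x)))
      + (d.stressPot E t).toReal ≤ (potVal d.P fun x => dev (Φ x)).toReal := by
  have hΩ := h.standing.domain
  have ht' := Ico_subset_Icc_self ht
  obtain ⟨h1, h2⟩ := h.stationary_le hw (h.isVelocityTest_cutoff hw ht.2) hΦ ht hfin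
  refine ⟨h1, ?_⟩
  convert h2 using 2
  have hone : timeCutoff t ((t + d.T) / 2) t = 1 :=
    timeCutoff_eq_one (by linarith [ht.2]) (by linarith [ht.2])
  have hψ : (fun x => timeCutoff t ((t + d.T) / 2) t • v t x) = v t := by
    simp only [hone, one_smul]
  have hθ : ContDiffOn ℝ 1 (fun y => d.ρ / 2 * ‖v t y‖ ^ 2 - d.φ (E t y) + ⟪E t y, Φ y⟫)
      (closure d.Ω) :=
    ((contDiffOn_const.mul ((h.contDiffOn_v ht').norm_sq ℝ)).sub
      ((h.contDiff_φ.of_le (by norm_num)).comp_contDiffOn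
        ((h.contDiffOn_E ht').of_le (by norm_num)))).add
      (((h.contDiffOn_E ht').of_le (by norm_num)).inner ℝ hΦ)
  have hF := (h.isTangentialField hw ht').smul hθ
  have hS := (h.contDiffOn_stress ht').of_le (m := 1) (by norm_num)
  have hDS := hΩ.continuousOn_fderivWithin hS le_rfl
  have i1 : IntegrableOn (fun x => ⟪d.strainDefect v E dE t x, d.stress E t x - Φ x⟫
        + d.γ * tripleDot (fderivWithin ℝ (d.stress E t) (closure d.Ω) x)
          (fderivWithin ℝ (d.stress E t) (closure d.Ω) x - fderivWithin ℝ Φ (closure d.Ω) x)) d.Ω :=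
    hΩ.integrableOn (((h.continuousOn_strainDefect ht').inner (𝕜 := ℝ)
      (hS.continuousOn.sub hΦ.continuousOn)).add ((hDS.tripleDot
        (hDS.sub (hΩ.continuousOn_fderivWithin hΦ le_rfl))).const_mul d.γ))
  have i2 : IntegrableOn (fun x => divg (fderivWithin ℝ (fun y =>
      (d.ρ / 2 * ‖v t y‖ ^ 2 - d.φ (E t y) + ⟪E t y, Φ y⟫) • v t y) (closure d.Ω) x)) d.Ω :=
    hΩ.integrableOn (continuous_divg.comp_continuousOn
      (hΩ.continuousOn_fderivWithin hF.1 le_rfl))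
  -- The divergence from `coreField_self` integrates to zero because a scalar multiple of v is
  -- tangential.
  rw [← add_zero (∫ x in d.Ω, _), ← hΩ.integral_divg_eq_zero hF, ← integral_add i1 i2]
  refine setIntegral_congr_fun hΩ.isOpen.measurableSet fun x hx => ?_
  rw [← h.coreField_self ht' hΦ hx, coreField, coreField,
    momField_congr v dv E (p := (t, x))
      (ψ := fun t' x => timeCutoff t ((t + d.T) / 2) t' • v t' x) (ψ' := v) hψ]
  simp only [hone, one_smul]

end IsRegular

end Data

end ViscoPlast
end

noncomputable section

namespace ViscoPlast

/-! ### The Laplacian and the normal derivative in weak form -/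

section Laplacian

variable {Ω : Set Vec} {S : Vec → Sym}

/-- The Laplacian with derivatives taken within the closure of the domain. -/
def lapWithin (Ω : Set Vec) (S : Vec → Sym) (x : Vec) : Sym :=
  ∑ k, fderivWithin ℝ (fun y => fderivWithin ℝ S (closure Ω) y (unitVec k)) (closure Ω) x (unitVec k)

/-- The vector field with the components `∂ₖS : u`. -/
def gradFlux (Ω : Set Vec) (S u : Vec → Sym) (x : Vec) : Vec :=
  ∑ k, ⟪fderivWithin ℝ S (closure Ω) x (unitVec k), u x⟫ • unitVec k

lemma IsLipschitzDomain.tripleDot_smul_const (h : IsLipschitzDomain Ω)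
    (S : Vec → Sym) {χ : Vec → ℝ} (hχ : ContDiff ℝ 1 χ) (B : Sym)
    {x : Vec} (hx : x ∈ Ω) :
    tripleDot (fderivWithin ℝ S (closure Ω) x) (fderivWithin ℝ (fun y => χ y • B) (closure Ω) x) =
      fderiv ℝ χ x (gradFlux Ω S (fun _ => B) x) := by
  have h1 : fderivWithin ℝ (fun y => χ y • B) (closure Ω) x = (fderiv ℝ χ x).smulRight B := by
    rw [fderivWithin_of_mem_nhds (h.closure_mem_nhds hx)]
    exact ((hχ.differentiable (by norm_num) x).hasFDerivAt.smul_const B).fderiv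
  rw [h1, tripleDot_smulRight, gradFlux, map_sum]
  simp only [map_smul, smul_eq_mul, mul_comm]

variable (h : IsLipschitzDomain Ω) (hS : ContDiffOn ℝ 2 S (closure Ω))
include h hS

lemma IsLipschitzDomain.contDiffOn_partial (k : Fin 3) :
    ContDiffOn ℝ 1 (fun y => fderivWithin ℝ S (closure Ω) y (unitVec k)) (closure Ω) :=
  (hS.fderivWithin h.uniqueDiffOn (m := 1) (by norm_num)).clm_apply contDiffOn_const

lemma IsLipschitzDomain.continuousOn_lapWithin : ContinuousOn (lapWithin Ω S) (closure Ω) := by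
  refine continuousOn_finsetSum _ fun k _ => ?_
  exact (h.continuousOn_fderivWithin (h.contDiffOn_partial hS k) le_rfl).clm_apply
    continuousOn_const

lemma IsLipschitzDomain.contDiffOn_gradFlux {u : Vec → Sym} (hu : ContDiffOn ℝ 1 u (closure Ω)) :
    ContDiffOn ℝ 1 (gradFlux Ω S u) (closure Ω) :=
  ContDiffOn.sum fun k _ => ((h.contDiffOn_partial hS k).inner ℝ hu).smul contDiffOn_const

lemma IsLipschitzDomain.divg_gradFlux {u : Vec → Sym} (hu : ContDiffOn ℝ 1 u (closure Ω)) {x : Vec}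
    (hx : x ∈ Ω) : divg (fderivWithin ℝ (gradFlux Ω S u) (closure Ω) x) =
      ⟪lapWithin Ω S x, u x⟫ + tripleDot (fderivWithin ℝ S (closure Ω) x)
        (fderivWithin ℝ u (closure Ω) x) := by
  have h1 := fun k => h.hasFDerivAt (h.contDiffOn_partial hS k) hx
  have h2 := h.hasFDerivAt hu hx
  have h3 := fun k => ((h1 k).inner ℝ h2).smul_const (unitVec k)
  have h4 : HasFDerivAt (gradFlux Ω S u) _ x := HasFDerivAt.fun_sum fun k (_ : k ∈ Finset.univ) => h3 k
  rw [fderivWithin_of_mem_nhds (h.closure_mem_nhds hx), h4.fderiv]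
  have h5 : ∀ G : Fin 3 → Vec →L[ℝ] Vec, divg (∑ k, G k) = ∑ k, divg (G k) :=
    fun G => map_sum divgL G Finset.univ
  rw [h5]
  simp only [divg_smulRight, ContinuousLinearMap.comp_apply, ContinuousLinearMap.prod_apply,
    fderivInnerCLM_apply, Finset.sum_add_distrib, lapWithin, sum_inner, tripleDot]
  ring

lemma IsLipschitzDomain.integral_tripleDot {u : Vec → Sym} (hu : ContDiffOn ℝ 1 u (closure Ω))
    (h0 : ∀ x ∈ frontier Ω, u x = 0) :
    ∫ x in Ω, (⟪lapWithin Ω S x, u x⟫ + tripleDot (fderivWithin ℝ S (closure Ω) x)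
        (fderivWithin ℝ u (closure Ω) x)) = 0 := by
  rw [← h.integral_divg_eq_zero_of_zero (h.contDiffOn_gradFlux hS hu) fun x hx => by
    simp [gradFlux, h0 x hx]]
  exact setIntegral_congr_fun h.isOpen.measurableSet fun x hx => (h.divg_gradFlux hS hu hx).symm

/-- The natural boundary condition that follows from a weak equation. -/
lemma IsLipschitzDomain.inner_fderivWithin_normal_eq_zero {B : Sym} {g : Vec → ℝ}
    (hg : ContinuousOn g (closure Ω))
    (hz : ∀ χ : Vec → ℝ, ContDiff ℝ ∞ χ → ∫ y in Ω, (χ y * g y + tripleDot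
      (fderivWithin ℝ S (closure Ω) y) (fderivWithin ℝ (fun y => χ y • B) (closure Ω) y)) = 0)
    {x n : Vec} (hx : x ∈ closure Ω) (hn : IsOuterNormal Ω x n) :
    ⟪fderivWithin ℝ S (closure Ω) x n, B⟫ = 0 := by
  have h1 := h.inner_eq_zero_of_flux hx hn
    (h.contDiffOn_gradFlux hS (u := fun _ => B) contDiffOn_const).continuousOn hg
    (Eventually.of_forall fun r => by
      rw [← hz (bumpAt x r) (contDiff_bumpAt (n := ⊤) x r)]
      refine setIntegral_congr_fun h.isOpen.measurableSet fun y hy => ?_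
      rw [h.tripleDot_smul_const S (contDiff_bumpAt (n := 1) x r) B hy, add_comm])
  have h2 : ⟪fderivWithin ℝ S (closure Ω) x n, B⟫ = ⟪gradFlux Ω S (fun _ => B) x, n⟫ := by
    conv_lhs => rw [vec_eq_sum n]
    simp only [map_sum, map_smul, sum_inner, gradFlux, sym_inner_smul_left, real_inner_smul_left]
    refine Finset.sum_congr rfl fun k _ => ?_
    simp [unitVec, EuclideanSpace.inner_single_left, mul_comm]
  rw [h2, h1]

/-- The pointwise equation that follows from a weak equation. -/
lemma IsLipschitzDomain.eq_lapWithin_of_weak {B : Sym} {g : Vec → ℝ}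
    (hg : ContinuousOn g (closure Ω))
    (hz : ∀ χ : Vec → ℝ, ContDiff ℝ ∞ χ → ∫ y in Ω, (χ y * g y + tripleDot
      (fderivWithin ℝ S (closure Ω) y) (fderivWithin ℝ (fun y => χ y • B) (closure Ω) y)) = 0)
    {x : Vec} (hx : x ∈ Ω) : g x = ⟪lapWithin Ω S x, B⟫ := by
  have hl : ContinuousOn (fun y => ⟪lapWithin Ω S y, B⟫) (closure Ω) :=
    (h.continuousOn_lapWithin hS).inner (𝕜 := ℝ) continuousOn_const
  have hae : ∀ᵐ y ∂(volume.restrict Ω), g y - ⟪lapWithin Ω S y, B⟫ = 0 := by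
    rw [ae_restrict_iff' h.isOpen.measurableSet]
    refine h.isOpen.ae_eq_zero_of_integral_contDiff_smul_eq_zero
      (IntegrableOn.locallyIntegrableOn (h.integrableOn (hg.sub hl))) fun χ hχ hχc hχs => ?_
    have hχ0 : ∀ y, y ∉ Ω → χ y = 0 := fun y hy =>
      image_eq_zero_of_notMem_tsupport fun hm => hy (hχs hm)
    have hχ1 : ContDiff ℝ 1 χ := hχ.of_le (by norm_cast)
    rw [← setIntegral_eq_integral_of_forall_compl_eq_zero (s := Ω)
      (fun y hy => by rw [hχ0 y hy, zero_smul])]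
    have hu : ContDiffOn ℝ 1 (fun y => χ y • B) (closure Ω) :=
      (hχ1.smul contDiff_const).contDiffOn
    have e1 := hz χ hχ
    have e2 := h.integral_tripleDot hS hu fun y hy => by
      rw [h.isOpen.frontier_eq] at hy
      rw [hχ0 y hy.2, zero_smul]
    have htd : ContinuousOn (fun y => tripleDot (fderivWithin ℝ S (closure Ω) y)
        (fderivWithin ℝ (fun y => χ y • B) (closure Ω) y)) (closure Ω) :=
      (h.continuousOn_fderivWithin (hS.of_le (by norm_num)) le_rfl).tripleDot
        (h.continuousOn_fderivWithin hu le_rfl)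
    have i1 := h.integrableOn ((hχ1.continuous.continuousOn.mul hg).add htd)
    have i2 := h.integrableOn (((h.continuousOn_lapWithin hS).inner (𝕜 := ℝ)
      hu.continuousOn).add htd)
    have e3 := integral_sub i1 i2
    simp only [Pi.add_apply, Pi.mul_apply] at e3
    rw [e1, e2, sub_zero] at e3
    refine Eq.trans ?_ e3
    refine integral_congr_ae (Eventually.of_forall fun y => ?_)
    simp only [smul_eq_mul, sym_inner_smul_right]
    ring
  have heq := Measure.eqOn_open_of_ae_eq (f := fun y => g y - ⟪lapWithin Ω S y, B⟫)
    (g := fun _ => 0) hae h.isOpen ((hg.sub hl).mono subset_closure) continuousOn_const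
  exact sub_eq_zero.1 (heq hx)

end Laplacian

end ViscoPlast
end

/-! ### Strain-rate inequality: spherical and trace-free tests -/

noncomputable section

namespace ViscoPlast

lemma potVal_eq_of_ae {Ω : Set Vec} (P : DevL1 Ω → ℝ≥0∞) {u : Vec → Dev} {B : DevL1 Ω}
    (hB : ⇑B =ᵐ[volume.restrict Ω] u) : potVal P u = P B := by
  have h1 : MemLp u 1 (volume.restrict Ω) := (memLp_congr_ae hB).1 (Lp.memLp B)
  rw [potVal, dif_pos h1]
  congr 1
  exact Lp.ext (h1.coeFn_toLp.trans hB.symm)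

/-- The functional on `L¹` represented by a bounded field. -/
lemma exists_pairing_of_bound {Ω : Set Vec} {K : Vec → Dev}
    (hKm : AEStronglyMeasurable K (volume.restrict Ω)) {C : ℝ}
    (hC : ∀ᵐ x ∂(volume.restrict Ω), ‖K x‖ ≤ C) :
    (∀ B : DevL1 Ω, IntegrableOn (fun x => ⟪K x, B x⟫) Ω) ∧
    ∃ ℓ : DevL1 Ω →L[ℝ] ℝ, ∀ B : DevL1 Ω, ℓ B = ∫ x in Ω, ⟪K x, B x⟫ := by
  have hbd : ∀ B : DevL1 Ω, ∀ᵐ x ∂(volume.restrict Ω), ‖⟪K x, B x⟫‖ ≤ C * ‖B x‖ := by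
    intro B
    filter_upwards [hC] with x hx
    exact (norm_inner_le_norm _ _).trans (by gcongr)
  have hBi : ∀ B : DevL1 Ω, IntegrableOn (fun x => B x) Ω := fun B => L1.integrable_coeFn B
  have hi : ∀ B : DevL1 Ω, IntegrableOn (fun x => ⟪K x, B x⟫) Ω := fun B =>
    ((hBi B).norm.const_mul C).mono' (hKm.inner (hBi B).1) (hbd B)
  have hadd : ∀ A B : DevL1 Ω, ∫ x in Ω, ⟪K x, (A + B : DevL1 Ω) x⟫ =
      (∫ x in Ω, ⟪K x, A x⟫) + ∫ x in Ω, ⟪K x, B x⟫ := by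
    intro A B
    rw [← integral_add (hi A) (hi B)]
    refine integral_congr_ae ?_
    filter_upwards [Lp.coeFn_add A B] with x hx
    rw [hx, Pi.add_apply, inner_add_right]
  have hsmul : ∀ (c : ℝ) (A : DevL1 Ω), ∫ x in Ω, ⟪K x, (c • A : DevL1 Ω) x⟫ =
      c * ∫ x in Ω, ⟪K x, A x⟫ := by
    intro c A
    rw [← integral_const_mul]
    refine integral_congr_ae ?_
    filter_upwards [Lp.coeFn_smul c A] with x hx
    rw [hx, Pi.smul_apply, dev_inner_smul_right]
  let m : DevL1 Ω →ₗ[ℝ] ℝ :=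
    { toFun := fun B => ∫ x in Ω, ⟪K x, B x⟫
      map_add' := hadd
      map_smul' := hsmul }
  have hm : ∀ B : DevL1 Ω, ‖m B‖ ≤ C * ‖B‖ := by
    intro B
    calc ‖∫ x in Ω, ⟪K x, B x⟫‖ ≤ ∫ x in Ω, C * ‖B x‖ :=
          norm_integral_le_of_norm_le ((hBi B).norm.const_mul C) (hbd B)
      _ = C * ‖B‖ := by rw [integral_const_mul, L1.norm_eq_integral_norm]
  let ℓ : DevL1 Ω →L[ℝ] ℝ :=
    { toLinearMap := m
      cont := AddMonoidHomClass.continuous_of_bound m C hm }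
  exact ⟨hi, ℓ, fun B => rfl⟩

lemma IsLipschitzDomain.exists_pairing {Ω : Set Vec} (h : IsLipschitzDomain Ω) {K : Vec → Dev}
    (hK : ContinuousOn K (closure Ω)) :
    (∀ B : DevL1 Ω, IntegrableOn (fun x => ⟪K x, B x⟫) Ω) ∧
    ∃ ℓ : DevL1 Ω →L[ℝ] ℝ, ∀ B : DevL1 Ω, ℓ B = ∫ x in Ω, ⟪K x, B x⟫ := by
  obtain ⟨C, hC⟩ := h.isCompact_closure.exists_bound_of_continuousOn hK
  refine exists_pairing_of_bound (h.integrableOn hK).1 (C := C) ?_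
  filter_upwards [ae_restrict_mem h.isOpen.measurableSet] with x hx using hC x (subset_closure hx)

namespace Data

variable {d : Data}

/-- The strain-rate equation without plastic term in weak form. -/
def weakStrain (d : Data) (v : ℝ → Vec → Vec) (E dE : ℝ → Vec → Sym) (t : ℝ) (Φ : Vec → Sym) : ℝ :=
  ∫ x in d.Ω, (⟪d.strainDefect v E dE t x, Φ x⟫
    + d.γ * tripleDot (fderivWithin ℝ (d.stress E t) (closure d.Ω) x)
      (fderivWithin ℝ Φ (closure d.Ω) x))

/-- The strain-rate equation without plastic term. -/
def strainResidual (d : Data) (v : ℝ → Vec → Vec) (E dE : ℝ → Vec → Sym) (t : ℝ) (x : Vec) : Sym :=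
  d.strainDefect v E dE t x - d.γ • lapWithin d.Ω (d.stress E t) x

namespace IsRegular

variable {v dv : ℝ → Vec → Vec} {E dE : ℝ → Vec → Sym} (h : d.IsRegular v dv E dE)
include h

lemma continuousOn_weakStrain {t : ℝ} (ht : t ∈ Icc 0 d.T) {Φ : Vec → Sym}
    (hΦ : ContDiffOn ℝ 1 Φ (closure d.Ω)) :
    ContinuousOn (fun x => ⟪d.strainDefect v E dE t x, Φ x⟫
      + d.γ * tripleDot (fderivWithin ℝ (d.stress E t) (closure d.Ω) x)
      (fderivWithin ℝ Φ (closure d.Ω) x)) (closure d.Ω) :=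
  ((h.continuousOn_strainDefect ht).inner (𝕜 := ℝ) hΦ.continuousOn).add
    (((h.standing.domain.continuousOn_fderivWithin ((h.contDiffOn_stress ht).of_le (by norm_num))
      le_rfl).tripleDot (h.standing.domain.continuousOn_fderivWithin hΦ le_rfl)).const_mul d.γ)

lemma weakStrain_sub {t : ℝ} (ht : t ∈ Icc 0 d.T) {Φ Ψ : Vec → Sym}
    (hΦ : ContDiffOn ℝ 1 Φ (closure d.Ω)) (hΨ : ContDiffOn ℝ 1 Ψ (closure d.Ω)) :
    d.weakStrain v E dE t (fun x => Φ x - Ψ x) =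
      d.weakStrain v E dE t Φ - d.weakStrain v E dE t Ψ := by
  have hΩ := h.standing.domain
  rw [weakStrain, weakStrain, weakStrain,
    ← integral_sub (hΩ.integrableOn (h.continuousOn_weakStrain ht hΦ))
      (hΩ.integrableOn (h.continuousOn_weakStrain ht hΨ))]
  refine setIntegral_congr_fun hΩ.isOpen.measurableSet fun x hx => ?_
  have hx' := subset_closure hx
  rw [fderivWithin_fun_sub (h.uniqueDiffOn x hx')
    ((hΦ x hx').differentiableWithinAt (by norm_num))
    ((hΨ x hx').differentiableWithinAt (by norm_num)), tripleDot_sub_right, inner_sub_right]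
  ring

lemma weakStrain_smul {t : ℝ} {Φ : Vec → Sym}
    (hΦ : ContDiffOn ℝ 1 Φ (closure d.Ω)) (c : ℝ) :
    d.weakStrain v E dE t (fun x => c • Φ x) = c * d.weakStrain v E dE t Φ := by
  have hΩ := h.standing.domain
  rw [weakStrain, weakStrain, ← integral_const_mul]
  refine setIntegral_congr_fun hΩ.isOpen.measurableSet fun x hx => ?_
  have hx' := subset_closure hx
  rw [fderivWithin_fun_const_smul (h.uniqueDiffOn x hx')
    ((hΦ x hx').differentiableWithinAt (by norm_num)), tripleDot_smul_right, sym_inner_smul_right]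
  ring

lemma weakStrain_le (hw : d.IsWeakSolution v E) {Φ : Vec → Sym}
    (hΦ : ContDiffOn ℝ 1 Φ (closure d.Ω)) {t : ℝ} (ht : t ∈ Ico 0 d.T)
    (hfin : potVal d.P (fun x => dev (Φ x)) ≠ ⊤) :
    d.weakStrain v E dE t (fun x => d.stress E t x - Φ x) + (d.stressPot E t).toReal
      ≤ (potVal d.P fun x => dev (Φ x)).toReal := by
  have hΩ := h.standing.domain
  have hS := (h.contDiffOn_stress (Ico_subset_Icc_self ht)).of_le (m := 1) (by norm_num)
  refine le_trans (le_of_eq ?_) (h.strain_le hw hΦ ht hfin).2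
  congr 1
  refine setIntegral_congr_fun hΩ.isOpen.measurableSet fun x hx => ?_
  have hx' := subset_closure hx
  rw [fderivWithin_fun_sub (h.uniqueDiffOn x hx')
    ((hS x hx').differentiableWithinAt (by norm_num))
    ((hΦ x hx').differentiableWithinAt (by norm_num))]

lemma potVal_dev_zero : potVal d.P (fun _ => dev 0) = 0 := by
  rw [show dev 0 = 0 from devL.map_zero, potVal_zero, h.standing.potential.zero]

lemma stressPot_ne_top (hw : d.IsWeakSolution v E) {t : ℝ} (ht : t ∈ Ico 0 d.T) :
    d.stressPot E t ≠ ⊤ :=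
  (h.strain_le hw (Φ := fun _ => 0) contDiffOn_const ht
    (by rw [h.potVal_dev_zero]; exact ENNReal.zero_ne_top)).1

/-- The strain-rate equation tested with spherical matrices. -/
lemma weakStrain_idSym (hw : d.IsWeakSolution v E) {t : ℝ} (ht : t ∈ Ico 0 d.T) {q : Vec → ℝ}
    (hq : ContDiffOn ℝ 1 q (closure d.Ω)) :
    d.weakStrain v E dE t (fun x => q x • idSym) = 0 := by
  have ht' := Ico_subset_Icc_self ht
  have hS := (h.contDiffOn_stress ht').of_le (m := 1) (by norm_num)
  have hqI : ContDiffOn ℝ 1 (fun x => q x • idSym) (closure d.Ω) := hq.smul contDiffOn_const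
  refine eq_zero_of_forall_int_mul_le (Z := 0)
    (X := d.weakStrain v E dE t (d.stress E t) + (d.stressPot E t).toReal) fun n => ?_
  -- The sign is chosen because the test enters as stress minus test; the deviator of any multiple
  -- is zero, so the right-hand side does not grow with n.
  have hqn : ContDiffOn ℝ 1 (fun x => (-n : ℝ) • (q x • idSym)) (closure d.Ω) :=
    hqI.const_smul (-n : ℝ)
  have hdev : (fun x => dev ((-n : ℝ) • (q x • idSym))) = fun _ : Vec => dev 0 := by
    funext x
    rw [← devL_apply, map_smul, map_smul, devL_apply, dev_idSym, smul_zero, smul_zero,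
      show dev 0 = 0 from devL.map_zero]
  have key := h.weakStrain_le hw hqn ht (by
    rw [hdev, h.potVal_dev_zero]; exact ENNReal.zero_ne_top)
  rw [hdev, h.potVal_dev_zero, h.weakStrain_sub ht' hS hqn, h.weakStrain_smul hqI,
    ENNReal.toReal_zero] at key
  linarith

/-- The spherical part of the test contributes nothing, by `weakStrain_idSym`. -/
lemma weakStrain_eq_dev (hw : d.IsWeakSolution v E) {t : ℝ} (ht : t ∈ Ico 0 d.T) {Φ : Vec → Sym}
    (hΦ : ContDiffOn ℝ 1 Φ (closure d.Ω)) :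
    d.weakStrain v E dE t Φ = d.weakStrain v E dE t fun x => devIncl (dev (Φ x)) := by
  have ht' := Ico_subset_Icc_self ht
  have hq : ContDiffOn ℝ 1 (fun x => tr (Φ x) / 3) (closure d.Ω) :=
    (trL.contDiff.comp_contDiffOn hΦ).div_const 3
  have h1 := h.weakStrain_idSym hw ht hq
  have h2 : (fun x => devIncl (dev (Φ x))) = fun x => Φ x - (tr (Φ x) / 3) • idSym := by
    funext x
    exact eq_sub_of_add_eq (sym_eq_dev_add (Φ x)).symm
  have hqI : ContDiffOn ℝ 1 (fun x => (tr (Φ x) / 3) • idSym) (closure d.Ω) :=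
    hq.smul contDiffOn_const
  rw [h2, h.weakStrain_sub ht' hΦ hqI, h1, sub_zero]

lemma continuousOn_strainResidual {t : ℝ} (ht : t ∈ Icc 0 d.T) :
    ContinuousOn (d.strainResidual v E dE t) (closure d.Ω) :=
  (h.continuousOn_strainDefect ht).sub
    ((h.standing.domain.continuousOn_lapWithin (h.contDiffOn_stress ht)).const_smul d.γ)

/-- Integration by parts for test fields without boundary values. -/
lemma weakStrain_of_zero_frontier {t : ℝ} (ht : t ∈ Icc 0 d.T) {u : Vec → Sym}
    (hu : ContDiffOn ℝ 1 u (closure d.Ω)) (h0 : ∀ x ∈ frontier d.Ω, u x = 0) :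
    d.weakStrain v E dE t u = ∫ x in d.Ω, ⟪d.strainResidual v E dE t x, u x⟫ := by
  have hΩ := h.standing.domain
  have hS := h.contDiffOn_stress ht
  have h1 := hΩ.integral_tripleDot hS hu h0
  have i1 := hΩ.integrableOn ((h.continuousOn_strainResidual ht).inner (𝕜 := ℝ) hu.continuousOn)
  have i2 := hΩ.integrableOn (((hΩ.continuousOn_lapWithin hS).inner (𝕜 := ℝ) hu.continuousOn).add
    ((hΩ.continuousOn_fderivWithin (hS.of_le (by norm_num)) le_rfl).tripleDot
      (hΩ.continuousOn_fderivWithin hu le_rfl)))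
  have h2 := integral_add i1 (i2.const_mul d.γ)
  simp only [Pi.add_apply] at h2
  rw [integral_const_mul, h1, mul_zero, add_zero] at h2
  rw [← h2, weakStrain]
  refine integral_congr_ae (Eventually.of_forall fun x => ?_)
  simp only [strainResidual, inner_sub_left, sym_inner_smul_left]
  ring

/-- The strain-rate inequality for trace-free fields in `L¹`, with a perturbation of the boundary
values. -/
lemma residual_le (hP : HasApproximationProperty d.P) (hw : d.IsWeakSolution v E) {t : ℝ}
    (ht : t ∈ Ico 0 d.T) {H : Vec → Dev} (hH : ContDiffOn ℝ 2 H (closure d.Ω)) {A : DevL1 d.Ω}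
    (hA : d.P A ≠ ⊤) :
    (∫ x in d.Ω, ⟪dev (d.strainResidual v E dE t x), dev (d.stress E t x) + H x⟫)
      - (∫ x in d.Ω, ⟪dev (d.strainResidual v E dE t x), A x⟫)
      - d.weakStrain v E dE t (fun x => devIncl (H x)) + (d.stressPot E t).toReal
      ≤ (d.P A).toReal := by
  have hΩ := h.standing.domain
  have ht' := Ico_subset_Icc_self ht
  have hS := h.contDiffOn_stress ht'
  have hS1 : ContDiffOn ℝ 1 (d.stress E t) (closure d.Ω) := hS.of_le (by norm_num)
  have hH1 : ContDiffOn ℝ 1 H (closure d.Ω) := hH.of_le (by norm_num)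
  have hSd : ContDiffOn ℝ 2 (fun x => dev (d.stress E t x)) (closure d.Ω) :=
    devL.contDiff.comp_contDiffOn hS
  have hSd1 : ContDiffOn ℝ 1 (fun x => dev (d.stress E t x)) (closure d.Ω) :=
    hSd.of_le (by norm_num)
  have hG : ContDiffOn ℝ 2 (fun x => dev (d.stress E t x) + H x) (closure d.Ω) := hSd.add hH
  have hG1 : ContDiffOn ℝ 1 (fun x => dev (d.stress E t x) + H x) (closure d.Ω) :=
    hG.of_le (by norm_num)
  have hK : ContinuousOn (fun x => dev (d.strainResidual v E dE t x)) (closure d.Ω) :=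
    continuous_dev.comp_continuousOn (h.continuousOn_strainResidual ht')
  obtain ⟨hi, ℓ, hℓ⟩ := hΩ.exists_pairing hK
  -- The prescribed boundary values make dev S + H - Φ_j vanish on the frontier, where S is the
  -- stress. It can then be integrated by parts, after which Φ_j occurs only in the L¹ pairing with
  -- a bounded field and in P; both converge.
  obtain ⟨Φ, Φc, h1, h2, h3, h4, h5⟩ := hP A _ hG
  have hev : ∀ᶠ j in atTop, d.P (Φc j) ≠ ⊤ := by
    filter_upwards [h5.eventually (gt_mem_nhds hA.lt_top)] with j hj using hj.ne
  have hlim : Tendsto (fun j => (d.P (Φc j)).toReal) atTop (𝓝 (d.P A).toReal) :=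
    (ENNReal.tendsto_toReal hA).comp h5
  have hlim2 : Tendsto (fun j => (∫ x in d.Ω, ⟪dev (d.strainResidual v E dE t x),
      dev (d.stress E t x) + H x⟫) - ℓ (Φc j)
      - d.weakStrain v E dE t (fun x => devIncl (H x)) + (d.stressPot E t).toReal) atTop
      (𝓝 ((∫ x in d.Ω, ⟪dev (d.strainResidual v E dE t x), dev (d.stress E t x) + H x⟫) - ℓ A
      - d.weakStrain v E dE t (fun x => devIncl (H x)) + (d.stressPot E t).toReal)) :=
    (((tendsto_const_nhds.sub (h4 ℓ)).sub_const _).add_const _)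
  rw [← hℓ A]
  refine le_of_tendsto_of_tendsto hlim2 hlim ?_
  filter_upwards [hev] with j hj
  have hΦj : ContDiffOn ℝ 1 (fun x => devIncl (Φ j x)) (closure d.Ω) :=
    devIncl.contDiff.comp_contDiffOn (h1 j)
  have hpot : potVal d.P (fun x => dev (devIncl (Φ j x))) = d.P (Φc j) := by
    simp only [dev_devIncl]
    exact potVal_eq_of_ae _ (h3 j)
  have key := h.weakStrain_le hw hΦj ht (by rwa [hpot])
  rw [hpot, h.weakStrain_eq_dev hw ht (hS1.sub hΦj)] at key
  set u : Vec → Dev := fun x => dev (d.stress E t x) + H x - Φ j x with hu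
  have hu1 : ContDiffOn ℝ 1 (fun x => devIncl (u x)) (closure d.Ω) :=
    devIncl.contDiff.comp_contDiffOn (hG1.sub (h1 j))
  -- The test difference is split into a part without boundary values and the remainder -H, which
  -- keeps its gradient term.
  have e1 : (fun x => devIncl (dev (d.stress E t x - devIncl (Φ j x)))) =
      fun x => devIncl (u x) - devIncl (H x) := by
    funext x
    rw [← devL_apply, map_sub, devL_apply, devL_apply, dev_devIncl, hu, ← map_sub]
    congr 1
    change _ = dev (d.stress E t x) + H x - Φ j x - H x
    rw [add_sub_right_comm, add_sub_cancel_right]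
  have e2 := h.weakStrain_of_zero_frontier (v := v) (dE := dE) ht' hu1 fun x hx => by
    rw [hu]
    simp only
    rw [h2 j x hx, sub_self, map_zero]
  have e3 : ∫ x in d.Ω, ⟪d.strainResidual v E dE t x, devIncl (u x)⟫ =
      (∫ x in d.Ω, ⟪dev (d.strainResidual v E dE t x), dev (d.stress E t x) + H x⟫)
        - ℓ (Φc j) := by
    rw [hℓ, ← integral_sub (hΩ.integrableOn (hK.inner (𝕜 := ℝ) hG1.continuousOn)) (hi _)]
    refine integral_congr_ae ?_
    filter_upwards [h3 j] with x hx
    rw [inner_devIncl, hx, hu, inner_sub_right]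
  have hH2 : ContDiffOn ℝ 1 (fun x => devIncl (H x)) (closure d.Ω) :=
    devIncl.contDiff.comp_contDiffOn hH1
  rw [e1, h.weakStrain_sub ht' hu1 hH2, e2, e3] at key
  exact key

end IsRegular

end Data

end ViscoPlast
end

/-! ### Neumann condition and strain-rate inclusion -/

noncomputable section

namespace ViscoPlast

lemma IsLipschitzDomain.laplacian_eq {Ω : Set Vec} (h : IsLipschitzDomain Ω) {S : Vec → Sym}
    (hS : ContDiffOn ℝ 2 S (closure Ω)) {x : Vec} (hx : x ∈ Ω) : Δ S x = lapWithin Ω S x := by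
  have hSx : ContDiffAt ℝ 2 S x := (hS x (subset_closure hx)).contDiffAt (h.closure_mem_nhds hx)
  have hD : DifferentiableAt ℝ (fderiv ℝ S) x :=
    (hSx.fderiv_right (m := 1) (by norm_num)).differentiableAt (by norm_num)
  rw [InnerProductSpace.laplacian_eq_iteratedFDeriv_orthonormalBasis S
    (EuclideanSpace.basisFun (Fin 3) ℝ), lapWithin]
  refine Finset.sum_congr rfl fun k _ => ?_
  have h1 : (fun y => fderivWithin ℝ S (closure Ω) y (unitVec k)) =ᶠ[𝓝 x]
      fun y => fderiv ℝ S y (unitVec k) := by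
    filter_upwards [h.isOpen.mem_nhds hx] with y hy
    rw [fderivWithin_of_mem_nhds (h.closure_mem_nhds hy)]
  rw [fderivWithin_of_mem_nhds (h.closure_mem_nhds hx), h1.fderiv_eq, iteratedFDeriv_two_apply]
  have h2 : HasFDerivAt (fun y => fderiv ℝ S y (unitVec k)) _ x :=
    hD.hasFDerivAt.clm_apply (hasFDerivAt_const (unitVec k) x)
  rw [h2.fderiv]
  simp [unitVec]

namespace Data

variable {d : Data}

lemma dev_elasticStress (A : Sym) : dev (d.elasticStress A) = dev (gradient d.φ A) := by
  rw [elasticStress, ← devL_apply, map_add, map_smul, devL_apply, devL_apply, dev_idSym, smul_zero,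
    add_zero]

namespace IsRegular

variable {v dv : ℝ → Vec → Vec} {E dE : ℝ → Vec → Sym} (h : d.IsRegular v dv E dE)
include h

lemma continuousOn_dev_residual {t : ℝ} (ht : t ∈ Icc 0 d.T) :
    ContinuousOn (fun x => dev (d.strainResidual v E dE t x)) (closure d.Ω) :=
  continuous_dev.comp_continuousOn (h.continuousOn_strainResidual ht)

/-- The strain-rate equation tested with trace-free fields. -/
lemma weakStrain_devIncl (hP : HasApproximationProperty d.P) (hw : d.IsWeakSolution v E) {t : ℝ}
    (ht : t ∈ Ico 0 d.T) {H : Vec → Dev} (hH : ContDiffOn ℝ 2 H (closure d.Ω)) :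
    d.weakStrain v E dE t (fun x => devIncl (H x)) =
      ∫ x in d.Ω, ⟪dev (d.strainResidual v E dE t x), H x⟫ := by
  have hΩ := h.standing.domain
  have ht' := Ico_subset_Icc_self ht
  have hK := h.continuousOn_dev_residual (v := v) (dE := dE) ht'
  have hSd : ContinuousOn (fun x => dev (d.stress E t x)) (closure d.Ω) :=
    continuous_dev.comp_continuousOn (h.contDiffOn_stress ht').continuousOn
  have hm := hΩ.memLp_one hSd
  have hPA : d.P (hm.toLp _) = d.stressPot E t := (hΩ.potVal_eq hSd).symm
  have hdI : ContDiffOn ℝ 1 (fun x => devIncl (H x)) (closure d.Ω) :=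
    devIncl.contDiff.comp_contDiffOn (hH.of_le (by norm_num))
  have i1 := hΩ.integrableOn (hK.inner (𝕜 := ℝ) hSd)
  have i2 := hΩ.integrableOn (hK.inner (𝕜 := ℝ) hH.continuousOn)
  have e0 : ∫ x in d.Ω, ⟪dev (d.strainResidual v E dE t x), hm.toLp _ x⟫ =
      ∫ x in d.Ω, ⟪dev (d.strainResidual v E dE t x), dev (d.stress E t x)⟫ := by
    refine integral_congr_ae ?_
    filter_upwards [hm.coeFn_toLp] with x hx
    rw [hx]
  refine (sub_eq_zero.1 (eq_zero_of_forall_int_mul_le (X := 0) (Z := 0) fun n => ?_)).symm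
  have hnH : ContDiffOn ℝ 2 (fun x => (n : ℝ) • H x) (closure d.Ω) := hH.const_smul (n : ℝ)
  -- With A the deviatoric stress itself, the two potentials cancel and an inequality linear in n
  -- remains.
  have key := h.residual_le hP hw ht hnH (A := hm.toLp _) (by
    rw [hPA]; exact h.stressPot_ne_top hw ht)
  have e1 : (fun x => devIncl ((n : ℝ) • H x)) = fun x => (n : ℝ) • devIncl (H x) := by
    funext x; rw [map_smul]
  have e2 : ∫ x in d.Ω, ⟪dev (d.strainResidual v E dE t x), dev (d.stress E t x) + (n : ℝ) • H x⟫ =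
      (∫ x in d.Ω, ⟪dev (d.strainResidual v E dE t x), dev (d.stress E t x)⟫)
      + n * ∫ x in d.Ω, ⟪dev (d.strainResidual v E dE t x), H x⟫ := by
    rw [← integral_const_mul, ← integral_add i1 (i2.const_mul _)]
    refine integral_congr_ae (Eventually.of_forall fun x => ?_)
    simp only [inner_add_right, dev_inner_smul_right]
  rw [hPA, e0, e1, e2, h.weakStrain_smul hdI] at key
  linarith

lemma integral_bump_idSym (hw : d.IsWeakSolution v E) {t : ℝ} (ht : t ∈ Ico 0 d.T) {χ : Vec → ℝ}
    (hχ : ContDiff ℝ ∞ χ) :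
    ∫ y in d.Ω, (χ y * (d.γ⁻¹ * ⟪d.strainDefect v E dE t y, idSym⟫) + tripleDot
      (fderivWithin ℝ (d.stress E t) (closure d.Ω) y)
      (fderivWithin ℝ (fun y => χ y • idSym) (closure d.Ω) y)) = 0 := by
  have hγ := h.standing.γ_pos.ne'
  have h1 := h.weakStrain_idSym (dE := dE) hw ht (hχ.of_le (by norm_cast)).contDiffOn
  rw [← mul_zero d.γ⁻¹, ← h1, weakStrain, ← integral_const_mul]
  refine integral_congr_ae (Eventually.of_forall fun y => ?_)
  simp only [sym_inner_smul_right]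
  field_simp

/-- The strain defect occurs on both sides of `weakStrain_devIncl` and cancels. What remains says
that partial integration of the stress gradient against χB leaves no boundary term, although χ need
not vanish on the frontier. -/
lemma integral_bump_devIncl (hP : HasApproximationProperty d.P) (hw : d.IsWeakSolution v E) {t : ℝ}
    (ht : t ∈ Ico 0 d.T) (B : Dev) {χ : Vec → ℝ} (hχ : ContDiff ℝ ∞ χ) :
    ∫ y in d.Ω, (χ y * ⟪lapWithin d.Ω (d.stress E t) y, devIncl B⟫ + tripleDot
      (fderivWithin ℝ (d.stress E t) (closure d.Ω) y)
      (fderivWithin ℝ (fun y => χ y • devIncl B) (closure d.Ω) y)) = 0 := by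
  have hΩ := h.standing.domain
  have ht' := Ico_subset_Icc_self ht
  have hγ := h.standing.γ_pos.ne'
  have hH : ContDiffOn ℝ 2 (fun y => χ y • B) (closure d.Ω) :=
    ((hχ.of_le (by norm_cast)).smul contDiff_const).contDiffOn
  have h1 := h.weakStrain_devIncl hP hw ht hH
  have e1 : (fun y => devIncl (χ y • B)) = fun y => χ y • devIncl B := by
    funext y; rw [map_smul]
  have hdI : ContDiffOn ℝ 1 (fun y => χ y • devIncl B) (closure d.Ω) :=
    ((hχ.of_le (by norm_cast)).smul contDiff_const).contDiffOn
  rw [e1] at h1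
  have i1 := hΩ.integrableOn (h.continuousOn_weakStrain (dE := dE) ht' hdI)
  have i2 := hΩ.integrableOn ((h.continuousOn_dev_residual (dE := dE) ht').inner (𝕜 := ℝ)
    hH.continuousOn)
  have h2 := integral_sub i1 i2
  rw [weakStrain] at h1
  rw [h1, sub_self] at h2
  rw [← mul_zero d.γ⁻¹, ← h2, ← integral_const_mul]
  refine integral_congr_ae (Eventually.of_forall fun y => ?_)
  simp only
  rw [← inner_devIncl, map_smul, strainResidual, inner_sub_left, sym_inner_smul_right,
    sym_inner_smul_right, sym_inner_smul_left]
  field_simp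
  ring

/-- The Neumann condition for the stress. -/
lemma neumann (hP : HasApproximationProperty d.P) (hw : d.IsWeakSolution v E) {t : ℝ}
    (ht : t ∈ Ico 0 d.T) {x n : Vec} (hx : x ∈ closure d.Ω) (hn : IsOuterNormal d.Ω x n) :
    fderivWithin ℝ (d.stress E t) (closure d.Ω) x n = 0 := by
  have hΩ := h.standing.domain
  have ht' := Ico_subset_Icc_self ht
  have hS := h.contDiffOn_stress ht'
  have h1 := hΩ.inner_fderivWithin_normal_eq_zero hS
    (((h.continuousOn_strainDefect (dE := dE) ht').inner (𝕜 := ℝ)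
      (continuousOn_const (c := idSym))).const_mul d.γ⁻¹)
    (fun χ hχ => h.integral_bump_idSym hw ht hχ) hx hn
  set w := fderivWithin ℝ (d.stress E t) (closure d.Ω) x n with hwdef
  -- The direction B is the deviator of the normal derivative w itself; with the vanishing trace
  -- this gives |w|² = 0.
  have h2 := hΩ.inner_fderivWithin_normal_eq_zero hS
    ((hΩ.continuousOn_lapWithin hS).inner (𝕜 := ℝ) (continuousOn_const (c := devIncl (dev w))))
    (fun χ hχ => h.integral_bump_devIncl hP hw ht (dev w) hχ) hx hn
  have h3 : ⟪w, w⟫ = 0 := by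
    conv_lhs => rw [sym_eq_dev_add w, ← sym_eq_dev_add w]
    have : ⟪w, w⟫ = ⟪w, devIncl (dev w) + (tr w / 3) • idSym⟫ := by rw [← sym_eq_dev_add w]
    rw [this, inner_add_right, sym_inner_smul_right, h1, h2]
    simp
  exact inner_self_eq_zero.1 h3

/-- Spherical tests give the trace of the strain-rate equation pointwise, without plastic
contribution, so the residual is trace-free. -/
lemma strainResidual_eq (hw : d.IsWeakSolution v E) {t : ℝ} (ht : t ∈ Ico 0 d.T) {x : Vec}
    (hx : x ∈ d.Ω) :
    d.strainResidual v E dE t x = devIncl (dev (d.strainResidual v E dE t x)) := by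
  have hΩ := h.standing.domain
  have ht' := Ico_subset_Icc_self ht
  have hγ := h.standing.γ_pos.ne'
  have h1 := hΩ.eq_lapWithin_of_weak (h.contDiffOn_stress ht')
    (((h.continuousOn_strainDefect (dE := dE) ht').inner (𝕜 := ℝ)
      (continuousOn_const (c := idSym))).const_mul d.γ⁻¹)
    (fun χ hχ => h.integral_bump_idSym hw ht hχ) hx
  have h2 : tr (d.strainResidual v E dE t x) = 0 := by
    rw [← inner_idSym, strainResidual, inner_sub_left, sym_inner_smul_left, ← h1]
    field_simp
    ring
  conv_lhs => rw [sym_eq_dev_add (d.strainResidual v E dE t x), h2]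
  simp

/-- The strain-rate inclusion. -/
lemma strainRate (hP : HasApproximationProperty d.P) (hw : d.IsWeakSolution v E) {t : ℝ}
    (ht : t ∈ Ioo 0 d.T) : ∃ Ξ : Vec → Dev,
      IsSubgradient d.P (fun x => dev (d.elasticStress (E t x))) Ξ ∧
        ∀ x ∈ d.Ω, d.StrainRateAt v E Ξ t x := by
  have hΩ := h.standing.domain
  have htc := Ioo_subset_Ico_self ht
  have ht' := Ioo_subset_Icc_self ht
  have hK := h.continuousOn_dev_residual (dE := dE) ht'
  have hS := h.contDiffOn_stress ht'
  have hSd : ContinuousOn (fun x => dev (d.stress E t x)) (closure d.Ω) :=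
    continuous_dev.comp_continuousOn hS.continuousOn
  -- The plastic term must balance the residual, which is trace-free by `strainResidual_eq`; it is
  -- bounded because the residual is continuous up to the boundary.
  refine ⟨fun x => -dev (d.strainResidual v E dE t x), ⟨?_, ?_, fun B => ?_⟩, fun x hx => ?_⟩
  · obtain ⟨C, hC⟩ := hΩ.isCompact_closure.exists_bound_of_continuousOn hK
    refine memLp_top_of_bound (hΩ.integrableOn hK.neg).1 C ?_
    filter_upwards [ae_restrict_mem hΩ.isOpen.measurableSet] with x hx
    rw [norm_neg]
    exact hC x (subset_closure hx)
  · simp only [dev_elasticStress]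
    exact h.stressPot_ne_top hw htc
  · simp only [dev_elasticStress]
    by_cases hB : d.P B = ⊤
    · rw [hB]; exact le_top
    obtain ⟨hi, -⟩ := hΩ.exists_pairing hK
    have i1 := hΩ.integrableOn (hK.inner (𝕜 := ℝ) hSd)
    have hz := h.weakStrain_devIncl (dE := dE) hP hw htc (H := fun _ => 0) contDiffOn_const
    -- For H = 0 the weak term vanishes, and the inequality with arbitrary B is the subgradient
    -- inequality.
    have key := h.residual_le (dE := dE) hP hw htc (H := fun _ => 0) contDiffOn_const hB
    rw [hz] at key
    simp only [inner_zero_right, integral_zero, sub_zero, add_zero] at key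
    have e1 : ∫ x in d.Ω, ⟪-dev (d.strainResidual v E dE t x), B x - dev (gradient d.φ (E t x))⟫ =
        (∫ x in d.Ω, ⟪dev (d.strainResidual v E dE t x), dev (d.stress E t x)⟫)
        - ∫ x in d.Ω, ⟪dev (d.strainResidual v E dE t x), B x⟫ := by
      rw [← integral_sub i1 (hi B)]
      refine integral_congr_ae (Eventually.of_forall fun x => ?_)
      simp only [inner_neg_left, inner_sub_right, stress]
      ring
    rw [e1]
    change ((d.stressPot E t : ℝ≥0∞) : EReal) + _ ≤ _
    rw [← ENNReal.coe_toNNReal (h.stressPot_ne_top hw htc), ← ENNReal.coe_toNNReal hB,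
      EReal.coe_nnreal_eq_coe_real, EReal.coe_nnreal_eq_coe_real, ← EReal.coe_add,
      EReal.coe_le_coe_iff]
    change (d.stressPot E t).toReal + _ ≤ (d.P B).toReal
    linarith
  · have hx' := subset_closure hx
    have hn := hΩ.closure_mem_nhds hx
    have h1 := h.strainResidual_eq (dE := dE) hw htc hx
    have h2 : dE t x + fderivWithin ℝ (E t) (closure d.Ω) x (v t x)
        + corotSym (E t x) (fderivWithin ℝ (v t) (closure d.Ω) x)
        + devIncl (-dev (d.strainResidual v E dE t x))
        = symGrad (fderivWithin ℝ (v t) (closure d.Ω) x)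
          + d.γ • lapWithin d.Ω (d.stress E t) x := by
      rw [map_neg, ← h1, strainResidual, strainDefect]
      abel
    rw [StrainRateAt, (h.hasDerivAt_E ht hx').deriv, ← fderivWithin_of_mem_nhds (f := E t) hn,
      ← fderivWithin_of_mem_nhds (f := v t) hn]
    have h3 : Δ (fun y => gradient d.φ (E t y)) x = lapWithin d.Ω (d.stress E t) x :=
      hΩ.laplacian_eq hS hx
    rw [h3]
    exact congrArg Subtype.val h2

end IsRegular

end Data

end ViscoPlast
end

/-! ### The tangential traction on the slip boundary -/

noncomputable section

namespace ViscoPlast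

namespace Data

namespace IsRegular

variable {d : Data} {v dv : ℝ → Vec → Vec} {E dE : ℝ → Vec → Sym} (h : d.IsRegular v dv E dE)
include h

/-- The weak momentum equation at a fixed time. -/
lemma integral_momField (hw : d.IsWeakSolution v E) {ψ : ℝ → Vec → Vec} (hψ : d.IsVelocityTest ψ)
    {t : ℝ} (ht : t ∈ Ico 0 d.T) :
    ∫ x in d.Ω, (d.momField v dv E ψ (t, x) + ⟪d.forceField v dv E t x, ψ t x⟫) = 0 := by
  have hΩ := h.standing.domain
  have ht' := Ico_subset_Icc_self ht
  have hcf := continuousOn_slice_time h.continuousOn_forceField ht'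
  have hsub : Icc t t ⊆ Icc 0 d.T := by rw [Icc_self]; exact singleton_subset_iff.2 ht'
  have hp : Icc t t ×ˢ closure d.Ω ⊆ Ico 0 d.T ×ˢ closure d.Ω :=
    Set.prod_mono (by rw [Icc_self]; exact singleton_subset_iff.2 ht) subset_rfl
  have hψc := (hψ.1.contDiffOn ht).continuousOn
  have c1 : ContinuousOn (fun x => d.baseField v dv E dE (t, x)
      - ⟪d.forceField v dv E t x, v t x⟫) (closure d.Ω) :=
    (continuousOn_slice_time h.continuousOn_baseField ht').sub
      (hcf.inner (𝕜 := ℝ) (h.contDiffOn_v ht').continuousOn)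
  have c2 : ContinuousOn (fun x => d.momField v dv E ψ (t, x)
      + ⟪d.forceField v dv E t x, ψ t x⟫) (closure d.Ω) :=
    (continuousOn_slice_time (h.continuousOn_momField hsub (hψ.1.continuousOn.mono hp)
      ((hψ.1.continuousOn_fderivWithin h.uniqueDiffOn).mono hp)) (left_mem_Icc.2 le_rfl)).add
      (hcf.inner (𝕜 := ℝ) hψc)
  refine eq_zero_of_forall_int_mul_le (Z := 0)
    (X := (∫ x in d.Ω, (d.baseField v dv E dE (t, x) - ⟪d.forceField v dv E t x, v t x⟫))
      + (d.stressPot E t).toReal) fun n => ?_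
  have key := (h.stationary_le hw (hψ.const_smul (n : ℝ)) (Φ := fun _ => 0) contDiffOn_const ht
    (by rw [h.potVal_dev_zero]; exact ENNReal.zero_ne_top)).2
  rw [h.potVal_dev_zero, ENNReal.toReal_zero] at key
  refine le_trans (le_of_eq ?_) key
  have e1 : ∫ x in d.Ω, d.coreField v dv E dE (d.forceField v dv E) (fun t x => (n : ℝ) • ψ t x)
      (fun _ _ => 0) (t, x) =
      (∫ x in d.Ω, (d.baseField v dv E dE (t, x) - ⟪d.forceField v dv E t x, v t x⟫))
      + n * ∫ x in d.Ω, (d.momField v dv E ψ (t, x) + ⟪d.forceField v dv E t x, ψ t x⟫) := by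
    rw [← integral_const_mul, ← integral_add (hΩ.integrableOn c1)
      ((hΩ.integrableOn c2).const_mul _)]
    refine setIntegral_congr_fun hΩ.isOpen.measurableSet fun x hx => ?_
    have hx' := subset_closure hx
    have hdiff := ((hψ.1.contDiffOn ht) x hx').differentiableWithinAt (by norm_num)
    simp only [coreField]
    rw [h.momField_smul (p := (t, x)) hx' hdiff, d.strainField_zero, inner_sub_right,
      real_inner_smul_right]
    ring
  rw [e1]
  ring

/-- The tangential traction vanishes at the regular points of the slip boundary. -/
lemma traction (hw : d.IsWeakSolution v E) {t : ℝ} (ht : t ∈ Ioo 0 d.T) {x : Vec}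
    (hx : x ∈ d.regularSlipSet) : d.TangentialTractionFreeAt v E t x := by
  intro n hn a
  have hΩ := h.standing.domain
  have htc := Ioo_subset_Ico_self ht
  have ht' := Ioo_subset_Icc_self ht
  obtain ⟨hxN, ⟨g, hg, hsub⟩, ε₁, hε₁, hnull⟩ := hx
  have hxf : x ∈ frontier d.Ω := hxN.1
  have hxc := frontier_subset_closure hxf
  obtain ⟨A, ε, hc⟩ := hsub.exists_chart
  have hε := hc.pos
  set H := graphFun A g with hHdef
  set e := upVec A with hedef
  have hH2 : ContDiff ℝ 2 H := contDiff_graphFun A hg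
  have hHd : ∀ y, HasFDerivAt H (fderiv ℝ H y) y := fun y =>
    (hH2.differentiable (by norm_num) y).hasFDerivAt
  have hH0 : ∀ y ∈ Metric.ball x ε, y ∈ frontier d.Ω → H y = 0 := fun y hy hyf =>
    hc.eq_zero_of_mem_frontier hH2.continuous hy hyf
  have hxb : x ∈ Metric.ball x ε := Metric.mem_ball_self hε
  set b : Vec := a - ⟪a, n⟫ • n with hb
  have hnn : ⟪n, n⟫ = 1 := by rw [real_inner_self_eq_norm_sq, hn.1, one_pow]
  have hbn : ⟪b, n⟫ = 0 := by
    rw [hb, inner_sub_left, real_inner_smul_left, hnn, mul_one, sub_self]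
  -- The tangential traction b is extended to a field in the kernel of the derivative of H: since
  -- that derivative maps e to -1, adding a vertical multiple corrects b. The field w is of class C¹
  -- because the boundary is C².
  set w : Vec → Vec := fun y => b + (fderiv ℝ H y b) • e with hwdef
  have hw1 : ContDiff ℝ 1 w := contDiff_const.add
    (((hH2.fderiv_right (m := 1) (by norm_num)).clm_apply contDiff_const).smul contDiff_const)
  have hwx : w x = b := by
    simp only [hwdef]
    rw [hc.apply_eq_zero hxb (hH0 x hxb hxf) (hHd x) hn hbn, zero_smul, add_zero]
  have hwt : ∀ y ∈ Metric.ball x ε, y ∈ frontier d.Ω → ∀ n', IsOuterNormal d.Ω y n' →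
      ⟪w y, n'⟫ = 0 := fun y hy hyf n' hn' => by
    refine hc.inner_eq_zero hy (hH0 y hy hyf) (hHd y) hn' ?_
    simp only [hwdef]
    rw [map_add, map_smul, hc.hasFDerivAt_apply (hHd y)]
    simp
  have hvn := (h.isTangentialField hw ht').inner_eq_zero hΩ hxc hn
  have hF : ContDiffOn ℝ 1 (d.momFlux v E t w) (closure d.Ω) :=
    h.contDiffOn_momFlux ht' hw1.contDiffOn
  have hflux := hΩ.inner_eq_zero_of_flux hxc hn hF.continuousOn
    (continuous_divg.comp_continuousOn (hΩ.continuousOn_fderivWithin hF le_rfl)) (by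
    filter_upwards [Ioo_mem_nhdsGT (lt_min hε hε₁)] with r hr
    have hr1 : r < ε := hr.2.trans_le (min_le_left _ _)
    have hr2 : r < ε₁ := hr.2.trans_le (min_le_right _ _)
    have hbump : ContDiff ℝ 1 (bumpAt x r) := contDiff_bumpAt (n := 1) x r
    set ψ : ℝ → Vec → Vec := fun t' y => timeCutoff t ((t + d.T) / 2) t' • (bumpAt x r y • w y)
      with hψdef
    have hbw : ContDiffOn ℝ 1 (fun y => bumpAt x r y • w y) (closure d.Ω) :=
      (hbump.smul hw1).contDiffOn
    have hψ : d.IsVelocityTest ψ := by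
      refine ⟨isTestFunction_timeCutoff (contDiffOn_uncurry_const hbw _) ht.2,
        fun t' _ => ?_, fun t' _ => ?_⟩
      -- The bump is supported in a ball that meets the Dirichlet part only in a null set, so the
      -- no-slip requirement holds almost everywhere.
      · have hnull' : (surf.restrict d.ΓD) (Metric.ball x ε₁) = 0 := by
          rwa [Measure.restrict_apply Metric.isOpen_ball.measurableSet]
        filter_upwards [measure_eq_zero_iff_ae_notMem.1 hnull'] with y hy
        have : bumpAt x r y = 0 :=
          bumpAt_eq_zero hr.1 fun hm => hy (Metric.ball_subset_ball hr2.le hm)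
        simp [hψdef, this]
      · filter_upwards [ae_restrict_mem h.standing.measurableSet_ΓN] with y hy n' hn'
        simp only [hψdef]
        by_cases hyb : y ∈ Metric.ball x r
        · rw [real_inner_smul_left, real_inner_smul_left,
            hwt y (Metric.ball_subset_ball hr1.le hyb) hy.1 n' hn', mul_zero, mul_zero]
        · simp [bumpAt_eq_zero hr.1 hyb]
    have hone : timeCutoff t ((t + d.T) / 2) t = 1 :=
      timeCutoff_eq_one (by linarith [ht.2]) (by linarith [ht.2])
    have hψt : ψ t = fun y => bumpAt x r y • w y := by
      simp only [hψdef, hone, one_smul]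
    have hψc : ContDiffOn ℝ 1 (ψ t) (closure d.Ω) := by rw [hψt]; exact hbw
    rw [← h.integral_momField hw hψ htc]
    refine setIntegral_congr_fun hΩ.isOpen.measurableSet fun y hy => ?_
    have e1 : d.momFlux v E t (ψ t) = fun y => bumpAt x r y • d.momFlux v E t w y := by
      funext y
      rw [hψt]
      simp only [momFlux]
      rw [real_inner_smul_right, smul_sub, smul_smul,
        show matVec (d.stressField v E t y) (bumpAt x r y • w y) =
          bumpAt x r y • matVec (d.stressField v E t y) (w y) from
          (matVecL (d.stressField v E t y)).map_smul _ _]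
      congr 2
      ring
    have e2 := divg_fderiv_smul ((hbump.differentiable (by norm_num) y).hasFDerivAt)
      (hΩ.hasFDerivAt hF hy)
    change _ = d.momField v dv E ψ (t, y) + _
    rw [← h.divg_momFlux ht' hψc hy, e1, fderivWithin_of_mem_nhds (𝕜 := ℝ)
      (f := fun y => bumpAt x r y • d.momFlux v E t w y) (hΩ.closure_mem_nhds hy), e2]
    simp only [Function.comp_apply]
    ring)
  -- At x the convective part of the flux has no normal component as v is tangential, and the
  -- symmetric stress moves to n. Hence b is orthogonal to the traction; being also orthogonal to n,
  -- it vanishes.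
  rw [momFlux, hwx, inner_sub_left, real_inner_smul_left, hvn, mul_zero, zero_sub, neg_eq_zero,
    inner_matVec] at hflux
  have hab : ⟪b, a⟫ = 0 := hflux
  have hbb : ⟪b, b⟫ = 0 := by
    conv_lhs => rw [hb, inner_sub_right, real_inner_smul_right, ← hb, hab, hbn]
    simp
  exact inner_self_eq_zero.1 hbb

end IsRegular

end Data

end ViscoPlast
end

noncomputable section

namespace ViscoPlast

/-! ### Convex functions -/

lemma ConvexOn.add_fderiv_le {F : Type*} [NormedAddCommGroup F] [NormedSpace ℝ F] {g : F → ℝ}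
    (hg : ConvexOn ℝ univ g) {A : F} (hd : DifferentiableAt ℝ g A) (B : F) :
    g A + fderiv ℝ g A (B - A) ≤ g B := by
  have h1 : HasDerivAt (fun t : ℝ => g (A + t • (B - A))) (fderiv ℝ g A (B - A)) 0 := by
    have h2 : HasDerivAt (fun t : ℝ => A + t • (B - A)) (B - A) 0 := by
      simpa using ((hasDerivAt_id (0 : ℝ)).smul_const (B - A)).const_add A
    have h3 : HasFDerivAt g (fderiv ℝ g A) (A + (0 : ℝ) • (B - A)) := by
      simpa using hd.hasFDerivAt
    exact h3.comp_hasDerivAt 0 h2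
  suffices fderiv ℝ g A (B - A) ≤ g B - g A by linarith
  refine le_of_tendsto h1.tendsto_slope_zero_right ?_
  have h4 : ∀ᶠ t : ℝ in 𝓝[>] 0, t ∈ Ioo (0 : ℝ) 1 := Ioo_mem_nhdsGT one_pos
  filter_upwards [h4] with t ht
  have h5 := hg.2 (mem_univ A) (mem_univ B) (sub_nonneg.2 ht.2.le) ht.1.le (by ring)
  have h6 : (1 - t) • A + t • B = A + (0 + t) • (B - A) := by module
  rw [h6, smul_eq_mul, smul_eq_mul] at h5
  rw [smul_eq_mul, inv_mul_le_iff₀ ht.1, zero_smul, add_zero]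
  linarith

/-- This is the tangent inequality for the convex function φ - κ/2 |·|² at A; the quadratic terms
combine to κ/2 |B - A|². -/
lemma IsStoredEnergy.exists_quadratic_le {φ : Sym → ℝ} (hφ : IsStoredEnergy φ) :
    ∃ κ > 0, ∀ A B : Sym, κ * ‖B - A‖ ^ 2 ≤ φ B - φ A + ⟪A - B, gradient φ A⟫ := by
  obtain ⟨κ, hκ, hc⟩ := hφ.stronglyConvex
  refine ⟨κ / 2, by positivity, fun A B => ?_⟩
  have hA : HasFDerivAt φ (fderiv ℝ φ A) A :=
    (hφ.contDiff.differentiable (by norm_num) A).hasFDerivAt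
  have h1 : HasFDerivAt (fun A => φ A - κ / 2 * ‖A‖ ^ 2) _ A := hA.sub (((hasStrictFDerivAt_norm_sq A).hasFDerivAt).const_mul (κ / 2))
  have h2 := ConvexOn.add_fderiv_le hc h1.differentiableAt B
  have h3 : fderiv ℝ (fun A => φ A - κ / 2 * ‖A‖ ^ 2) A (B - A) =
      fderiv ℝ φ A (B - A) - κ * ⟪A, B - A⟫ := by
    rw [h1.fderiv]
    simp
    ring
  rw [h3] at h2
  have h4 : ⟪A - B, gradient φ A⟫ = -fderiv ℝ φ A (B - A) := by
    rw [real_inner_comm, Data.inner_gradient, ← map_neg, neg_sub]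
  have h5 : ‖B‖ ^ 2 = ‖A‖ ^ 2 + 2 * ⟪A, B - A⟫ + ‖B - A‖ ^ 2 := by
    rw [← norm_add_sq_real, add_sub_cancel]
  rw [h4]
  rw [h5] at h2
  linarith

/-! ### The fundamental lemma of the calculus of variations -/

lemma ae_eq_zero_of_integral_mul_inner {F : Type*} [NormedAddCommGroup F] [InnerProductSpace ℝ F]
    [CompleteSpace F] {Ω : Set Vec} (hΩ : IsOpen Ω) {u : Vec → F} (hu : IntegrableOn u Ω)
    (h : ∀ χ : Vec → ℝ, ContDiff ℝ ∞ χ → HasCompactSupport χ → tsupport χ ⊆ Ω → ∀ w : F,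
      ∫ x in Ω, χ x * ⟪u x, w⟫ = 0) : ∀ᵐ x ∂(volume.restrict Ω), u x = 0 := by
  rw [ae_restrict_iff' hΩ.measurableSet]
  refine hΩ.ae_eq_zero_of_integral_contDiff_smul_eq_zero (IntegrableOn.locallyIntegrableOn hu)
    fun χ hχ hχc hχs => ?_
  have hχ0 : ∀ x, x ∉ Ω → χ x • u x = 0 := fun x hx => by
    rw [image_eq_zero_of_notMem_tsupport fun hm => hx (hχs hm), zero_smul]
  have hi : IntegrableOn (fun x => χ x • u x) Ω := by
    obtain ⟨C, hC⟩ := hχ.continuous.bounded_above_of_compact_support hχc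
    exact hu.bdd_smul C hχ.continuous.aestronglyMeasurable (Eventually.of_forall hC)
  rw [← setIntegral_eq_integral_of_forall_compl_eq_zero hχ0]
  refine ext_inner_left ℝ fun w => ?_
  rw [inner_zero_right, ← integral_inner hi]
  refine Eq.trans ?_ (h χ hχ hχc hχs w)
  refine integral_congr_ae (Eventually.of_forall fun x => ?_)
  simp only [inner_smul_right]
  rw [real_inner_comm]

lemma IsLipschitzDomain.integrableOn_inner {F : Type*} [NormedAddCommGroup F]
    [InnerProductSpace ℝ F] {Ω : Set Vec} (h : IsLipschitzDomain Ω) {u w : Vec → F}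
    (hu : IntegrableOn u Ω) (hw : ContinuousOn w (closure Ω)) :
    IntegrableOn (fun x => ⟪u x, w x⟫) Ω := by
  obtain ⟨C, hC⟩ := h.isCompact_closure.exists_bound_of_continuousOn hw
  refine (hu.norm.mul_const C).mono' (hu.1.inner (h.integrableOn hw).1) ?_
  filter_upwards [ae_restrict_mem h.isOpen.measurableSet] with x hx
  refine (norm_inner_le_norm _ _).trans ?_
  gcongr
  exact hC x (subset_closure hx)

lemma IsLipschitzDomain.eq_zero_of_mem_frontier {Ω : Set Vec} (h : IsLipschitzDomain Ω)
    {χ : Vec → ℝ} (hχ : tsupport χ ⊆ Ω) {x : Vec} (hx : x ∈ frontier Ω) : χ x = 0 := by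
  rw [h.isOpen.frontier_eq] at hx
  exact image_eq_zero_of_notMem_tsupport fun hm => hx.2 (hχ hm)

/-! ### Initial conditions -/

namespace Data

variable {d : Data}

lemma Standing.integrableOn_φ (hd : d.Standing) : IntegrableOn (fun x => d.φ (d.E₀ x)) d.Ω := by
  refine hd.finite_energy.mono' (hd.energy.contDiff.continuous.comp_aestronglyMeasurable
    hd.E₀_integrable.1) (Eventually.of_forall fun x => ?_)
  rw [Real.norm_eq_abs, abs_of_nonneg (hd.energy.nonneg _), energyDensity]
  have := hd.ρ_pos
  nlinarith [sq_nonneg ‖d.v₀ x‖]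

namespace IsRegular

variable {v dv : ℝ → Vec → Vec} {E dE : ℝ → Vec → Sym} (h : d.IsRegular v dv E dE)
include h

lemma continuousOn_v_zero : ContinuousOn (v 0) (closure d.Ω) :=
  (h.v_mem.1 0 ⟨le_rfl, h.standing.T_pos.le⟩).continuousOn

lemma continuousOn_E_zero : ContinuousOn (E 0) (closure d.Ω) :=
  (h.E_mem.1 0 ⟨le_rfl, h.standing.T_pos.le⟩).continuousOn

lemma integrableOn_v_defect : IntegrableOn (fun x => d.v₀ x - v 0 x) d.Ω :=
  h.standing.v₀_integrable.sub (h.standing.domain.integrableOn h.continuousOn_v_zero)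

lemma integrableOn_E_defect : IntegrableOn (fun x => d.E₀ x - E 0 x) d.Ω :=
  h.standing.E₀_integrable.sub (h.standing.domain.integrableOn h.continuousOn_E_zero)

/-- The inequality for the initial data. -/
lemma initial_le (hw : d.IsWeakSolution v E) {ψ : Vec → Vec}
    (hψ : ContDiffOn ℝ 1 ψ (closure d.Ω)) (hψ0 : ∀ x ∈ frontier d.Ω, ψ x = 0) {Φ : Vec → Sym}
    (hΦ : ContDiffOn ℝ 1 Φ (closure d.Ω)) (hfin : potVal d.P (fun x => dev (Φ x)) ≠ ⊤) :
    ((∫ x in d.Ω, d.energyDensity (v 0) (E 0) x) - ∫ x in d.Ω, d.energyDensity d.v₀ d.E₀ x)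
      + d.ρ * (∫ x in d.Ω, ⟪d.v₀ x - v 0 x, ψ x⟫) + (∫ x in d.Ω, ⟪d.E₀ x - E 0 x, Φ x⟫) ≤ 0 := by
  have hΩ := h.standing.domain
  have hT := h.standing.T_pos
  have hψt := isTestFunction_timeCutoff (contDiffOn_uncurry_const hψ (Icc 0 d.T)) hT
  have hψv := h.standing.isVelocityTest_of_zero_frontier hψt fun t _ x hx => by
    rw [hψ0 x hx, smul_zero]
  have key := h.energyPairing_initial_le hw hψv hΦ hfin
  have hone : (fun x => timeCutoff 0 ((0 + d.T) / 2) 0 • ψ x) = ψ := by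
    funext x
    rw [timeCutoff_eq_one (by linarith) (by linarith), one_smul]
  rw [hone] at key
  have hv := hΩ.integrableOn h.continuousOn_v_zero
  have hE := hΩ.integrableOn h.continuousOn_E_zero
  have e : ∀ {w : Vec → Vec} {B : Vec → Sym}, IntegrableOn w d.Ω → IntegrableOn B d.Ω →
      d.energyPairing w B ψ Φ = (∫ x in d.Ω, d.energyDensity w B x)
        - (d.ρ * (∫ x in d.Ω, ⟪w x, ψ x⟫) + ∫ x in d.Ω, ⟪B x, Φ x⟫) := by
    intro w B hw hB
    rw [energyPairing, integral_add ((hΩ.integrableOn_inner hw hψ.continuousOn).const_mul _)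
      (hΩ.integrableOn_inner hB hΦ.continuousOn), integral_const_mul]
  rw [e hv hE, e h.standing.v₀_integrable h.standing.E₀_integrable] at key
  have e1 : ∫ x in d.Ω, ⟪d.v₀ x - v 0 x, ψ x⟫ =
      (∫ x in d.Ω, ⟪d.v₀ x, ψ x⟫) - ∫ x in d.Ω, ⟪v 0 x, ψ x⟫ := by
    simp only [inner_sub_left]
    exact integral_sub (hΩ.integrableOn_inner h.standing.v₀_integrable hψ.continuousOn)
      (hΩ.integrableOn_inner hv hψ.continuousOn)
  have e2 : ∫ x in d.Ω, ⟪d.E₀ x - E 0 x, Φ x⟫ =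
      (∫ x in d.Ω, ⟪d.E₀ x, Φ x⟫) - ∫ x in d.Ω, ⟪E 0 x, Φ x⟫ := by
    simp only [inner_sub_left]
    exact integral_sub (hΩ.integrableOn_inner h.standing.E₀_integrable hΦ.continuousOn)
      (hΩ.integrableOn_inner hE hΦ.continuousOn)
  rw [e1, e2]
  linarith

/-- With zero strain test, integer multiples of χ w make the linear term in v₀ - v(0) vanish. -/
lemma initial_velocity (hw : d.IsWeakSolution v E) : v 0 =ᵐ[volume.restrict d.Ω] d.v₀ := by
  have hΩ := h.standing.domain
  have hz := ae_eq_zero_of_integral_mul_inner hΩ.isOpen h.integrableOn_v_defect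
    fun χ hχ hχc hχs w => by
      have hρ := h.standing.ρ_pos.ne'
      refine (mul_eq_zero.1 (eq_zero_of_forall_int_mul_le (X := (∫ x in d.Ω, d.energyDensity (v 0) (E 0) x)
        - ∫ x in d.Ω, d.energyDensity d.v₀ d.E₀ x) (Z := 0)
        (Y := d.ρ * ∫ x in d.Ω, χ x * ⟪d.v₀ x - v 0 x, w⟫) fun n => ?_)).resolve_left hρ
      have key := h.initial_le hw (ψ := fun x => ((n : ℝ) * χ x) • w)
        ((contDiff_const.mul (hχ.of_le (by norm_cast))).smul contDiff_const).contDiffOn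
        (fun x hx => by rw [hΩ.eq_zero_of_mem_frontier hχs hx, mul_zero, zero_smul])
        (Φ := fun _ => 0) contDiffOn_const
        (by rw [h.potVal_dev_zero]; exact ENNReal.zero_ne_top)
      simp only [inner_zero_right, integral_zero, add_zero, real_inner_smul_right, mul_assoc] at key
      rw [integral_const_mul] at key
      refine le_trans (le_of_eq ?_) key
      ring
  filter_upwards [hz] with x hx using (sub_eq_zero.1 hx).symm

/-- Finiteness of P on all smooth tests permits arbitrary multiples of a test, and `initial_le`
contains no potential that could grow with them. -/
lemma initial_strain_of_smooth (hw : d.IsWeakSolution v E)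
    (hfin : ∀ Φ : Vec → Dev, ContDiff ℝ ∞ Φ → HasCompactSupport Φ → tsupport Φ ⊆ d.Ω →
      potVal d.P Φ ≠ ⊤) : E 0 =ᵐ[volume.restrict d.Ω] d.E₀ := by
  have hΩ := h.standing.domain
  have hz := ae_eq_zero_of_integral_mul_inner hΩ.isOpen h.integrableOn_E_defect
    fun χ hχ hχc hχs w => by
      refine eq_zero_of_forall_int_mul_le (X := (∫ x in d.Ω, d.energyDensity (v 0) (E 0) x)
        - ∫ x in d.Ω, d.energyDensity d.v₀ d.E₀ x) (Z := 0) fun n => ?_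
      have hdev : (fun x => dev (((n : ℝ) * χ x) • w)) = fun x => χ x • ((n : ℝ) • dev w) := by
        funext x
        rw [← devL_apply, map_smul, devL_apply, mul_comm, mul_smul]
      have key := h.initial_le hw (ψ := fun _ => 0) contDiffOn_const (fun _ _ => rfl)
        (Φ := fun x => ((n : ℝ) * χ x) • w)
        ((contDiff_const.mul (hχ.of_le (by norm_cast))).smul contDiff_const).contDiffOn
        (by
          rw [hdev]
          exact hfin _ (hχ.smul contDiff_const) hχc.smul_right
            ((tsupport_smul_subset_left χ _).trans hχs))
      simp only [inner_zero_right, integral_zero, mul_zero, add_zero, sym_inner_smul_right,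
        mul_assoc] at key
      rwa [integral_const_mul] at key
  filter_upwards [hz] with x hx using (sub_eq_zero.1 hx).symm

/-- Spherical tests have potential zero whatever P is, so the traces agree without any compatibility
condition. This allows the full stress to be replaced by its deviator in `initial_le_stress`. -/
lemma initial_trace (hw : d.IsWeakSolution v E) :
    ∀ᵐ x ∂(volume.restrict d.Ω), tr (d.E₀ x - E 0 x : Sym) = 0 := by
  have hΩ := h.standing.domain
  have hi : IntegrableOn (fun x => trL (d.E₀ x - E 0 x)) d.Ω :=
    trL.integrable_comp h.integrableOn_E_defect
  refine ae_eq_zero_of_integral_mul_inner (F := ℝ) hΩ.isOpen hi fun χ hχ hχc hχs w => ?_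
  refine eq_zero_of_forall_int_mul_le (X := (∫ x in d.Ω, d.energyDensity (v 0) (E 0) x)
        - ∫ x in d.Ω, d.energyDensity d.v₀ d.E₀ x) (Z := 0) fun n => ?_
  have hdev : (fun x => dev (((n : ℝ) * (χ x * w)) • idSym)) = fun _ : Vec => dev 0 := by
    funext x
    rw [← devL_apply, map_smul, devL_apply, dev_idSym, smul_zero,
      show dev 0 = 0 from devL.map_zero]
  have key := h.initial_le hw (ψ := fun _ => 0) contDiffOn_const (fun _ _ => rfl)
    (Φ := fun x => ((n : ℝ) * (χ x * w)) • idSym)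
    ((contDiff_const.mul ((hχ.of_le (by norm_cast)).mul contDiff_const)).smul
      contDiff_const).contDiffOn
    (by rw [hdev, h.potVal_dev_zero]; exact ENNReal.zero_ne_top)
  simp only [inner_zero_right, integral_zero, mul_zero, add_zero, sym_inner_smul_right,
    mul_assoc] at key
  rw [integral_const_mul] at key
  have e : ∀ x, χ x * ⟪tr (d.E₀ x - E 0 x : Sym), w⟫ = χ x * (w * ⟪d.E₀ x - E 0 x, idSym⟫) := by
    intro x
    rw [inner_idSym]
    rfl
  simp only [e]
  exact key

/-- The inequality for the initial data, with the initial stress as test function. -/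
lemma initial_le_stress (hP : HasApproximationProperty d.P) (hw : d.IsWeakSolution v E)
    (hb : MemLp d.E₀ ⊤ (volume.restrict d.Ω))
    (hfin : potVal d.P (fun x => dev (gradient d.φ (d.E₀ x))) ≠ ⊤) :
    IntegrableOn (fun x => ⟪d.E₀ x - E 0 x, gradient d.φ (d.E₀ x)⟫) d.Ω ∧
    ((∫ x in d.Ω, d.energyDensity (v 0) (E 0) x) - ∫ x in d.Ω, d.energyDensity d.v₀ d.E₀ x)
      + (∫ x in d.Ω, ⟪d.E₀ x - E 0 x, gradient d.φ (d.E₀ x)⟫) ≤ 0 := by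
  have hΩ := h.standing.domain
  have hm : MemLp (fun x => dev (gradient d.φ (d.E₀ x))) 1 (volume.restrict d.Ω) := by
    by_contra hm
    exact hfin (dif_neg hm)
  have hPA : d.P (hm.toLp _) ≠ ⊤ := by
    rwa [potVal, dif_pos hm] at hfin
  obtain ⟨C, hC⟩ := hΩ.isCompact_closure.exists_bound_of_continuousOn
    (continuous_dev.comp_continuousOn h.continuousOn_E_zero)
  have hKm : AEStronglyMeasurable (fun x => dev (d.E₀ x - E 0 x)) (volume.restrict d.Ω) :=
    continuous_dev.comp_aestronglyMeasurable h.integrableOn_E_defect.1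
  -- Boundedness of E₀ makes the deviatoric initial defect a bounded field, hence a continuous
  -- functional on L¹ to which weak convergence applies.
  have hKb : ∀ᵐ x ∂(volume.restrict d.Ω), ‖dev (d.E₀ x - E 0 x)‖ ≤
      ‖devL‖ * (eLpNormEssSup d.E₀ (volume.restrict d.Ω)).toReal + C := by
    have htop : eLpNormEssSup d.E₀ (volume.restrict d.Ω) ≠ ⊤ := by
      have := hb.2.ne
      rwa [eLpNorm_exponent_top] at this
    filter_upwards [ae_le_eLpNormEssSup (f := d.E₀) (μ := volume.restrict d.Ω),
      ae_restrict_mem hΩ.isOpen.measurableSet] with x hx hxΩ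
    rw [← devL_apply, map_sub]
    refine (norm_sub_le _ _).trans (add_le_add ((devL.le_opNorm _).trans ?_)
      (hC x (subset_closure hxΩ)))
    gcongr
    rw [← toReal_enorm]
    exact ENNReal.toReal_mono htop hx
  obtain ⟨hi, ℓ, hℓ⟩ := exists_pairing_of_bound hKm hKb
  have heq : (fun x => ⟪dev (d.E₀ x - E 0 x), hm.toLp _ x⟫) =ᵐ[volume.restrict d.Ω]
      fun x => ⟪d.E₀ x - E 0 x, gradient d.φ (d.E₀ x)⟫ := by
    filter_upwards [hm.coeFn_toLp, h.initial_trace hw] with x hx htr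
    rw [hx]
    conv_rhs => rw [sym_eq_dev_add (gradient d.φ (d.E₀ x)), inner_add_right,
      sym_inner_smul_right, inner_idSym, htr, inner_devIncl]
    rw [mul_zero, add_zero]
  refine ⟨(hi (hm.toLp _)).congr heq, ?_⟩
  rw [← integral_congr_ae heq, ← hℓ]
  obtain ⟨Φ, Φc, h1, h2, h3, h4, h5⟩ := hP (hm.toLp _) (fun _ => 0) contDiffOn_const
  refine le_of_tendsto ((h4 ℓ).const_add _) ?_
  filter_upwards [h5.eventually (gt_mem_nhds hPA.lt_top)] with j hj
  have hpot : potVal d.P (fun x => dev (devIncl (Φ j x))) = d.P (Φc j) := by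
    simp only [dev_devIncl]
    exact potVal_eq_of_ae _ (h3 j)
  have key := h.initial_le hw (ψ := fun _ => 0) contDiffOn_const (fun _ _ => rfl)
    (Φ := fun x => devIncl (Φ j x)) (devIncl.contDiff.comp_contDiffOn (h1 j))
    (by rw [hpot]; exact hj.ne)
  simp only [inner_zero_right, integral_zero, mul_zero, add_zero, inner_devIncl] at key
  rw [hℓ]
  refine le_trans (le_of_eq ?_) key
  congr 1
  refine integral_congr_ae ?_
  filter_upwards [h3 j] with x hx
  rw [hx]

/-- Since v(0) = v₀, the kinetic energies cancel. The integral of φ(E(0)) - φ(E₀) - Dφ(E₀) : (E(0) -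
E₀) is then nonpositive, whereas strong convexity bounds its integrand below by a multiple of |E(0)
- E₀|². -/
lemma initial_strain_of_bounded (hP : HasApproximationProperty d.P) (hw : d.IsWeakSolution v E)
    (hb : MemLp d.E₀ ⊤ (volume.restrict d.Ω))
    (hfin : potVal d.P (fun x => dev (gradient d.φ (d.E₀ x))) ≠ ⊤) :
    E 0 =ᵐ[volume.restrict d.Ω] d.E₀ := by
  have hΩ := h.standing.domain
  obtain ⟨hi, hle⟩ := h.initial_le_stress hP hw hb hfin
  obtain ⟨κ, hκ, hconv⟩ := h.standing.energy.exists_quadratic_le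
  have iE : IntegrableOn (fun x => d.φ (E 0 x)) d.Ω := hΩ.integrableOn
    (h.standing.energy.contDiff.continuous.comp_continuousOn h.continuousOn_E_zero)
  have i0 := h.standing.integrableOn_φ
  have iv : IntegrableOn (d.energyDensity (v 0) (E 0)) d.Ω := hΩ.integrableOn
    ((h.continuousOn_v_zero.norm.pow 2).const_mul _ |>.add
      (h.standing.energy.contDiff.continuous.comp_continuousOn h.continuousOn_E_zero))
  have e1 : (∫ x in d.Ω, d.energyDensity (v 0) (E 0) x)
      - ∫ x in d.Ω, d.energyDensity d.v₀ d.E₀ x =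
      ∫ x in d.Ω, (d.φ (E 0 x) - d.φ (d.E₀ x)) := by
    rw [← integral_sub iv h.standing.finite_energy]
    refine integral_congr_ae ?_
    filter_upwards [h.initial_velocity hw] with x hx
    rw [energyDensity, energyDensity, hx]
    ring
  have i3 : IntegrableOn (fun x => d.φ (E 0 x) - d.φ (d.E₀ x)) d.Ω := iE.sub i0
  rw [e1, ← integral_add i3 hi] at hle
  have hnn : ∀ x, 0 ≤ d.φ (E 0 x) - d.φ (d.E₀ x) + ⟪d.E₀ x - E 0 x, gradient d.φ (d.E₀ x)⟫ :=
    fun x => le_trans (by positivity) (hconv (d.E₀ x) (E 0 x))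
  have hz := (integral_eq_zero_iff_of_nonneg hnn (i3.add hi)).1
    (le_antisymm hle (integral_nonneg hnn))
  filter_upwards [hz] with x hx
  have h1 := hconv (d.E₀ x) (E 0 x)
  rw [hx, Pi.zero_apply] at h1
  have h2 : ‖E 0 x - d.E₀ x‖ ^ 2 = 0 :=
    le_antisymm (nonpos_of_mul_nonpos_right h1 hκ) (by positivity)
  exact sub_eq_zero.1 (norm_eq_zero.1 (pow_eq_zero_iff two_ne_zero |>.1 h2))

lemma initial_strain (hP : HasApproximationProperty d.P) (hw : d.IsWeakSolution v E)
    (hc : d.InitialStrainCompatible) : E 0 =ᵐ[volume.restrict d.Ω] d.E₀ :=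
  hc.elim (fun hc => h.initial_strain_of_bounded hP hw hc.1 hc.2)
    (h.initial_strain_of_smooth hw)

end IsRegular

end Data

end ViscoPlast
end

open ViscoPlast in
theorem proposition3p3 (d : ViscoPlast.Data) (hd : d.Standing)
    (hP : HasApproximationProperty d.P)
    (v : ℝ → Vec → Vec) (E : ℝ → Vec → Sym) (hw : d.IsWeakSolution v E)
    (hv : MemC1C2 d.Ω d.T v) (hE : MemC1C2 d.Ω d.T E) :
    -- momentum equation
    (∀ᵐ p ∂(cyl d.Ω d.T), d.MomentumAt v E p.1 p.2) ∧
    -- strain-rate inclusion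
    (∀ t ∈ Ioo 0 d.T, ∃ Ξ : Vec → Dev,
      IsSubgradient d.P (fun x => dev (d.elasticStress (E t x))) Ξ ∧
        ∀ x ∈ d.Ω, d.StrainRateAt v E Ξ t x) ∧
    -- no-slip condition
    (∀ t ∈ Ioo 0 d.T, ∀ᵐ x ∂(surf.restrict d.ΓD), v t x = 0) ∧
    -- slip conditions
    (∀ t ∈ Ioo 0 d.T, ∀ᵐ x ∂(surf.restrict d.ΓN), ∀ n, IsOuterNormal d.Ω x n → ⟪v t x, n⟫ = 0) ∧
    (∀ t ∈ Ioo 0 d.T, ∀ x ∈ d.regularSlipSet, d.TangentialTractionFreeAt v E t x) ∧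
    -- Neumann condition for the stress
    (∀ t ∈ Ioo 0 d.T, ∀ᵐ x ∂(surf.restrict (frontier d.Ω)), ∀ n, IsOuterNormal d.Ω x n →
      fderivWithin ℝ (fun y => gradient d.φ (E t y)) (closure d.Ω) x n = 0) ∧
    -- initial conditions
    v 0 =ᵐ[volume.restrict d.Ω] d.v₀ ∧
    (d.InitialStrainCompatible → E 0 =ᵐ[volume.restrict d.Ω] d.E₀) := by
  obtain ⟨hv, dv, hdv, hvd⟩ := hv
  obtain ⟨hE, dE, hdE, hEd⟩ := hE
  have h : d.IsRegular v dv E dE := ⟨hd, hv, hdv, hE, hdE, hvd, hEd⟩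
  refine ⟨h.momentumAt hw, fun t ht => h.strainRate hP hw ht,
    fun t ht => h.noslip hw (Ioo_subset_Icc_self ht),
    fun t ht => h.slip hw (Ioo_subset_Icc_self ht), fun t ht x hx => h.traction hw ht hx,
    fun t ht => ?_, h.initial_velocity hw, h.initial_strain hP hw⟩
  filter_upwards [ae_restrict_mem isClosed_frontier.measurableSet] with x hx n hn
  exact h.neumann hP hw (Ioo_subset_Ico_self ht) (frontier_subset_closure hx) hn
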